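/- Let $(M,g)$ be a smooth $n$-dimensional Riemannian spin manifold, possibly with boundary, with a fixed spin structure, let $\nabla$ also denote its Levi-Civita connection, and let $k$ be a smooth symmetric $2$-tensor on $M$. Let $\slashed{S}_M\to M$ be the complex spinor bundle with the connection induced by the Levi-Civita connection and with Clifford multiplication $c_{\slashed S}$, normalized by $c_{\slashed S}(\omega)^2=-|\omega|^2$, and let $E\to M$ be a smooth Hermitian vector bundle with a metric connection $\nabla^E$, with curvature $R^{E}$. On $S:=(\slashed{S}_M\otimes E)\oplus(\slashed{S}_M\otimes E)$ let $\nabla$ be the induced connection and put $$c(\omega)=\begin{pmatrix}0&c_{\slashed S}(\omega)\otimes \mathrm{id}_E\\ c_{\slashed S}(\omega)\otimes \mathrm{id}_E&0\end{pmatrix},\qquad \sigma=\begin{pmatrix}0&-i\\ i&0\end{pmatrix}.$$ In terms of a local orthonormal frame $(e_i)$ with dual coframe $(e^i)$, and with summation over repeated indices, let $$D=c(e^i)\nabla_{e_i},\qquad \widetilde\nabla_{e_i}=\nabla_{e_i}-\tfrac12k_{ij}c(e^j)\sigma,\qquad \widetilde D=c(e^i)\widetilde\nabla_{e_i},$$ $$2\mu=R_g-|k|_g^2+(\operatorname{tr}_gk)^2,\qquad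 J_i=(\operatorname{div}_gk-d(\operatorname{tr}_gk))_i,\qquad \mathcal R^E=\sum_{i<j}c(e^i)c(e^j)\,(\mathrm{id}\otimes R^{E}(e_i,e_j)),$$ where $R_g$ is the scalar curvature and $R(X,Y)=[\nabla_X,\nabla_Y]-\nabla_{[X,Y]}$. Formal adjoints are taken with respect to the $L^2$ inner products given by the Riemannian volume; they are tested on pairs of smooth sections one of which has compact support in the interior of $M$ (and in the open set in question). Then, for every smooth section $u$ of $S$: (i) $\widetilde\nabla_{X}u=\nabla_{X}u+\tfrac12\sigma c(k(X,\cdot))u$ for every tangent vector $X$, and $\widetilde Du=Du+\tfrac{\operatorname{tr}_gk}{2}\sigma u$. (ii) For every vector field $X$ that is smooth on an open set, the operators $\nabla_X$ and $\widetilde\nabla_X$ over that set have the formal adjoints $$(\nabla_X)^*u=-\nabla_Xu-(\operatorname{div}X)u,\qquad (\widetilde\nabla_X)^*u=-\widetilde\nabla_Xu-c(k(X,\cdot))\sigma u-(\operatorname{div}X)u .$$ The operators $\nabla$ and $\widetilde\nabla$ from sections of $S$ to $S$-valued $1$-forms have the formal adjoints $$\nabla^*\Psi=\sum_i\bigl(-\nabla_{e_i}(\Psi(e_i))+\Psi(\nabla_{e_i}e_i)\bigr),\qquad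 \widetilde\nabla^*\Psi=\sum_i\bigl(-\widetilde\nabla_{e_i}(\Psi(e_i))-k_{ij}c(e^j)\sigma\Psi(e_i)+\Psi(\nabla_{e_i}e_i)\bigr).$$ The operators $D$ and $\widetilde D$ are formally self-adjoint. (iii) $D^2u=\nabla^*\nabla u+\mathcal Ru$ with $\mathcal R=\tfrac14R_g+\mathcal R^E$, and $\widetilde D^2u=\widetilde\nabla^*\widetilde\nabla u+\widetilde{\mathcal R}u$ with $\widetilde{\mathcal R}=\tfrac12\bigl(\mu_E-J_ic(e^i)\sigma\bigr)$ and $\mu_E=\mu+2\mathcal R^E$. -/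

import Mathlib

open Bundle MeasureTheory Manifold
open scoped ContDiff Matrix

noncomputable section

/-! ### Clifford algebra and spinor module -/

/-- The quadratic form `v ↦ -|v|²` on `ℝⁿ`; its Clifford algebra satisfies `v² = -|v|²`, and
`spinGroup (euclidNeg n)` is `Spin(n)`. -/
def euclidNeg (n : ℕ) : QuadraticForm ℝ (Fin n → ℝ) :=
  QuadraticMap.weightedSumSquares ℝ (fun _ : Fin n => (-1 : ℝ))

/-- The `i`-th standard basis vector of `ℝⁿ` in the Clifford algebra. -/
def cliffBasis (n : ℕ) (i : Fin n) : CliffordAlgebra (euclidNeg n) :=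
  CliffordAlgebra.ι (euclidNeg n) (Pi.single i 1)

/-- A complex spinor module of `ℝⁿ`: a complex representation of the Clifford algebra of the
dimension `2^⌊n/2⌋` (it is automatically irreducible) in which vectors act by skew-Hermitian
matrices. -/
structure SpinorModule (n : ℕ) where
  /-- the representation -/
  rho : CliffordAlgebra (euclidNeg n) →ₐ[ℝ] Matrix (Fin (2 ^ (n / 2))) (Fin (2 ^ (n / 2))) ℂ
  skew : ∀ v : Fin n → ℝ, (rho (CliffordAlgebra.ι (euclidNeg n) v))ᴴ =
    -rho (CliffordAlgebra.ι (euclidNeg n) v)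

/-- The action of a matrix `A` on `ℂ^N ⊗ X = X^N`, i.e. `A ⊗ id`. -/
def matAct {N : ℕ} {X : Type*} [AddCommGroup X] [Module ℂ X]
    (A : Matrix (Fin N) (Fin N) ℂ) (w : Fin N → X) : Fin N → X :=
  fun a => ∑ b, A a b • w b

lemma matAct_add_left {N : ℕ} {X : Type*} [AddCommGroup X] [Module ℂ X]
    (A B : Matrix (Fin N) (Fin N) ℂ) (w : Fin N → X) :
    matAct (A + B) w = matAct A w + matAct B w := by
  ext a
  simp [matAct, add_smul, Finset.sum_add_distrib]

lemma matAct_smul_left {N : ℕ} {X : Type*} [AddCommGroup X] [Module ℂ X] (r : ℝ)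
    (A : Matrix (Fin N) (Fin N) ℂ) (w : Fin N → X) :
    matAct (r • A) w = r • matAct A w := by
  ext a
  simp [matAct, Finset.smul_sum, mul_smul]

section Manifold

variable {n : ℕ} {H : Type*} [TopologicalSpace H]
  (I : ModelWithCorners ℝ (EuclideanSpace ℝ (Fin n)) H)
  (M : Type*) [TopologicalSpace M] [ChartedSpace H M] [IsManifold I ∞ M]

/-! ### Riemannian volume -/

section Volume

variable [RiemannianBundle (fun x : M => TangentSpace I x)] [MeasurableSpace M]

/-- The Gram matrix `g_{ij}` of the coordinate vector fields of the chart at `x`, at the point of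
the chart with coordinates `y`. -/
def chartGram (x : M) (y : EuclideanSpace ℝ (Fin n)) : Matrix (Fin n) (Fin n) ℝ :=
  fun i j =>
    inner ℝ
      (mfderivWithin 𝓘(ℝ, EuclideanSpace ℝ (Fin n)) I (extChartAt I x).symm (Set.range I) y
        (EuclideanSpace.single i (1 : ℝ)) : TangentSpace I ((extChartAt I x).symm y))
      (mfderivWithin 𝓘(ℝ, EuclideanSpace ℝ (Fin n)) I (extChartAt I x).symm (Set.range I) y
        (EuclideanSpace.single j (1 : ℝ)) : TangentSpace I ((extChartAt I x).symm y))

/-- The Riemannian volume `√(det g_{ij}) dy¹ ⋯ dyⁿ` of the domain of the chart at `x`, extended by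
zero to `M`. -/
def chartVolume (x : M) : Measure M :=
  (((volume : Measure (EuclideanSpace ℝ (Fin n))).restrict (extChartAt I x).target).withDensity
    (fun y => ENNReal.ofReal (Real.sqrt (chartGram I M x y).det))).map (extChartAt I x).symm

/-- The Riemannian volume measure of `M`: the smallest measure that dominates the Riemannian volume
of every chart domain. As the chart volumes agree on overlaps, it restricts to each of them. -/
def riemannianVolume : Measure M := ⨆ x : M, chartVolume I M x

end Volume

/-! ### Connections and curvature -/

section Curvature

variable {I M}
variable {F : Type*} [NormedAddCommGroup F] [NormedSpace ℝ F]
  {V : M → Type*} [TopologicalSpace (TotalSpace F V)]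
  [∀ x, AddCommGroup (V x)] [∀ x, Module ℝ (V x)] [∀ x, TopologicalSpace (V x)]
  [∀ x, IsTopologicalAddGroup (V x)] [∀ x, ContinuousSMul ℝ (V x)] [FiberBundle F V]

/-- The section `s` of the bundle `V` is smooth on the set `U`. -/
def SmoothSectionOn (I : ModelWithCorners ℝ (EuclideanSpace ℝ (Fin n)) H)
    (F : Type*) [NormedAddCommGroup F] [NormedSpace ℝ F]
    {V : M → Type*} [TopologicalSpace (TotalSpace F V)] [∀ x, TopologicalSpace (V x)]
    [FiberBundle F V] (s : Π x : M, V x) (U : Set M) : Prop :=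
  ContMDiffOn I (I.prod 𝓘(ℝ, F)) ∞ (fun x => (TotalSpace.mk' F x (s x) : TotalSpace F V)) U

/-- `R(X, Y) s = ∇_X ∇_Y s - ∇_Y ∇_X s - ∇_{[X, Y]} s`. -/
def curvatureOp (cov : CovariantDerivative I F V) (X Y : Π x : M, TangentSpace I x)
    (s : Π x : M, V x) (x : M) : V x :=
  cov (fun y => cov s y (Y y)) x (X x) - cov (fun y => cov s y (X y)) x (Y x)
    - cov s x (VectorField.mlieBracket I X Y x)

/-- `(∇_X k)(Y, Z) = X(k(Y, Z)) - k(∇_X Y, Z) - k(Y, ∇_X Z)` for a 2-tensor `k`. -/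
def covTwoTensor
    (lc : CovariantDerivative I (EuclideanSpace ℝ (Fin n)) (TangentSpace I : M → Type _))
    (k : Π x : M, TangentSpace I x →L[ℝ] TangentSpace I x →L[ℝ] ℝ)
    (X Y Z : Π x : M, TangentSpace I x) (x : M) : ℝ :=
  mvfderiv I (fun y => k y (Y y) (Z y)) x (X x)
    - k x (lc Y x (X x)) (Z x) - k x (Y x) (lc Z x (X x))

end Curvature

/-! ### Spin structures -/

/-- A spin structure on the Riemannian manifold `M`, as a lift to `Spin(n)` of the cocycle of
transition functions of a family of local orthonormal frames: `frame α` is a frame over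
`baseSet α`, the transition from `frame β` to `frame α` is covered by `lift α β`, and the lifts form
a smooth cocycle. (As `Spin(n)` covers `SO(n)`, the frames define an orientation.)
As in Mathlib's `VectorBundleCore`, `indexAt x` is a chosen trivialization around `x`. -/
structure SpinStructure (κ : Type*) [RiemannianBundle (fun x : M => TangentSpace I x)] where
  /-- the domains of the local trivializations -/
  baseSet : κ → Set M
  isOpen_baseSet : ∀ α, IsOpen (baseSet α)
  /-- a trivialization around each point -/
  indexAt : M → κ
  mem_baseSet_at : ∀ x, x ∈ baseSet (indexAt x)
  /-- the local orthonormal frames `e₁, …, eₙ` -/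
  frame : κ → Fin n → Π x : M, TangentSpace I x
  smooth_frame : ∀ α i, SmoothSectionOn I (EuclideanSpace ℝ (Fin n)) (frame α i) (baseSet α)
  orthonormal_frame : ∀ α, ∀ x ∈ baseSet α, Orthonormal ℝ (fun i => frame α i x)
  /-- the `Spin(n)`-valued transition functions -/
  lift : κ → κ → M → CliffordAlgebra (euclidNeg n)
  lift_mem : ∀ α β, ∀ x ∈ baseSet α ∩ baseSet β, lift α β x ∈ spinGroup (euclidNeg n)
  smooth_lift : ∀ α β, ∀ l : CliffordAlgebra (euclidNeg n) →ₗ[ℝ] ℝ,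
    ContMDiffOn I 𝓘(ℝ, ℝ) ∞ (fun x => l (lift α β x)) (baseSet α ∩ baseSet β)
  lift_conj : ∀ α β, ∀ x ∈ baseSet α ∩ baseSet β, ∀ j,
    lift α β x * cliffBasis n j * star (lift α β x) =
      ∑ i, inner ℝ (frame α i x) (frame β j x) • cliffBasis n i
  lift_cocycle : ∀ α β γ, ∀ x ∈ baseSet α ∩ baseSet β ∩ baseSet γ,
    lift α β x * lift β γ x = lift α γ x

/-! ### Spin initial data sets with a Hermitian bundle -/

set_option synthInstance.maxHeartbeats 400000 in
/-- A spin initial data set `(M, g, k)` (the metric `g` being given by the `RiemannianBundle`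
instance), together with the Levi-Civita connection of `g` and a metric connection on the Hermitian
vector bundle `V`. -/
structure SpinInitialData (F : Type*) [NormedAddCommGroup F] [NormedSpace ℂ F]
    [FiniteDimensional ℂ F]
    (V : M → Type*) [TopologicalSpace (TotalSpace F V)]
    [∀ x, NormedAddCommGroup (V x)] [∀ x, InnerProductSpace ℂ (V x)]
    [FiberBundle F V] [VectorBundle ℂ F V] [VectorBundle ℝ F V] [ContMDiffVectorBundle ∞ F V I]
    (κ : Type*) [RiemannianBundle (fun x : M => TangentSpace I x)]
    [IsContMDiffRiemannianBundle I ∞ (EuclideanSpace ℝ (Fin n))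
      (fun x : M => TangentSpace I x)] where
  /-- the spin structure -/
  spin : SpinStructure I M κ
  /-- the spinor module to which the spinor bundle is associated -/
  spinor : SpinorModule n
  /-- the symmetric 2-tensor `k` -/
  k : Π x : M, TangentSpace I x →L[ℝ] TangentSpace I x →L[ℝ] ℝ
  symm_k : ∀ x (v w : TangentSpace I x), k x v w = k x w v
  smooth_k : ContMDiff I
    (I.prod 𝓘(ℝ, EuclideanSpace ℝ (Fin n) →L[ℝ] EuclideanSpace ℝ (Fin n) →L[ℝ] ℝ)) ∞
    (fun x => TotalSpace.mk'
      (EuclideanSpace ℝ (Fin n) →L[ℝ] EuclideanSpace ℝ (Fin n) →L[ℝ] ℝ)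
      (E := fun x : M => TangentSpace I x →L[ℝ] TangentSpace I x →L[ℝ] ℝ) x (k x))
  /-- the Levi-Civita connection of `g` -/
  lc : CovariantDerivative I (EuclideanSpace ℝ (Fin n)) (TangentSpace I : M → Type _)
  metric_lc : lc.IsMetricCompatible
  torsion_lc : lc.torsion = 0
  /-- the Hermitian metric of `V` is smooth -/
  smooth_inner : ∀ U : Set M, IsOpen U → ∀ s t : Π x : M, V x,
    SmoothSectionOn I F s U → SmoothSectionOn I F t U →
    ContMDiffOn I 𝓘(ℝ, ℂ) ∞ (fun x => inner ℂ (s x) (t x)) U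
  /-- the connection of `V` -/
  conn : CovariantDerivative I F V
  smooth_conn : ∀ U : Set M, IsOpen U → ∀ (X : Π x : M, TangentSpace I x) (s : Π x : M, V x),
    SmoothSectionOn I (EuclideanSpace ℝ (Fin n)) X U → SmoothSectionOn I F s U →
    SmoothSectionOn I F (fun x => conn s x (X x)) U
  /-- the connection of `V` is complex linear -/
  complex_conn : ∀ U : Set M, IsOpen U → ∀ s : Π x : M, V x, SmoothSectionOn I F s U →
    ∀ x ∈ U, ∀ v : TangentSpace I x,
      conn (fun y => Complex.I • s y) x v = Complex.I • conn s x v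
  /-- the connection of `V` is compatible with the Hermitian metric -/
  metric_conn : ∀ U : Set M, IsOpen U → ∀ s t : Π x : M, V x,
    SmoothSectionOn I F s U → SmoothSectionOn I F t U → ∀ x ∈ U, ∀ v : TangentSpace I x,
      mvfderiv I (fun y => inner ℂ (s y) (t y)) x v =
        inner ℂ (conn s x v) (t x) + inner ℂ (s x) (conn t x v)

/-- The fibre at `x` of `S = (𝕊 ⊗ V) ⊕ (𝕊 ⊗ V)`, where `𝕊` is the spinor bundle. As for Mathlib's
`VectorBundleCore`, a point of the fibre is given by its components in the trivialization
`indexAt x` of `𝕊`, in which `𝕊_x ⊗ V_x = ℂ^N ⊗ V_x = (V_x)^N` with `N = 2^⌊n/2⌋`. -/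
abbrev SFiber {M : Type*} (n : ℕ) (V : M → Type*) (x : M) : Type _ :=
  (Fin (2 ^ (n / 2)) → V x) × (Fin (2 ^ (n / 2)) → V x)

namespace SpinInitialData

variable {I M}
variable {F : Type*} [NormedAddCommGroup F] [NormedSpace ℂ F] [FiniteDimensional ℂ F]
  {V : M → Type*} [TopologicalSpace (TotalSpace F V)]
  [∀ x, NormedAddCommGroup (V x)] [∀ x, InnerProductSpace ℂ (V x)]
  [FiberBundle F V] [VectorBundle ℂ F V] [VectorBundle ℝ F V] [ContMDiffVectorBundle ∞ F V I]
  {κ : Type*} [RiemannianBundle (fun x : M => TangentSpace I x)]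
  [IsContMDiffRiemannianBundle I ∞ (EuclideanSpace ℝ (Fin n)) (fun x : M => TangentSpace I x)]
  (d : SpinInitialData I M F V κ)

/-- The local orthonormal frame `e₁, …, eₙ` around `x` of the chosen trivialization at `x`. -/
def e (x : M) (i : Fin n) : Π y : M, TangentSpace I y :=
  d.spin.frame (d.spin.indexAt x) i

/-! #### Local expressions and smoothness of sections of `S` -/

/-- The expression `u_α(y) = ρ(g_{α β}(y)) u_β(y)`, `β = indexAt y`, of the section `u` in the
trivialization `α`. -/
def localRep (u : Π x : M, SFiber n V x) (α : κ) (y : M) : SFiber n V y :=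
  (matAct (d.spinor.rho (d.spin.lift α (d.spin.indexAt y) y)) (u y).1,
   matAct (d.spinor.rho (d.spin.lift α (d.spin.indexAt y) y)) (u y).2)

/-- The section `u` of `S` is smooth on `U`. -/
def SmoothOn (u : Π x : M, SFiber n V x) (U : Set M) : Prop :=
  ∀ α a, SmoothSectionOn I F (fun y => (d.localRep u α y).1 a) (d.spin.baseSet α ∩ U) ∧
    SmoothSectionOn I F (fun y => (d.localRep u α y).2 a) (d.spin.baseSet α ∩ U)

/-- The `S`-valued 1-form `Ψ` is smooth on `U`. -/
def SmoothFormOn (Ψ : Π x : M, TangentSpace I x →ₗ[ℝ] SFiber n V x) (U : Set M) : Prop :=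
  ∀ α i, d.SmoothOn (fun x => Ψ x (d.spin.frame α i x)) (d.spin.baseSet α ∩ U)

/-! #### The relative Dirac bundle structure of `S` -/

/-- The Hermitian inner product on the fibres of `S`. -/
def herm {x : M} (u v : SFiber n V x) : ℂ :=
  ∑ a, inner ℂ (u.1 a) (v.1 a) + ∑ a, inner ℂ (u.2 a) (v.2 a)

/-- Clifford multiplication by the covector `w` on `S`, the off-diagonal matrix with entries
`c_𝕊(w) ⊗ id`. -/
def c {x : M} (w : TangentSpace I x →ₗ[ℝ] ℝ) (u : SFiber n V x) : SFiber n V x :=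
  (matAct (d.spinor.rho (CliffordAlgebra.ι (euclidNeg n) (fun i => w (d.e x i x)))) u.2,
   matAct (d.spinor.rho (CliffordAlgebra.ι (euclidNeg n) (fun i => w (d.e x i x)))) u.1)

/-- The involution `σ` on `S`, with matrix `((0, -i), (i, 0))`. -/
def sig {x : M} (u : SFiber n V x) : SFiber n V x :=
  (-Complex.I • u.2, Complex.I • u.1)

/-- The covector `eⁱ` at `x` dual to `eᵢ`. -/
def coframe (x : M) (i : Fin n) : TangentSpace I x →ₗ[ℝ] ℝ :=
  (innerSL ℝ (d.e x i x) : TangentSpace I x →L[ℝ] ℝ)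

/-- The covector `k(v, ·)`. -/
def kForm {x : M} (v : TangentSpace I x) : TangentSpace I x →ₗ[ℝ] ℝ :=
  (d.k x v : TangentSpace I x →L[ℝ] ℝ)

lemma c_add_left {x : M} (w w' : TangentSpace I x →ₗ[ℝ] ℝ) (u : SFiber n V x) :
    d.c (w + w') u = d.c w u + d.c w' u := by
  have h : (fun i => (w + w') (d.e x i x)) =
      (fun i => w (d.e x i x)) + (fun i => w' (d.e x i x)) := rfl
  simp only [c, h, map_add, matAct_add_left, Prod.mk_add_mk]

lemma c_smul_left {x : M} (r : ℝ) (w : TangentSpace I x →ₗ[ℝ] ℝ) (u : SFiber n V x) :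
    d.c (r • w) u = r • d.c w u := by
  have h : (fun i => (r • w) (d.e x i x)) = r • (fun i => w (d.e x i x)) := rfl
  simp only [c, h, map_smul, matAct_smul_left, Prod.smul_mk]

lemma kForm_add {x : M} (v w : TangentSpace I x) :
    d.kForm (v + w) = d.kForm v + d.kForm w := by
  ext z
  simp [kForm]

lemma kForm_smul {x : M} (r : ℝ) (v : TangentSpace I x) :
    d.kForm (r • v) = r • d.kForm v := by
  ext z
  simp [kForm]

/-- The endomorphism `¼ ∑_{i,j} g(∇_v eᵢ, eⱼ) c(eᵢ) c(eⱼ)` by which the spinor connection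
differs from the derivative in the trivialization at `x`. -/
def spinForm (x : M) (v : TangentSpace I x) :
    Matrix (Fin (2 ^ (n / 2))) (Fin (2 ^ (n / 2))) ℂ :=
  (1 / 4 : ℝ) • ∑ i, ∑ j, (inner ℝ (d.lc (d.e x i) x v) (d.e x j x) : ℝ) •
    d.spinor.rho (cliffBasis n i * cliffBasis n j)

lemma spinForm_add (x : M) (v w : TangentSpace I x) :
    d.spinForm x (v + w) = d.spinForm x v + d.spinForm x w := by
  simp only [spinForm, map_add, inner_add_left, add_smul, Finset.sum_add_distrib, smul_add]

lemma spinForm_smul (x : M) (r : ℝ) (v : TangentSpace I x) :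
    d.spinForm x (r • v) = r • d.spinForm x v := by
  simp only [spinForm, map_smul, real_inner_smul_left, mul_smul, ← Finset.smul_sum]
  rw [smul_comm]

/-- The connection `∇` on `S` induced by the spinor connection and the connection of `V`. -/
def nabla (u : Π x : M, SFiber n V x) (x : M) : TangentSpace I x →ₗ[ℝ] SFiber n V x where
  toFun v :=
    ((fun a => d.conn (fun y => (d.localRep u (d.spin.indexAt x) y).1 a) x v)
        + matAct (d.spinForm x v) (u x).1,
     (fun a => d.conn (fun y => (d.localRep u (d.spin.indexAt x) y).2 a) x v)
        + matAct (d.spinForm x v) (u x).2)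
  map_add' v w := by
    simp only [map_add, spinForm_add, matAct_add_left]
    ext a <;> simp only [Prod.fst_add, Prod.snd_add, Pi.add_apply] <;> abel
  map_smul' r v := by
    simp only [map_smul, spinForm_smul, matAct_smul_left]
    ext a <;> simp only [RingHom.id_apply, Prod.smul_fst, Prod.smul_snd, Pi.add_apply,
      Pi.smul_apply, smul_add]

/-- The Dirac operator `D = c(eⁱ) ∇_{eᵢ}`. -/
def D (u : Π x : M, SFiber n V x) (x : M) : SFiber n V x :=
  ∑ i, d.c (d.coframe x i) (d.nabla u x (d.e x i x))

/-- The modified connection `∇̃_v = ∇_v - ½ c(k(v, ·)) σ`. -/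
def nablaT (u : Π x : M, SFiber n V x) (x : M) : TangentSpace I x →ₗ[ℝ] SFiber n V x where
  toFun v := d.nabla u x v - (1 / 2 : ℝ) • d.c (d.kForm v) (sig (u x))
  map_add' v w := by
    simp only [map_add, kForm_add, c_add_left, smul_add]
    abel
  map_smul' r v := by
    simp only [map_smul, kForm_smul, c_smul_left, RingHom.id_apply, smul_sub]
    rw [smul_comm]

/-- The modified Dirac operator `D̃ = c(eⁱ) ∇̃_{eᵢ}`. -/
def DT (u : Π x : M, SFiber n V x) (x : M) : SFiber n V x :=
  ∑ i, d.c (d.coframe x i) (d.nablaT u x (d.e x i x))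

/-! #### Scalar quantities of the initial data set -/

/-- The trace `tr_g k`. -/
def trK (x : M) : ℝ := ∑ i, d.k x (d.e x i x) (d.e x i x)

/-- `|k|²_g`. -/
def normSqK (x : M) : ℝ := ∑ i, ∑ j, (d.k x (d.e x i x) (d.e x j x)) ^ 2

/-- The scalar curvature `R_g = ∑_{i,j} g(R(eᵢ, eⱼ) eⱼ, eᵢ)`. -/
def scal (x : M) : ℝ :=
  ∑ i, ∑ j, inner ℝ (curvatureOp d.lc (d.e x i) (d.e x j) (d.e x j) x) (d.e x i x)

/-- The divergence of the vector field `X`. -/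
def divX (X : Π x : M, TangentSpace I x) (x : M) : ℝ :=
  ∑ i, inner ℝ (d.lc X x (d.e x i x)) (d.e x i x)

/-- The energy density, `2μ = R_g - |k|² + (tr_g k)²`. -/
def mu (x : M) : ℝ := (1 / 2) * (d.scal x - d.normSqK x + (d.trK x) ^ 2)

/-- The components `Jⱼ = (div_g k - d(tr_g k))(eⱼ)` of the current density. -/
def J (x : M) (j : Fin n) : ℝ :=
  ∑ i, covTwoTensor d.lc d.k (d.e x i) (d.e x i) (d.e x j) x - mvfderiv I d.trK x (d.e x j x)

/-! #### Curvature endomorphisms -/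

/-- `(id ⊗ R^V(X, Y)) u` at `x`, where `R^V` is the curvature of `V`. -/
def twistCurv (X Y : Π x : M, TangentSpace I x) (u : Π x : M, SFiber n V x) (x : M) :
    SFiber n V x :=
  (fun a => curvatureOp d.conn X Y (fun y => (d.localRep u (d.spin.indexAt x) y).1 a) x,
   fun a => curvatureOp d.conn X Y (fun y => (d.localRep u (d.spin.indexAt x) y).2 a) x)

/-- `𝓡^E u = ∑_{i<j} c(eⁱ) c(eʲ) (id ⊗ R^V(eᵢ, eⱼ)) u`. -/
def RE (u : Π x : M, SFiber n V x) (x : M) : SFiber n V x :=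
  ∑ i, ∑ j ∈ Finset.Ioi i,
    d.c (d.coframe x i) (d.c (d.coframe x j) (d.twistCurv (d.e x i) (d.e x j) u x))

/-- `𝓡 u = ¼ R_g u + 𝓡^E u`. -/
def Rcurv (u : Π x : M, SFiber n V x) (x : M) : SFiber n V x :=
  (d.scal x / 4) • u x + d.RE u x

/-- `μ_E u = μ u + 2 𝓡^E u`. -/
def muE (u : Π x : M, SFiber n V x) (x : M) : SFiber n V x :=
  d.mu x • u x + (2 : ℝ) • d.RE u x

/-- `𝓡̃ u = ½ (μ_E u - Jᵢ c(eⁱ) σ u)`. -/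
def RcurvT (u : Π x : M, SFiber n V x) (x : M) : SFiber n V x :=
  (1 / 2 : ℝ) • (d.muE u x - ∑ i, d.J x i • d.c (d.coframe x i) (sig (u x)))

/-! #### Formal adjoints -/

/-- `∇* Ψ = -∑ᵢ (∇_{eᵢ} Ψ)(eᵢ) = ∑ᵢ (-∇_{eᵢ}(Ψ(eᵢ)) + Ψ(∇_{eᵢ} eᵢ))`. -/
def nablaStar (Ψ : Π x : M, TangentSpace I x →ₗ[ℝ] SFiber n V x) (x : M) : SFiber n V x :=
  ∑ i, (-d.nabla (fun y => Ψ y (d.e x i y)) x (d.e x i x)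
    + Ψ x (d.lc (d.e x i) x (d.e x i x)))

/-- `∇̃* Ψ = ∑ᵢ (-∇̃_{eᵢ}(Ψ(eᵢ)) - c(k(eᵢ, ·)) σ Ψ(eᵢ) + Ψ(∇_{eᵢ} eᵢ))`. -/
def nablaTStar (Ψ : Π x : M, TangentSpace I x →ₗ[ℝ] SFiber n V x) (x : M) : SFiber n V x :=
  ∑ i, (-d.nablaT (fun y => Ψ y (d.e x i y)) x (d.e x i x)
    - d.c (d.kForm (d.e x i x)) (sig (Ψ x (d.e x i x)))
    + Ψ x (d.lc (d.e x i) x (d.e x i x)))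

/-- The inner product of `S`-valued covectors. -/
def hermForm {x : M} (Φ Ψ : TangentSpace I x →ₗ[ℝ] SFiber n V x) : ℂ :=
  ∑ i, herm (Φ (d.e x i x)) (Ψ (d.e x i x))

variable [MeasurableSpace M]

/-- `Q` is the formal adjoint over the open set `U` of the operator `P` on sections of `S`: both map
smooth sections to smooth sections, and `∫ ⟨P u, v⟩ = ∫ ⟨u, Q v⟩` for smooth `u`, `v` one of which
vanishes outside a compact subset of `U` that does not meet the boundary of `M`. -/
def IsFormalAdjointOn (U : Set M)
    (P Q : (Π x : M, SFiber n V x) → (Π x : M, SFiber n V x)) : Prop :=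
  (∀ u, d.SmoothOn u U → d.SmoothOn (P u) U ∧ d.SmoothOn (Q u) U) ∧
  ∀ u v, d.SmoothOn u U → d.SmoothOn v U →
    ∀ K : Set M, IsCompact K → K ⊆ U ∩ I.interior M →
    ((∀ x ∉ K, u x = 0) ∨ (∀ x ∉ K, v x = 0)) →
    Integrable (fun x => herm (P u x) (v x)) (riemannianVolume I M) ∧
    Integrable (fun x => herm (u x) (Q v x)) (riemannianVolume I M) ∧
    ∫ x, herm (P u x) (v x) ∂(riemannianVolume I M) =
      ∫ x, herm (u x) (Q v x) ∂(riemannianVolume I M)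

/-- `Q`, from `S`-valued 1-forms to sections of `S`, is the formal adjoint of `P`, from sections of
`S` to `S`-valued 1-forms. -/
def IsFormalAdjointForm
    (P : (Π x : M, SFiber n V x) → (Π x : M, TangentSpace I x →ₗ[ℝ] SFiber n V x))
    (Q : (Π x : M, TangentSpace I x →ₗ[ℝ] SFiber n V x) → (Π x : M, SFiber n V x)) : Prop :=
  (∀ u, d.SmoothOn u Set.univ → d.SmoothFormOn (P u) Set.univ) ∧
  (∀ Ψ, d.SmoothFormOn Ψ Set.univ → d.SmoothOn (Q Ψ) Set.univ) ∧
  ∀ u Ψ, d.SmoothOn u Set.univ → d.SmoothFormOn Ψ Set.univ →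
    ∀ K : Set M, IsCompact K → K ⊆ I.interior M →
    ((∀ x ∉ K, u x = 0) ∨ (∀ x ∉ K, Ψ x = 0)) →
    Integrable (fun x => d.hermForm (P u x) (Ψ x)) (riemannianVolume I M) ∧
    Integrable (fun x => herm (u x) (Q Ψ x)) (riemannianVolume I M) ∧
    ∫ x, d.hermForm (P u x) (Ψ x) ∂(riemannianVolume I M) =
      ∫ x, herm (u x) (Q Ψ x) ∂(riemannianVolume I M)

end SpinInitialData

end Manifold

end

/-! Near a point a section of `S` is a pair of tuples of sections of `V`, and its components in two
trivializations differ by the matrices G = ρ(g_αβ) with g_αβ in Spin(n). In the trivialization α the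
connection of `S` is the connection of `V` on components plus the matrix ω_α(v) = ¼ ∑ g(∇_v eᵢ, eⱼ)
γᵢ γⱼ. The point that is not formal is that these expressions agree on overlaps, that is dG + ω_α G
= G ω_β (`dMat_trans`). It is obtained without computing the derivative of the covering Spin(n) →
SO(n): one differentiates the relation by which G rotates the generators, and then uses that an even
skew-Hermitian matrix is determined by its commutators with the generators (`eq_bivector`). Indeed
an even element commuting with all γᵢ is a real scalar, and a skew-Hermitian real scalar is zero.

Three properties of ∇ follow: Clifford multiplication is parallel (`nabla_cv`), the Hermitian
product is parallel (`mvfderiv_herm_nabla`), and the curvature is the bivector of the Riemann tensor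
plus the curvature of `V` (`nabla_nabla_sub`). The operators are defined with a frame that may jump
from point to point; as they are traces of bilinear maps, any smooth orthonormal frame may be used
instead (`sum_bilin_frame`).

Lichnerowicz formula. D² is the sum of c(eⁱ) c(eʲ) applied to the second covariant derivative of u
(`D_D_eq`). The diagonal terms give ∇*∇, because c(eⁱ)² = -1. The others see only the antisymmetric
part of the second derivative, which is curvature, and the Clifford relations with the Bianchi
identity reduce ∑_{i<j} γᵢ γⱼ ¼ ∑ R_{ijkl} γₖ γₗ to a quarter of the scalar curvature
(`CliffRel.sum_curvature`).

Modified formula. Since k is symmetric and σ anticommutes with Clifford multiplication, D̃ = D + ½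
(tr k) σ. In D̃² the terms Dσ and σD cancel, up to the derivative of tr k, and (tr k)²/4 appears
(`DT_DT_eq`). In ∇̃*∇̃ the first order terms cancel as well and leave the divergence of k and |k|²/4
(`nablaTStar_nablaT_eq`). The difference of the two is exactly the curvature term with μ and J.

Formal adjoints. For a section u and an `S`-valued 1-form Ψ, the pointwise difference of ⟨∇u, Ψ⟩ and
⟨u, ∇*Ψ⟩ has as real and imaginary parts divergences of compactly supported vector fields
(`divX_sharp_herm`), so its integral vanishes by the divergence theorem (`integral_divX`). That
theorem is reduced by a partition of unity to one chart, where √det g · div X is a sum of coordinate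
derivatives. The adjoints of ∇_X and D come from Ψ = g(X, ·) v and Ψ = c(·) v, and those of the
modified operators from the fact that c(k(X, ·)) σ and σ are Hermitian. -/

set_option linter.unusedSectionVars false

noncomputable section

/-! ### Algebra of Clifford generators -/

section Generators

variable {n : ℕ} {A : Type*} [Ring A] [Algebra ℝ A]

/-- The elements `γ i` satisfy the Clifford relations `γᵢ γⱼ + γⱼ γᵢ = -2 δᵢⱼ`. -/
def CliffRel (γ : Fin n → A) : Prop :=
  ∀ i j, γ i * γ j + γ j * γ i = (if i = j then (-2 : ℝ) else 0) • (1 : A)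

/-- The element `¼ ∑ aᵢⱼ γᵢ γⱼ`. -/
def bivector (γ : Fin n → A) (a : Fin n → Fin n → ℝ) : A :=
  (1 / 4 : ℝ) • ∑ i, ∑ j, a i j • (γ i * γ j)

variable {γ : Fin n → A}

lemma CliffRel.swap (hγ : CliffRel γ) (i j : Fin n) :
    γ i * γ j = (if i = j then (-2 : ℝ) else 0) • (1 : A) - γ j * γ i :=
  eq_sub_of_add_eq (hγ i j)

lemma CliffRel.sq (hγ : CliffRel γ) (i : Fin n) : γ i * γ i = -1 := by
  have h := hγ i i
  simp only [if_true] at h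
  have h2 : (2 : ℝ) • (γ i * γ i) = (2 : ℝ) • (-1 : A) := by
    rw [two_smul, h]; module
  have := congrArg (fun z => (1 / 2 : ℝ) • z) h2
  simpa [smul_smul] using this

/-- A generator that passes two others changes sign twice, so only the contractions remain. -/
lemma CliffRel.pair_comm (hγ : CliffRel γ) (i j k : Fin n) :
    γ i * γ j * γ k = γ k * (γ i * γ j)
      + (if j = k then (-2 : ℝ) else 0) • γ i + (if i = k then (2 : ℝ) else 0) • γ j := by
  rw [mul_assoc, hγ.swap j k, mul_sub, ← mul_assoc, hγ.swap i k, sub_mul]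
  have : (if i = k then (2 : ℝ) else 0) = - (if i = k then (-2 : ℝ) else 0) := by
    split_ifs <;> simp
  rw [this, mul_smul_comm, smul_mul_assoc, mul_one, one_mul, mul_assoc]
  module

/-- Commutation with a bivector acts on generators as an infinitesimal rotation. The factor 1/4 in
`bivector` makes that rotation exactly `a`: every contraction has weight 2 and, by antisymmetry,
contributes twice. -/
lemma CliffRel.bivector_comm (hγ : CliffRel γ) {a : Fin n → Fin n → ℝ}
    (ha : ∀ i j, a i j = -a j i) (k : Fin n) :
    bivector γ a * γ k = γ k * bivector γ a + ∑ j, a k j • γ j := by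
  have h : ∑ i, ∑ j, a i j • (γ i * γ j) * γ k = γ k * (∑ i, ∑ j, a i j • (γ i * γ j))
      + (4 : ℝ) • ∑ j, a k j • γ j := by
    have h1 : ∀ i j, a i j • (γ i * γ j) * γ k = γ k * (a i j • (γ i * γ j))
        + ((if j = k then (-2 * a i j : ℝ) else 0) • γ i
          + (if i = k then (2 * a i j : ℝ) else 0) • γ j) := by
      intro i j
      rw [smul_mul_assoc, hγ.pair_comm, mul_smul_comm]
      split_ifs <;> module
    simp only [h1, Finset.sum_add_distrib, Finset.mul_sum]
    congr 1
    have h2 : ∑ i, ∑ j, (if j = k then (-2 * a i j : ℝ) else 0) • γ i =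
        (2 : ℝ) • ∑ j, a k j • γ j := by
      simp only [ite_smul, zero_smul, Finset.sum_ite_eq', Finset.mem_univ, if_true, Finset.smul_sum]
      refine Finset.sum_congr rfl fun i _ => ?_
      rw [ha i k]; module
    have h3 : ∑ i, ∑ j, (if i = k then (2 * a i j : ℝ) else 0) • γ j =
        (2 : ℝ) • ∑ j, a k j • γ j := by
      rw [Finset.sum_comm]
      simp only [ite_smul, zero_smul, Finset.sum_ite_eq', Finset.mem_univ, if_true, Finset.smul_sum]
      refine Finset.sum_congr rfl fun i _ => ?_
      module
    rw [h2, h3]; module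
  simp only [bivector, smul_mul_assoc, mul_smul_comm]
  rw [Finset.sum_mul]
  simp only [Finset.sum_mul]
  rw [h]; module

/-- The commutator with `bivector γ a` is a derivation, so it rotates each of the two factors of
every γᵢ γⱼ in the other bivector. This produces the quadratic terms in the curvature of the spinor
connection. -/
lemma CliffRel.bivector_comm_bivector (hγ : CliffRel γ) {a b : Fin n → Fin n → ℝ}
    (ha : ∀ i j, a i j = -a j i)
    (hb : ∀ i j, b i j = -b j i) :
    bivector γ a * bivector γ b = bivector γ b * bivector γ a
      + bivector γ (fun i j => ∑ k, (a i k * b j k - b i k * a j k)) := by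
  have h1 : ∀ i j, bivector γ a * (b i j • (γ i * γ j)) = (b i j • (γ i * γ j)) * bivector γ a
      + (∑ k, (b i j * a i k) • (γ k * γ j) + ∑ k, (b i j * a j k) • (γ i * γ k)) := by
    intro i j
    rw [mul_smul_comm, ← mul_assoc, hγ.bivector_comm ha, add_mul, mul_assoc, hγ.bivector_comm ha,
      mul_add, smul_mul_assoc, Finset.sum_mul, Finset.mul_sum]
    simp only [smul_mul_assoc, mul_smul_comm, smul_add, Finset.smul_sum, mul_assoc, smul_smul]
    abel
  have h2 : ∑ i, ∑ j, (∑ k, (b i j * a i k) • (γ k * γ j) + ∑ k, (b i j * a j k) • (γ i * γ k))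
      = ∑ i, ∑ j, (∑ k, (a i k * b j k - b i k * a j k)) • (γ i * γ j) := by
    simp only [Finset.sum_add_distrib, Finset.sum_smul]
    have e1 : ∑ i, ∑ j, ∑ k, (b i j * a i k) • (γ k * γ j)
        = ∑ i, ∑ j, ∑ k, (a i k * b j k) • (γ i * γ j) := by
      rw [Finset.sum_comm]
      simp_rw [Finset.sum_comm (γ := Fin n) (s := Finset.univ) (t := Finset.univ)
        (f := fun x y => (b x _ * a x y) • (γ y * γ _))]
      rw [Finset.sum_comm]
      refine Finset.sum_congr rfl fun i _ => Finset.sum_congr rfl fun j _ =>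
        Finset.sum_congr rfl fun k _ => ?_
      rw [ha i k, hb j k]; congr 1; ring
    have e2 : ∑ i, ∑ j, ∑ k, (b i j * a j k) • (γ i * γ k)
        = ∑ i, ∑ j, ∑ k, (-(b i k * a j k)) • (γ i * γ j) := by
      refine Finset.sum_congr rfl fun i _ => ?_
      rw [Finset.sum_comm]
      refine Finset.sum_congr rfl fun j _ =>
        Finset.sum_congr rfl fun k _ => ?_
      rw [ha j k]; congr 1; ring
    rw [e1, e2, ← Finset.sum_add_distrib]
    refine Finset.sum_congr rfl fun i _ => ?_
    rw [← Finset.sum_add_distrib]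
    refine Finset.sum_congr rfl fun j _ => ?_
    rw [← Finset.sum_add_distrib]
    refine Finset.sum_congr rfl fun k _ => ?_
    module
  have h3 : bivector γ a * (∑ i, ∑ j, b i j • (γ i * γ j))
      = (∑ i, ∑ j, b i j • (γ i * γ j)) * bivector γ a
        + ∑ i, ∑ j, (∑ k, (a i k * b j k - b i k * a j k)) • (γ i * γ j) := by
    rw [← h2, Finset.mul_sum, Finset.sum_mul, ← Finset.sum_add_distrib]
    refine Finset.sum_congr rfl fun i _ => ?_
    rw [Finset.mul_sum, Finset.sum_mul, ← Finset.sum_add_distrib]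
    exact Finset.sum_congr rfl fun j _ => h1 i j
  conv_lhs => rw [bivector.eq_1 γ b]
  conv_rhs => rw [bivector.eq_1 γ b]
  rw [mul_smul_comm, h3, smul_mul_assoc, smul_add]
  rfl

/-- An array with the symmetries of a Riemann curvature tensor `R i j k l = g(R(eᵢ, eⱼ) eₖ, eₗ)`. -/
structure IsCurvatureArray (R : Fin n → Fin n → Fin n → Fin n → ℝ) : Prop where
  antisymm_left : ∀ i j k l, R i j k l = -R j i k l
  antisymm_right : ∀ i j k l, R i j k l = -R i j l k
  bianchi : ∀ i j k l, R i j k l + R j k i l + R k i j l = 0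

/-- The octahedron argument: the four cyclic identities, with each of the four indices in turn in
the last place, are combined with the antisymmetries. -/
lemma IsCurvatureArray.pair_symm {R : Fin n → Fin n → Fin n → Fin n → ℝ}
    (hR : IsCurvatureArray R) (i j k l : Fin n) : R i j k l = R k l i j := by
  linarith [hR.bianchi i j k l, hR.bianchi j k l i, hR.bianchi k l i j, hR.bianchi l i j k,
    hR.antisymm_left i j k l, hR.antisymm_left j k i l, hR.antisymm_left k i j l,
    hR.antisymm_left k l i j, hR.antisymm_left l i j k, hR.antisymm_left j l i k,
    hR.antisymm_left l j i k, hR.antisymm_right i j k l, hR.antisymm_right j k i l,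
    hR.antisymm_right k i j l, hR.antisymm_right k l i j, hR.antisymm_right l i j k,
    hR.antisymm_right l j i k, hR.antisymm_right j k l i, hR.antisymm_right k l j i,
    hR.antisymm_right i l j k, hR.antisymm_left i l j k, hR.antisymm_left i l k j,
    hR.antisymm_right i k l j, hR.antisymm_right i k j l, hR.antisymm_left i k j l,
    hR.antisymm_right j l k i, hR.antisymm_left j l k i, hR.antisymm_right l i k j]

/-- `∑ Rᵢⱼₖₗ γᵢ γⱼ γₖ = -2 ∑ Rᵢⱼⱼₗ γᵢ`. -/
lemma CliffRel.sum_triple (hγ : CliffRel γ) {R : Fin n → Fin n → Fin n → Fin n → ℝ}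
    (hR : IsCurvatureArray R)
    (l : Fin n) :
    ∑ i, ∑ j, ∑ k, R i j k l • (γ i * γ j * γ k) = (-2 : ℝ) • ∑ i, ∑ j, R i j j l • γ i := by
  set T := ∑ i, ∑ j, ∑ k, R i j k l • (γ i * γ j * γ k) with hT
  -- Moving the last factor to the front gives one cyclic permutation of `R` plus contractions; `c2`
  -- moves the first factor to the end and gives the other one. The three cyclic sums add up to zero
  -- by the Bianchi identity, so 3T consists of contractions only, of weights -4 and -2.
  have c1 : T = ∑ i, ∑ j, ∑ k, R j k i l • (γ i * γ j * γ k)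
      + ∑ i, ∑ j, ∑ k, R i j k l • ((if j = k then (-2 : ℝ) else 0) • γ i
        + (if i = k then (2 : ℝ) else 0) • γ j) := by
    have : ∑ i, ∑ j, ∑ k, R j k i l • (γ i * γ j * γ k)
        = ∑ i, ∑ j, ∑ k, R i j k l • (γ k * (γ i * γ j)) := by
      rw [Finset.sum_comm]
      refine Finset.sum_congr rfl fun i _ => ?_
      rw [Finset.sum_comm]
      refine Finset.sum_congr rfl fun j _ => Finset.sum_congr rfl fun k _ => ?_
      rw [mul_assoc]
    rw [this, hT, ← Finset.sum_add_distrib]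
    refine Finset.sum_congr rfl fun i _ => ?_
    rw [← Finset.sum_add_distrib]
    refine Finset.sum_congr rfl fun j _ => ?_
    rw [← Finset.sum_add_distrib]
    refine Finset.sum_congr rfl fun k _ => ?_
    rw [hγ.pair_comm, add_assoc, smul_add]
  have c2 : T = ∑ i, ∑ j, ∑ k, R k i j l • (γ i * γ j * γ k)
      + ∑ i, ∑ j, ∑ k, R i j k l • ((if k = i then (2 : ℝ) else 0) • γ j
        + (if j = i then (-2 : ℝ) else 0) • γ k) := by
    have : ∑ i, ∑ j, ∑ k, R k i j l • (γ i * γ j * γ k)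
        = ∑ i, ∑ j, ∑ k, R i j k l • (γ j * γ k * γ i) := by
      rw [Finset.sum_comm' (t' := Finset.univ) (s' := fun _ => Finset.univ) (by simp)]
      rw [Finset.sum_congr rfl fun _ _ => Finset.sum_comm]
      rw [Finset.sum_comm]
      refine Finset.sum_congr rfl fun i _ => ?_
      rw [Finset.sum_comm]
    rw [this, hT, ← Finset.sum_add_distrib]
    refine Finset.sum_congr rfl fun i _ => ?_
    rw [← Finset.sum_add_distrib]
    refine Finset.sum_congr rfl fun j _ => ?_
    rw [← Finset.sum_add_distrib]
    refine Finset.sum_congr rfl fun k _ => ?_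
    rw [hγ.pair_comm j k i, mul_assoc, ← smul_add]
    congr 1
    split_ifs <;> module
  have c3 : T + ∑ i, ∑ j, ∑ k, R j k i l • (γ i * γ j * γ k)
      + ∑ i, ∑ j, ∑ k, R k i j l • (γ i * γ j * γ k) = 0 := by
    rw [hT]
    simp only [← Finset.sum_add_distrib, ← add_smul, hR.bianchi, zero_smul, Finset.sum_const_zero]
  have d1 : ∑ i, ∑ j, ∑ k, R i j k l • ((if j = k then (-2 : ℝ) else 0) • γ i
        + (if i = k then (2 : ℝ) else 0) • γ j) = (-4 : ℝ) • ∑ i, ∑ j, R i j j l • γ i := by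
    simp only [smul_add, Finset.sum_add_distrib, ite_smul, zero_smul, smul_ite, smul_zero,
      Finset.sum_ite_eq, Finset.mem_univ, if_true]
    conv_lhs => rhs; rw [Finset.sum_comm]
    simp only [Finset.smul_sum, ← Finset.sum_add_distrib]
    refine Finset.sum_congr rfl fun i _ => Finset.sum_congr rfl fun j _ => ?_
    rw [hR.antisymm_left j i]; module
  have d2 : ∑ i, ∑ j, ∑ k, R i j k l • ((if k = i then (2 : ℝ) else 0) • γ j
        + (if j = i then (-2 : ℝ) else 0) • γ k) = (-2 : ℝ) • ∑ i, ∑ j, R i j j l • γ i := by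
    have z : ∀ i k, R i i k l = 0 := fun i k => by linarith [hR.antisymm_left i i k l]
    simp only [smul_add, Finset.sum_add_distrib, ite_smul, zero_smul, smul_ite, smul_zero,
      Finset.sum_ite_eq', Finset.mem_univ, if_true]
    have z2 : ∑ i, ∑ j, ∑ k, (if j = i then R i j k l • (-2 : ℝ) • γ k else 0) = 0 := by
      refine Finset.sum_eq_zero fun i _ => Finset.sum_eq_zero fun j _ =>
        Finset.sum_eq_zero fun k _ => ?_
      split_ifs with h
      · subst h; simp [z]
      · rfl
    rw [z2, add_zero, Finset.sum_comm]
    simp only [Finset.smul_sum]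
    refine Finset.sum_congr rfl fun i _ => Finset.sum_congr rfl fun j _ => ?_
    rw [hR.antisymm_left j i]; module
  rw [d1] at c1
  rw [d2] at c2
  have : (3 : ℝ) • T = (3 : ℝ) • ((-2 : ℝ) • ∑ i, ∑ j, R i j j l • γ i) := by
    have e1 := eq_sub_of_add_eq c1.symm
    have e2 := eq_sub_of_add_eq c2.symm
    rw [e1, e2] at c3
    have : (3 : ℝ) • T = T + T + T := by module
    rw [this, ← sub_eq_zero, ← c3]
    module
  have := congrArg (fun z => (1 / 3 : ℝ) • z) this
  simpa [smul_smul] using this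

/-- Averaging the sum with its transpose replaces each product by half an anticommutator. It is used
for the Ricci tensor, for `k`, and for the square of a covector. -/
lemma CliffRel.sum_symm (hγ : CliffRel γ) {a : Fin n → Fin n → ℝ} (ha : ∀ i j, a i j = a j i) :
    ∑ i, ∑ j, a i j • (γ i * γ j) = -(∑ i, a i i) • (1 : A) := by
  have h : (2 : ℝ) • ∑ i, ∑ j, a i j • (γ i * γ j) = (2 : ℝ) • (-(∑ i, a i i) • (1 : A)) := by
    have e : ∑ i, ∑ j, a i j • (γ i * γ j) = ∑ i, ∑ j, a i j • (γ j * γ i) := by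
      rw [Finset.sum_comm]
      exact Finset.sum_congr rfl fun i _ => Finset.sum_congr rfl fun j _ => by rw [ha]
    rw [two_smul]
    nth_rewrite 2 [e]
    simp only [← Finset.sum_add_distrib, ← smul_add, hγ _ _, ite_smul, zero_smul, smul_ite,
      smul_zero, Finset.sum_ite_eq, Finset.mem_univ, if_true]
    simp only [smul_smul, ← Finset.sum_smul]
    congr 1
    rw [← Finset.sum_mul]; ring
  have := congrArg (fun z => (1 / 2 : ℝ) • z) h
  simpa [smul_smul] using this

/-- The algebraic part of the Lichnerowicz formula. -/
lemma CliffRel.sum_curvature (hγ : CliffRel γ) {R : Fin n → Fin n → Fin n → Fin n → ℝ}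
    (hR : IsCurvatureArray R) :
    ∑ i, ∑ j ∈ Finset.Ioi i, γ i * γ j * bivector γ (R i j)
      = ((∑ i, ∑ j, R i j j i) / 4) • (1 : A) := by
  have hz : ∀ i, bivector γ (R i i) = 0 := by
    intro i
    have z : ∀ k l, R i i k l = 0 := fun k l => by linarith [hR.antisymm_left i i k l]
    simp [bivector, z]
  have hs : ∀ i j, γ j * γ i * bivector γ (R j i) = γ i * γ j * bivector γ (R i j) := by
    intro i j
    have e : bivector γ (R j i) = -bivector γ (R i j) := by
      simp only [bivector, ← smul_neg, ← Finset.sum_neg_distrib]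
      congr 1
      refine Finset.sum_congr rfl fun k _ => Finset.sum_congr rfl fun l _ => ?_
      rw [hR.antisymm_left]; module
    by_cases hij : i = j
    · subst hij; rfl
    · rw [hγ.swap j i, if_neg (Ne.symm hij), e]; simp
  -- Off the diagonal both γᵢ γⱼ and the bivector change sign under exchange of `i` and `j`, and the
  -- diagonal bivectors vanish, so the full sum is twice the sum over i < j.
  have half : (2 : ℝ) • ∑ i, ∑ j ∈ Finset.Ioi i, γ i * γ j * bivector γ (R i j)
      = ∑ i, ∑ j, γ i * γ j * bivector γ (R i j) := by
    have split : ∀ i, ∑ j, γ i * γ j * bivector γ (R i j)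
        = ∑ j ∈ Finset.Ioi i, γ i * γ j * bivector γ (R i j)
          + ∑ j ∈ Finset.Iio i, γ i * γ j * bivector γ (R i j) := by
      intro i
      have e : (Finset.univ : Finset (Fin n)) = insert i (Finset.Ioi i ∪ Finset.Iio i) := by
        ext j; simp only [Finset.mem_univ, Finset.mem_insert, Finset.mem_union, Finset.mem_Ioi,
          Finset.mem_Iio, true_iff]
        rcases lt_trichotomy i j with h | h | h
        · exact Or.inr (Or.inl h)
        · exact Or.inl h.symm
        · exact Or.inr (Or.inr h)
      rw [e, Finset.sum_insert (by simp), hz, mul_zero, zero_add, Finset.sum_union]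
      exact Finset.disjoint_left.2 fun j h1 h2 =>
        lt_asymm (Finset.mem_Ioi.1 h1) (Finset.mem_Iio.1 h2)
    have sw : ∑ i, ∑ j ∈ Finset.Iio i, γ i * γ j * bivector γ (R i j)
        = ∑ i, ∑ j ∈ Finset.Ioi i, γ i * γ j * bivector γ (R i j) := by
      rw [Finset.sum_comm' (t' := Finset.univ) (s' := fun j => Finset.Ioi j) (by simp)]
      exact Finset.sum_congr rfl fun i _ => Finset.sum_congr rfl fun j _ => hs i j
    rw [Finset.sum_congr rfl fun i _ => split i, Finset.sum_add_distrib, sw, two_smul]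
  have full : ∑ i, ∑ j, γ i * γ j * bivector γ (R i j)
      = (1 / 4 : ℝ) • ∑ l, (∑ i, ∑ j, ∑ k, R i j k l • (γ i * γ j * γ k)) * γ l := by
    simp only [bivector, mul_smul_comm, Finset.mul_sum, Finset.sum_mul, ← Finset.smul_sum,
      smul_mul_assoc, mul_assoc]
    congr 1
    conv_rhs => rw [Finset.sum_comm]
    refine Finset.sum_congr rfl fun i _ => ?_
    conv_rhs => rw [Finset.sum_comm]
    refine Finset.sum_congr rfl fun j _ => ?_
    rw [Finset.sum_comm]
  -- `sum_triple` contracts the curvature to -2 times the Ricci tensor. Its symmetry lets `sum_symm`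
  -- replace γᵢ γₗ by minus the trace. The constants combine to 2 · ¼ · ½ = ¼.
  have ric : ∑ l, (∑ i, ∑ j, ∑ k, R i j k l • (γ i * γ j * γ k)) * γ l
      = (2 * ∑ i, ∑ j, R i j j i) • (1 : A) := by
    simp only [hγ.sum_triple hR, smul_mul_assoc, Finset.sum_mul, ← Finset.smul_sum]
    rw [Finset.sum_comm]
    simp only [← Finset.sum_smul]
    rw [hγ.sum_symm (a := fun i l => ∑ j, R i j j l)]
    · module
    · intro i l
      refine Finset.sum_congr rfl fun j _ => ?_
      rw [hR.pair_symm, hR.antisymm_left, hR.antisymm_right, neg_neg]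
  rw [full, ric] at half
  have := congrArg (fun z => (1 / 2 : ℝ) • z) half
  simp only [smul_smul] at this
  norm_num at this
  rw [this]
  congr 1; ring

end Generators

/-! ### Even elements, and the even elements commuting with all generators -/

section EvenSpan

variable {n : ℕ} {A : Type*} [Ring A] [Algebra ℝ A] {γ : Fin n → A}

/-- The span of the products of an even number of generators in which each generator `γ i`,
`i ∈ s`, occurs an even number of times. -/
def evenSpan (γ : Fin n → A) (s : Finset (Fin n)) : Submodule ℝ A :=
  Submodule.span ℝ {x | ∃ l : List (Fin n), Even l.length ∧ (∀ i ∈ s, Even (l.count i)) ∧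
    x = (l.map γ).prod}

/-- Each letter different from `i` contributes a sign and each letter equal to `i` none; modulo 2
the number of signs is the sum of the length and the count. -/
lemma CliffRel.mul_prod (hγ : CliffRel γ) (i : Fin n) (l : List (Fin n)) :
    γ i * (l.map γ).prod = ((-1 : ℝ) ^ (l.length + l.count i)) • ((l.map γ).prod * γ i) := by
  induction l with
  | nil => simp
  | cons a l ih =>
    simp only [List.map_cons, List.prod_cons, List.length_cons]
    by_cases h : a = i
    · subst h
      rw [List.count_cons_self]
      conv_lhs => rw [ih, mul_smul_comm, ← mul_assoc]
      congr 1
      ring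
    · rw [← mul_assoc, hγ.swap i a, if_neg (Ne.symm h), zero_smul, zero_sub, neg_mul, mul_assoc, ih,
        List.count_cons_of_ne h, mul_smul_comm, ← mul_assoc, ← neg_smul]
      congr 1
      ring

/-- The map y ↦ ½ (y - γᵢ y γᵢ) fixes the even words in which `i` occurs an even number of times and
kills the other even words. An element commuting with γᵢ is fixed by it, because γᵢ² = -1. -/
lemma CliffRel.mem_evenSpan_insert (hγ : CliffRel γ) {s : Finset (Fin n)} {i : Fin n} {x : A}
    (hx : x ∈ evenSpan γ s) (hc : γ i * x = x * γ i) : x ∈ evenSpan γ (insert i s) := by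
  have key : ∀ y ∈ evenSpan γ s, (1 / 2 : ℝ) • (y - γ i * y * γ i) ∈ evenSpan γ (insert i s) := by
    intro y hy
    induction hy using Submodule.span_induction with
    | mem y hy =>
      obtain ⟨l, hl, hs, rfl⟩ := hy
      have e : γ i * (l.map γ).prod * γ i = -((-1 : ℝ) ^ (l.count i)) • (l.map γ).prod := by
        rw [hγ.mul_prod, smul_mul_assoc, mul_assoc, hγ.sq, pow_add, hl.neg_one_pow, mul_neg,
          mul_one]
        module
      rw [e]
      by_cases hi : Even (l.count i)
      · rw [hi.neg_one_pow]
        have : (1 / 2 : ℝ) • ((l.map γ).prod - (-(1 : ℝ)) • (l.map γ).prod) = (l.map γ).prod := by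
          module
        rw [this]
        refine Submodule.subset_span ⟨l, hl, ?_, rfl⟩
        intro j hj
        rcases Finset.mem_insert.1 hj with rfl | hj
        · exact hi
        · exact hs j hj
      · rw [(Nat.not_even_iff_odd.1 hi).neg_one_pow]
        simp
    | zero => simp
    | add y z _ _ hy hz =>
      convert Submodule.add_mem _ hy hz using 1
      rw [mul_add, add_mul]; module
    | smul r y _ hy =>
      convert Submodule.smul_mem _ r hy using 1
      rw [mul_smul_comm, smul_mul_assoc]; module
  have h := key x hx
  rw [hc, mul_assoc, hγ.sq] at h
  convert h using 1
  rw [mul_neg, mul_one]; module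

/-- The leading letter occurs again further on; it is moved there, up to sign, and the pair cancels
to -1. The bound `m` serves the induction, which shortens the word by two letters. -/
lemma CliffRel.prod_scalar (hγ : CliffRel γ) (m : ℕ) : ∀ l : List (Fin n), l.length ≤ m →
    (∀ i, Even (l.count i)) → ∃ r : ℝ, (l.map γ).prod = r • (1 : A) := by
  induction m with
  | zero =>
    intro l hl _
    rw [List.length_eq_zero_iff.1 (Nat.le_zero.1 hl)]
    exact ⟨1, by simp⟩
  | succ m ih =>
    intro l hl he
    cases l with
    | nil => exact ⟨1, by simp⟩
    | cons i l =>
      have hi : i ∈ l := by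
        have := he i
        rw [List.count_cons_self] at this
        rw [← List.count_pos_iff]
        rcases Nat.eq_zero_or_pos (l.count i) with h | h
        · rw [h] at this; exact absurd this (by decide)
        · exact h
      obtain ⟨l₁, l₂, rfl⟩ := List.append_of_mem hi
      obtain ⟨r, hr⟩ := ih (l₁ ++ l₂) (by simp at hl ⊢; omega) (by
        intro j
        have := he j
        simp only [List.count_cons, List.count_append] at this ⊢
        by_cases h : i = j
        · subst h; simp at this; rw [Nat.even_iff] at this ⊢; omega
        · simp [h] at this; exact this)
      refine ⟨-((-1 : ℝ) ^ (l₁.length + l₁.count i)) * r, ?_⟩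
      simp only [List.map_cons, List.map_append, List.prod_cons, List.prod_append] at hr ⊢
      rw [← mul_assoc, hγ.mul_prod, smul_mul_assoc, mul_assoc, ← mul_assoc (γ i) (γ i), hγ.sq,
        neg_one_mul, mul_neg, hr]
      module

/-- An even element that commutes with all generators is a scalar. -/
lemma CliffRel.scalar_of_commute (hγ : CliffRel γ) {x : A} (hx : x ∈ evenSpan γ ∅)
    (hc : ∀ i, γ i * x = x * γ i) : ∃ r : ℝ, x = r • (1 : A) := by
  -- The projections for the single generators are applied one after another, until every generator
  -- occurs evenly and each word is a scalar.
  have h : ∀ s : Finset (Fin n), x ∈ evenSpan γ s := by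
    intro s
    induction s using Finset.induction_on with
    | empty => exact hx
    | insert i s _ ih => exact hγ.mem_evenSpan_insert ih (hc i)
  have h2 : evenSpan γ Finset.univ ≤ Submodule.span ℝ {(1 : A)} := by
    refine Submodule.span_le.2 ?_
    rintro _ ⟨l, _, hl, rfl⟩
    obtain ⟨r, hr⟩ := hγ.prod_scalar l.length l le_rfl (fun i => hl i (Finset.mem_univ i))
    rw [hr]
    exact Submodule.smul_mem _ _ (Submodule.mem_span_singleton_self _)
  obtain ⟨r, hr⟩ := Submodule.mem_span_singleton.1 (h2 (h Finset.univ))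
  exact ⟨r, hr.symm⟩

lemma pair_mul_mem_evenSpan (i j : Fin n) {x : A} (hx : x ∈ evenSpan γ ∅) :
    γ i * γ j * x ∈ evenSpan γ ∅ := by
  induction hx using Submodule.span_induction with
  | mem y hy =>
    obtain ⟨l, hl, -, rfl⟩ := hy
    refine Submodule.subset_span ⟨i :: j :: l, ?_, by simp, by simp [mul_assoc]⟩
    simp only [List.length_cons]
    rw [Nat.even_iff] at hl ⊢; omega
  | zero => simp
  | add y z _ _ hy hz => rw [mul_add]; exact Submodule.add_mem _ hy hz
  | smul r y _ hy => rw [mul_smul_comm]; exact Submodule.smul_mem _ r hy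

lemma one_mem_evenSpan : (1 : A) ∈ evenSpan γ ∅ :=
  Submodule.subset_span ⟨[], by simp, by simp, by simp⟩

lemma bivector_mem_evenSpan (a : Fin n → Fin n → ℝ) : bivector γ a ∈ evenSpan γ ∅ := by
  refine Submodule.smul_mem _ _ (Submodule.sum_mem _ fun i _ => Submodule.sum_mem _ fun j _ =>
    Submodule.smul_mem _ _ ?_)
  simpa using pair_mul_mem_evenSpan i j (one_mem_evenSpan (γ := γ))

lemma mul_mem_evenSpan {x y : A} (hx : x ∈ evenSpan γ ∅) (hy : y ∈ evenSpan γ ∅) :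
    x * y ∈ evenSpan γ ∅ := by
  induction hx using Submodule.span_induction with
  | mem x hx =>
    obtain ⟨l, hl, -, rfl⟩ := hx
    induction hy using Submodule.span_induction with
    | mem y hy =>
      obtain ⟨l', hl', -, rfl⟩ := hy
      exact Submodule.subset_span ⟨l ++ l', by simpa using hl.add hl', by simp, by simp⟩
    | zero => simp
    | add y z _ _ hy hz => rw [mul_add]; exact Submodule.add_mem _ hy hz
    | smul r y _ hy => rw [mul_smul_comm]; exact Submodule.smul_mem _ r hy
  | zero => simp
  | add y z _ _ hy hz => rw [add_mul]; exact Submodule.add_mem _ hy hz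
  | smul r y _ hy => rw [smul_mul_assoc]; exact Submodule.smul_mem _ r hy

end EvenSpan

/-! ### The spinor representation -/

section Spinor

variable {n : ℕ}

lemma iota_eq_sum (v : Fin n → ℝ) :
    CliffordAlgebra.ι (euclidNeg n) v = ∑ i, v i • cliffBasis n i := by
  have : v = ∑ i, v i • (Pi.single i 1 : Fin n → ℝ) := by
    ext j; simp [Finset.sum_apply, Pi.single_apply]
  conv_lhs => rw [this]
  simp [cliffBasis]

lemma cliffRel_cliffBasis : CliffRel (cliffBasis n) := by
  intro i j
  rw [cliffBasis, cliffBasis, CliffordAlgebra.ι_mul_ι_add_swap, Algebra.algebraMap_eq_smul_one]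
  congr 1
  have : ∀ v : Fin n → ℝ, euclidNeg n v = -∑ k, v k * v k := by
    intro v
    simp [euclidNeg, QuadraticMap.weightedSumSquares_apply]
  simp only [QuadraticMap.polar, this, Pi.add_apply]
  by_cases h : i = j
  · subst h
    simp [Pi.single_apply, mul_add, Finset.sum_add_distrib]
    norm_num
  · have h' : ¬ j = i := fun e => h e.symm
    simp [Pi.single_apply, mul_add, Finset.sum_add_distrib, h, h']

namespace SpinorModule

variable (S : SpinorModule n)

/-- The matrix of Clifford multiplication by the `i`-th basis vector. -/
def gam (i : Fin n) : Matrix (Fin (2 ^ (n / 2))) (Fin (2 ^ (n / 2))) ℂ := S.rho (cliffBasis n i)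

lemma cliffRel_gam : CliffRel S.gam := by
  intro i j
  simp only [gam, ← map_mul, ← map_add, cliffRel_cliffBasis i j, map_smul, map_one]

lemma gam_conjTranspose (i : Fin n) : (S.gam i)ᴴ = -S.gam i := S.skew _

lemma rho_iota (v : Fin n → ℝ) :
    S.rho (CliffordAlgebra.ι (euclidNeg n) v) = ∑ i, v i • S.gam i := by
  simp [iota_eq_sum, gam]

/-- Vectors are negated by `star` and act by skew-Hermitian matrices, so `rho` is a
*-representation. Hence the spin group acts by unitary matrices. -/
lemma rho_star (x : CliffordAlgebra (euclidNeg n)) : S.rho (star x) = (S.rho x)ᴴ := by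
  induction x using CliffordAlgebra.induction with
  | algebraMap r =>
    rw [CliffordAlgebra.star_algebraMap, AlgHom.commutes, Algebra.algebraMap_eq_smul_one,
      Matrix.conjTranspose_smul]
    simp
  | ι v => rw [CliffordAlgebra.star_ι, map_neg, S.skew]
  | mul a b ha hb => rw [star_mul, map_mul, ha, hb, map_mul, Matrix.conjTranspose_mul]
  | add a b ha hb => rw [star_add, map_add, ha, hb, map_add, Matrix.conjTranspose_add]

lemma rho_mem_evenSpan {x : CliffordAlgebra (euclidNeg n)}
    (hx : x ∈ CliffordAlgebra.even (euclidNeg n)) :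
    S.rho x ∈ evenSpan S.gam ∅ := by
  have hx' : x ∈ CliffordAlgebra.evenOdd (euclidNeg n) 0 := hx
  clear hx
  induction x, hx' using CliffordAlgebra.even_induction with
  | algebraMap r =>
    rw [AlgHom.commutes, Algebra.algebraMap_eq_smul_one]
    exact Submodule.smul_mem _ _ one_mem_evenSpan
  | add x y hx hy ihx ihy =>
    rw [map_add]; exact Submodule.add_mem _ ihx ihy
  | ι_mul_ι_mul v w x hx ih =>
    rw [map_mul, map_mul, rho_iota, rho_iota, Finset.sum_mul_sum, Finset.sum_mul]
    refine Submodule.sum_mem _ fun i _ => ?_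
    rw [Finset.sum_mul]
    refine Submodule.sum_mem _ fun j _ => ?_
    rw [smul_mul_smul_comm, smul_mul_assoc]
    exact Submodule.smul_mem _ _ (pair_mul_mem_evenSpan i j ih)

lemma bivector_conjTranspose {a : Fin n → Fin n → ℝ} (ha : ∀ i j, a i j = -a j i) :
    (bivector S.gam a)ᴴ = -bivector S.gam a := by
  have h : (∑ i, ∑ j, a i j • (S.gam i * S.gam j))ᴴ = -∑ i, ∑ j, a i j • (S.gam i * S.gam j) := by
    simp only [Matrix.conjTranspose_sum, Matrix.conjTranspose_smul, Matrix.conjTranspose_mul,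
      gam_conjTranspose, neg_mul_neg, star_trivial]
    rw [Finset.sum_comm, ← Finset.sum_neg_distrib]
    refine Finset.sum_congr rfl fun i _ => ?_
    rw [← Finset.sum_neg_distrib]
    refine Finset.sum_congr rfl fun j _ => ?_
    rw [ha]; module
  rw [bivector, Matrix.conjTranspose_smul, h]
  simp

/-- An even skew-Hermitian matrix whose commutators with the generators are those of a bivector is
that bivector. -/
lemma eq_bivector {a : Fin n → Fin n → ℝ} (ha : ∀ i j, a i j = -a j i)
    {T : Matrix (Fin (2 ^ (n / 2))) (Fin (2 ^ (n / 2))) ℂ} (hT : T ∈ evenSpan S.gam ∅)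
    (hs : Tᴴ = -T) (hc : ∀ k, T * S.gam k = S.gam k * T + ∑ j, a k j • S.gam j) :
    T = bivector S.gam a := by
  -- Evenness matters in odd dimension, where the product of all generators also commutes with each
  -- of them. That the scalar is real is what makes it incompatible with being skew-Hermitian unless
  -- it vanishes.
  obtain ⟨r, hr⟩ := S.cliffRel_gam.scalar_of_commute (x := T - bivector S.gam a)
    (Submodule.sub_mem _ hT (bivector_mem_evenSpan a)) (by
      intro i
      rw [mul_sub, sub_mul, hc, S.cliffRel_gam.bivector_comm ha]
      abel)
  have h1 : (T - bivector S.gam a)ᴴ = -(T - bivector S.gam a) := by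
    rw [Matrix.conjTranspose_sub, hs, S.bivector_conjTranspose ha]; abel
  rw [hr, Matrix.conjTranspose_smul, Matrix.conjTranspose_one, star_trivial] at h1
  have h2 : r • (1 : Matrix (Fin (2 ^ (n / 2))) (Fin (2 ^ (n / 2))) ℂ) = 0 := by
    have : (2 : ℝ) • r • (1 : Matrix (Fin (2 ^ (n / 2))) (Fin (2 ^ (n / 2))) ℂ) = 0 := by
      rw [two_smul]; nth_rewrite 1 [h1]; simp
    simpa using this
  rw [h2] at hr
  exact sub_eq_zero.1 hr

end SpinorModule

end Spinor

/-! ### Matrices acting on pairs of tuples -/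

section Act

variable {N : ℕ} {X : Type*} [AddCommGroup X] [Module ℂ X]

lemma matAct_add_right (A : Matrix (Fin N) (Fin N) ℂ) (w z : Fin N → X) :
    matAct A (w + z) = matAct A w + matAct A z := by
  ext a
  simp [matAct, Finset.sum_add_distrib]

lemma matAct_smul_right (r : ℂ) (A : Matrix (Fin N) (Fin N) ℂ) (w : Fin N → X) :
    matAct A (r • w) = r • matAct A w := by
  ext a
  simp [matAct, Finset.smul_sum, smul_smul, mul_comm]

lemma matAct_real_smul_right (r : ℝ) (A : Matrix (Fin N) (Fin N) ℂ) (w : Fin N → X) :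
    matAct A (r • w) = r • matAct A w := by
  ext a
  simp only [matAct, Finset.smul_sum, Pi.smul_apply]
  exact Finset.sum_congr rfl fun b _ => smul_comm _ _ _

lemma matAct_mul (A B : Matrix (Fin N) (Fin N) ℂ) (w : Fin N → X) :
    matAct (A * B) w = matAct A (matAct B w) := by
  ext a
  simp only [matAct, Matrix.mul_apply, Finset.sum_smul, Finset.smul_sum, mul_smul]
  exact Finset.sum_comm

lemma matAct_one (w : Fin N → X) : matAct (1 : Matrix (Fin N) (Fin N) ℂ) w = w := by
  ext a
  simp [matAct, Matrix.one_apply]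

/-- The diagonal action of a matrix `A` on pairs, with matrix `((A, 0), (0, A))`. -/
def act : Matrix (Fin N) (Fin N) ℂ →ₗ[ℝ] ((Fin N → X) × (Fin N → X)) →ₗ[ℝ]
    ((Fin N → X) × (Fin N → X)) :=
  LinearMap.mk₂ ℝ (fun A u => (matAct A u.1, matAct A u.2))
    (fun A B u => by simp [matAct_add_left])
    (fun r A u => by simp [matAct_smul_left])
    (fun A u v => by simp [matAct_add_right])
    (fun r A u => by simp [matAct_real_smul_right])

/-- The off-diagonal action of a matrix `A` on pairs, with matrix `((0, A), (A, 0))`. -/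
def cl : Matrix (Fin N) (Fin N) ℂ →ₗ[ℝ] ((Fin N → X) × (Fin N → X)) →ₗ[ℝ]
    ((Fin N → X) × (Fin N → X)) :=
  LinearMap.mk₂ ℝ (fun A u => (matAct A u.2, matAct A u.1))
    (fun A B u => by simp [matAct_add_left])
    (fun r A u => by simp [matAct_smul_left])
    (fun A u v => by simp [matAct_add_right])
    (fun r A u => by simp [matAct_real_smul_right])

/-- The action on pairs of the matrix `((0, -i), (i, 0))`. -/
def sigL : ((Fin N → X) × (Fin N → X)) →ₗ[ℝ] ((Fin N → X) × (Fin N → X)) where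
  toFun u := (-Complex.I • u.2, Complex.I • u.1)
  map_add' u v := by simp
  map_smul' r u := by
    simp only [Prod.smul_fst, Prod.smul_snd, RingHom.id_apply, Prod.smul_mk]
    rw [smul_comm, smul_comm Complex.I]

variable (A B : Matrix (Fin N) (Fin N) ℂ) (u : (Fin N → X) × (Fin N → X))

lemma act_apply : act A u = (matAct A u.1, matAct A u.2) := rfl

lemma cl_apply : cl A u = (matAct A u.2, matAct A u.1) := rfl

lemma act_mul : act (A * B) u = act A (act B u) := by simp [act_apply, matAct_mul]

lemma act_one : act (1 : Matrix (Fin N) (Fin N) ℂ) u = u := by simp [act_apply, matAct_one]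

lemma cl_cl : cl A (cl B u) = act (A * B) u := by simp [act_apply, cl_apply, matAct_mul]

lemma act_cl : act A (cl B u) = cl (A * B) u := by simp [act_apply, cl_apply, matAct_mul]

lemma cl_act : cl A (act B u) = cl (A * B) u := by simp [act_apply, cl_apply, matAct_mul]

lemma sigL_act : sigL (act A u) = act A (sigL u) := by
  simp only [act_apply, sigL, LinearMap.coe_mk, AddHom.coe_mk, matAct_smul_right]

lemma sigL_cl : sigL (cl A u) = -cl A (sigL u) := by
  simp only [cl_apply, sigL, LinearMap.coe_mk, AddHom.coe_mk, matAct_smul_right]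
  simp

lemma sigL_sigL : sigL (sigL u) = u := by
  simp [sigL, smul_smul]

end Act

/-! ### The Hermitian product on the fibres of `S` -/

section Herm

variable {M : Type*} {n : ℕ} {V : M → Type*}
  [∀ x, NormedAddCommGroup (V x)] [∀ x, InnerProductSpace ℂ (V x)] {x : M}

lemma sum_inner_matAct {N : ℕ} {X : Type*} [NormedAddCommGroup X] [InnerProductSpace ℂ X]
    (A : Matrix (Fin N) (Fin N) ℂ) (w z : Fin N → X) :
    ∑ a, inner ℂ (matAct A w a) (z a) = ∑ a, inner ℂ (w a) (matAct Aᴴ z a) := by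
  simp only [matAct, sum_inner, inner_sum, inner_smul_left, inner_smul_right]
  rw [Finset.sum_comm]
  simp [Matrix.conjTranspose_apply]

namespace SpinInitialData

lemma sig_eq_sigL (u : SFiber n V x) : sig u = sigL u := rfl

lemma herm_act (A : Matrix (Fin (2 ^ (n / 2))) (Fin (2 ^ (n / 2))) ℂ) (u v : SFiber n V x) :
    herm (act A u) v = herm u (act Aᴴ v) := by
  simp only [herm, act_apply, sum_inner_matAct]

lemma herm_cl (A : Matrix (Fin (2 ^ (n / 2))) (Fin (2 ^ (n / 2))) ℂ) (u v : SFiber n V x) :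
    herm (cl A u) v = herm u (cl Aᴴ v) := by
  simp only [herm, cl_apply, sum_inner_matAct]
  rw [add_comm]

lemma herm_sigL (u v : SFiber n V x) : herm (sigL u) v = herm u (sigL v) := by
  simp only [herm, sigL, LinearMap.coe_mk, AddHom.coe_mk, Pi.smul_apply, inner_smul_left,
    inner_smul_right, ← Finset.mul_sum, map_neg, Complex.conj_I, neg_neg]
  ring

lemma herm_add_left (u u' v : SFiber n V x) : herm (u + u') v = herm u v + herm u' v := by
  simp only [herm, Prod.fst_add, Prod.snd_add, Pi.add_apply, inner_add_left,
    Finset.sum_add_distrib]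
  ring

lemma herm_add_right (u v v' : SFiber n V x) : herm u (v + v') = herm u v + herm u v' := by
  simp only [herm, Prod.fst_add, Prod.snd_add, Pi.add_apply, inner_add_right,
    Finset.sum_add_distrib]
  ring

lemma herm_smul_left (r : ℝ) (u v : SFiber n V x) : herm (r • u) v = r * herm u v := by
  simp only [herm, Prod.smul_fst, Prod.smul_snd, Pi.smul_apply, inner_smul_left_eq_smul,
    Finset.mul_sum, mul_add, Complex.real_smul]

lemma herm_smul_right (r : ℝ) (u v : SFiber n V x) : herm u (r • v) = r * herm u v := by
  simp only [herm, Prod.smul_fst, Prod.smul_snd, Pi.smul_apply, inner_smul_right_eq_smul,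
    Finset.mul_sum, mul_add, Complex.real_smul]

/-- The Hermitian inner product as a real-bilinear map. -/
def hermL : SFiber n V x →ₗ[ℝ] SFiber n V x →ₗ[ℝ] ℂ :=
  LinearMap.mk₂ ℝ herm herm_add_left (fun r u v => by rw [herm_smul_left, Complex.real_smul])
    herm_add_right (fun r u v => by rw [herm_smul_right, Complex.real_smul])

lemma herm_eq_hermL (u v : SFiber n V x) : herm u v = hermL u v := rfl

end SpinInitialData

end Herm

/-! ### Smooth sections and covariant derivatives -/

section Sections

variable {n : ℕ} {H : Type*} [TopologicalSpace H]
  {I : ModelWithCorners ℝ (EuclideanSpace ℝ (Fin n)) H}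
  {M : Type*} [TopologicalSpace M] [ChartedSpace H M]
  {F : Type*} [NormedAddCommGroup F] [NormedSpace ℝ F]
  {V : M → Type*} [TopologicalSpace (TotalSpace F V)]
  [∀ x, AddCommGroup (V x)] [∀ x, Module ℝ (V x)] [∀ x, TopologicalSpace (V x)]
  [∀ x, IsTopologicalAddGroup (V x)] [∀ x, ContinuousSMul ℝ (V x)] [FiberBundle F V]
  {s t : Π x : M, V x} {U U' : Set M} {x : M}

lemma ContMDiffOn.mdifferentiableAt_of_isOpen {W : Type*} [NormedAddCommGroup W] [NormedSpace ℝ W]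
    {f : M → W} (hf : ContMDiffOn I 𝓘(ℝ, W) ∞ f U) (hU : IsOpen U) (hx : x ∈ U) :
    MDifferentiableAt I 𝓘(ℝ, W) f x :=
  (hf.contMDiffAt (hU.mem_nhds hx)).mdifferentiableAt (by simp)

lemma ContMDiffOn.finset_sum_fun {W : Type*} [NormedAddCommGroup W] [NormedSpace ℝ W]
    {ι : Type*} {S : Finset ι} {f : ι → M → W}
    (hf : ∀ i ∈ S, ContMDiffOn I 𝓘(ℝ, W) ∞ (f i) U) :
    ContMDiffOn I 𝓘(ℝ, W) ∞ (fun y => ∑ i ∈ S, f i y) U := by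
  classical
  induction S using Finset.induction_on with
  | empty => simpa using contMDiffOn_const
  | insert i S hi ih =>
    simp only [Finset.sum_insert hi]
    exact (hf i (Finset.mem_insert_self i S)).add
      (ih fun j hj => hf j (Finset.mem_insert_of_mem hj))

lemma mvfderiv_congr {W : Type*} [NormedAddCommGroup W] [NormedSpace ℝ W] {f g : M → W}
    (h : f =ᶠ[nhds x] g) : mvfderiv I f x = mvfderiv I g x := by
  ext v
  simp only [mvfderiv]
  have := h.mfderiv_eq (I := I) (I' := 𝓘(ℝ, W))
  rw [ContinuousLinearMap.comp_apply, ContinuousLinearMap.comp_apply, this]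
  rfl

lemma mvfderiv_finset_sum {W : Type*} [NormedAddCommGroup W] [NormedSpace ℝ W]
    {ι : Type*} {S : Finset ι} {f : ι → M → W}
    (hf : ∀ i ∈ S, MDifferentiableAt I 𝓘(ℝ, W) (f i) x) :
    mvfderiv I (fun y => ∑ i ∈ S, f i y) x = ∑ i ∈ S, mvfderiv I (f i) x := by
  classical
  have key : MDifferentiableAt I 𝓘(ℝ, W) (fun y => ∑ i ∈ S, f i y) x ∧
      mvfderiv I (fun y => ∑ i ∈ S, f i y) x = ∑ i ∈ S, mvfderiv I (f i) x := by
    induction S using Finset.induction_on with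
    | empty => simpa using ⟨mdifferentiableAt_const, mvfderiv_const (0 : W)⟩
    | insert i S hi ih =>
      obtain ⟨h1, h2⟩ := ih fun j hj => hf j (Finset.mem_insert_of_mem hj)
      have h3 := hf i (Finset.mem_insert_self i S)
      simp only [Finset.sum_insert hi]
      exact ⟨h3.add h1, by rw [mvfderiv_fun_add h3 h1, h2]⟩
  exact key.2

namespace SmoothSectionOn

lemma mono (h : SmoothSectionOn I F s U) (hU : U' ⊆ U) : SmoothSectionOn I F s U' :=
  ContMDiffOn.mono h hU

lemma congr (h : SmoothSectionOn I F s U) (hst : ∀ y ∈ U, t y = s y) :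
    SmoothSectionOn I F t U :=
  ContMDiffOn.congr h fun y hy => by rw [hst y hy]

lemma mdifferentiableAt (h : SmoothSectionOn I F s U) (hU : IsOpen U) (hx : x ∈ U) :
    MDifferentiableAt I (I.prod 𝓘(ℝ, F)) (fun y => (TotalSpace.mk' F y (s y) : TotalSpace F V)) x :=
  (ContMDiffOn.contMDiffAt h (hU.mem_nhds hx)).mdifferentiableAt (by simp)

/-- Smoothness on open sets is local. -/
lemma of_local (h : ∀ y ∈ U, ∃ W, IsOpen W ∧ y ∈ W ∧ SmoothSectionOn I F s (U ∩ W)) :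
    SmoothSectionOn I F s U := by
  intro y hy
  obtain ⟨W, hW, hyW, hs⟩ := h y hy
  exact (hs y ⟨hy, hyW⟩).mono_of_mem_nhdsWithin
    (Filter.inter_mem self_mem_nhdsWithin (mem_nhdsWithin_of_mem_nhds (hW.mem_nhds hyW)))

variable [VectorBundle ℝ F V]

lemma zero : SmoothSectionOn I F (fun y => (0 : V y)) U :=
  ContMDiffOn.of_le (contMDiffOn_zeroSection (n := ∞) ℝ V) le_rfl

lemma add (hs : SmoothSectionOn I F s U) (ht : SmoothSectionOn I F t U) :
    SmoothSectionOn I F (fun y => s y + t y) U :=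
  ContMDiffOn.add_section hs ht

lemma sub (hs : SmoothSectionOn I F s U) (ht : SmoothSectionOn I F t U) :
    SmoothSectionOn I F (fun y => s y - t y) U :=
  ContMDiffOn.sub_section hs ht

lemma neg (hs : SmoothSectionOn I F s U) : SmoothSectionOn I F (fun y => -s y) U :=
  ContMDiffOn.neg_section hs

lemma smul {f : M → ℝ} (hf : ContMDiffOn I 𝓘(ℝ, ℝ) ∞ f U) (hs : SmoothSectionOn I F s U) :
    SmoothSectionOn I F (fun y => f y • s y) U :=
  ContMDiffOn.smul_section hf hs

lemma sum {ι : Type*} {S : Finset ι} {s : ι → Π x : M, V x}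
    (hs : ∀ i ∈ S, SmoothSectionOn I F (s i) U) :
    SmoothSectionOn I F (fun y => ∑ i ∈ S, s i y) U :=
  ContMDiffOn.sum_section hs

/-- A section that is smooth on an open set `U` and vanishes off a closed subset of `U` is
smooth. -/
lemma extend_zero {K : Set M} (hs : SmoothSectionOn I F s U) (hU : IsOpen U) (hK : IsClosed K)
    (hKU : K ⊆ U) (h0 : ∀ y ∉ K, s y = 0) : SmoothSectionOn I F s Set.univ := by
  refine of_local fun y _ => ?_
  by_cases hy : y ∈ K
  · exact ⟨U, hU, hKU hy, by simpa using hs⟩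
  · exact ⟨Kᶜ, hK.isOpen_compl, hy, (zero (U := Set.univ ∩ Kᶜ)).congr fun z hz => h0 z hz.2⟩

end SmoothSectionOn

namespace CovariantDerivative

variable (cov : CovariantDerivative I F V)

lemma congr_nhds (h : ∀ᶠ y in nhds x, s y = t y) (hU : IsOpen U) (hx : x ∈ U)
    (ht : SmoothSectionOn I F t U) : cov s x = cov t x := by
  have h1 := ht.mdifferentiableAt hU hx
  refine cov.isCovariantDerivativeOnUniv.congr_of_eventuallyEq ?_ h1 Filter.univ_mem h
  exact h1.congr_of_eventuallyEq (h.mono fun y hy => by simp only [hy])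

lemma congr_on (h : ∀ y ∈ U, s y = t y) (hU : IsOpen U) (hx : x ∈ U)
    (ht : SmoothSectionOn I F t U) : cov s x = cov t x :=
  cov.congr_nhds (Filter.mem_of_superset (hU.mem_nhds hx) h) hU hx ht

lemma fun_add (hU : IsOpen U) (hx : x ∈ U) (hs : SmoothSectionOn I F s U)
    (ht : SmoothSectionOn I F t U) :
    cov (fun y => s y + t y) x = cov s x + cov t x :=
  cov.isCovariantDerivativeOnUniv.add (hs.mdifferentiableAt hU hx) (ht.mdifferentiableAt hU hx)

lemma fun_smul (hU : IsOpen U) (hx : x ∈ U) {f : M → ℝ} (hf : ContMDiffOn I 𝓘(ℝ, ℝ) ∞ f U)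
    (hs : SmoothSectionOn I F s U) (v : TangentSpace I x) :
    cov (fun y => f y • s y) x v = f x • cov s x v + mvfderiv I f x v • s x := by
  have := cov.isCovariantDerivativeOnUniv.leibniz (hs.mdifferentiableAt hU hx)
    (hf.mdifferentiableAt_of_isOpen hU hx)
  exact congr($this v)

variable [VectorBundle ℝ F V]

lemma fun_zero : cov (fun y => (0 : V y)) x = 0 :=
  congrFun cov.zero x

lemma fun_sum (hU : IsOpen U) (hx : x ∈ U) {ι : Type*} {S : Finset ι} {s : ι → Π x : M, V x}
    (hs : ∀ i ∈ S, SmoothSectionOn I F (s i) U) :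
    cov (fun y => ∑ i ∈ S, s i y) x = ∑ i ∈ S, cov (s i) x := by
  classical
  induction S using Finset.induction_on with
  | empty => simpa using cov.fun_zero
  | insert i S hi ih =>
    simp only [Finset.sum_insert hi]
    rw [cov.fun_add hU hx (hs i (Finset.mem_insert_self i S))
      (SmoothSectionOn.sum fun j hj => hs j (Finset.mem_insert_of_mem hj)),
      ih fun j hj => hs j (Finset.mem_insert_of_mem hj)]

lemma fun_neg (hU : IsOpen U) (hx : x ∈ U) (hs : SmoothSectionOn I F s U) :
    cov (fun y => -s y) x = -cov s x := by
  have h := cov.fun_add hU hx hs hs.neg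
  simp only [add_neg_cancel] at h
  rw [cov.fun_zero] at h
  exact (neg_eq_of_add_eq_zero_right h.symm).symm

lemma fun_sub (hU : IsOpen U) (hx : x ∈ U) (hs : SmoothSectionOn I F s U)
    (ht : SmoothSectionOn I F t U) :
    cov (fun y => s y - t y) x = cov s x - cov t x := by
  simp only [sub_eq_add_neg]
  rw [cov.fun_add hU hx hs ht.neg, cov.fun_neg hU hx ht]

/-- Leibniz rule for a linear combination of sections. -/
lemma fun_sum_smul (hU : IsOpen U) (hx : x ∈ U) {ι : Type*} {S : Finset ι} {s : ι → Π x : M, V x}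
    {f : ι → M → ℝ} (hf : ∀ i ∈ S, ContMDiffOn I 𝓘(ℝ, ℝ) ∞ (f i) U)
    (hs : ∀ i ∈ S, SmoothSectionOn I F (s i) U) (v : TangentSpace I x) :
    cov (fun y => ∑ i ∈ S, f i y • s i y) x v =
      ∑ i ∈ S, (f i x • cov (s i) x v + mvfderiv I (f i) x v • s i x) := by
  rw [cov.fun_sum hU hx fun i hi => (hs i hi).smul (hf i hi), sum_apply]
  exact Finset.sum_congr rfl fun i hi => cov.fun_smul hU hx (hf i hi) (hs i hi) v

end CovariantDerivative

end Sections

/-! ### Complex vector bundles -/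

section ComplexSections

variable {n : ℕ} {H : Type*} [TopologicalSpace H]
  {I : ModelWithCorners ℝ (EuclideanSpace ℝ (Fin n)) H}
  {M : Type*} [TopologicalSpace M] [ChartedSpace H M]
  {F : Type*} [NormedAddCommGroup F] [NormedSpace ℂ F]
  {V : M → Type*} [TopologicalSpace (TotalSpace F V)]
  [∀ x, NormedAddCommGroup (V x)] [∀ x, InnerProductSpace ℂ (V x)]
  [FiberBundle F V] [VectorBundle ℂ F V] [VectorBundle ℝ F V]
  {s t : Π x : M, V x} {U U' : Set M} {x : M}

lemma ContMDiffOn.complex_re {f : M → ℂ} (hf : ContMDiffOn I 𝓘(ℝ, ℂ) ∞ f U) :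
    ContMDiffOn I 𝓘(ℝ, ℝ) ∞ (fun y => (f y).re) U :=
  (Complex.reCLM.contMDiff.comp_contMDiffOn hf :)

lemma ContMDiffOn.complex_im {f : M → ℂ} (hf : ContMDiffOn I 𝓘(ℝ, ℂ) ∞ f U) :
    ContMDiffOn I 𝓘(ℝ, ℝ) ∞ (fun y => (f y).im) U :=
  (Complex.imCLM.contMDiff.comp_contMDiffOn hf :)

lemma ContMDiffOn.complex_ofReal {f : M → ℝ} (hf : ContMDiffOn I 𝓘(ℝ, ℝ) ∞ f U) :
    ContMDiffOn I 𝓘(ℝ, ℂ) ∞ (fun y => (f y : ℂ)) U :=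
  (Complex.ofRealCLM.contMDiff.comp_contMDiffOn hf :)

lemma mvfderiv_clm_comp {W W' : Type*} [NormedAddCommGroup W] [NormedSpace ℝ W]
    [NormedAddCommGroup W'] [NormedSpace ℝ W'] (L : W →L[ℝ] W') {f : M → W}
    (hf : MDifferentiableAt I 𝓘(ℝ, W) f x) (v : TangentSpace I x) :
    mvfderiv I (fun y => L (f y)) x v = L (mvfderiv I f x v) := by
  have h := (L.hasMFDerivAt (x := f x)).comp x hf.hasMFDerivAt
  have h2 := h.mfderiv
  change (mfderiv I 𝓘(ℝ, W') (⇑L ∘ f) x) v = _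
  rw [h2]; rfl

/-- The trivializations are complex linear, so in them multiplication by i is a constant real-linear
map of `F`. It reduces complex coefficients to pairs of real ones. -/
lemma SmoothSectionOn.I_smul (hs : SmoothSectionOn I F s U) :
    SmoothSectionOn I F (fun y => Complex.I • s y) U := by
  intro x₀ hx₀
  have h := hs x₀ hx₀
  rw [contMDiffWithinAt_section] at h ⊢
  set e := trivializationAt F V x₀
  have hL : ContMDiff 𝓘(ℝ, F) 𝓘(ℝ, F) ∞ (fun w : F => Complex.I • w) :=
    ((Complex.I • ContinuousLinearMap.id ℝ F : F →L[ℝ] F)).contMDiff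
  refine (hL.contMDiffAt.comp_contMDiffWithinAt x₀ h).congr_of_eventuallyEq ?_ ?_
  · refine Filter.eventually_of_mem (U := e.baseSet) (mem_nhdsWithin_of_mem_nhds <|
      e.open_baseSet.mem_nhds (mem_baseSet_trivializationAt F V x₀)) fun y hy => ?_
    exact (e.linear ℂ hy).map_smul Complex.I (s y)
  · exact (e.linear ℂ (mem_baseSet_trivializationAt F V x₀)).map_smul Complex.I (s x₀)

lemma complex_smul_eq {X : Type*} [AddCommGroup X] [Module ℂ X] (z : ℂ) (w : X) :
    z • w = z.re • w + z.im • (Complex.I • w) := by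
  conv_lhs => rw [← Complex.re_add_im z]
  rw [add_smul, mul_smul, Complex.coe_smul, Complex.coe_smul]

lemma SmoothSectionOn.csmul {f : M → ℂ} (hf : ContMDiffOn I 𝓘(ℝ, ℂ) ∞ f U)
    (hs : SmoothSectionOn I F s U) : SmoothSectionOn I F (fun y => f y • s y) U := by
  refine ((hs.smul hf.complex_re).add (hs.I_smul.smul hf.complex_im)).congr fun y _ => ?_
  exact complex_smul_eq _ _

end ComplexSections

/-! ### Pairs of tuples of sections -/

namespace SpinInitialData

variable {n : ℕ} {H : Type*} [TopologicalSpace H]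
  {I : ModelWithCorners ℝ (EuclideanSpace ℝ (Fin n)) H}
  {M : Type*} [TopologicalSpace M] [ChartedSpace H M] [IsManifold I ∞ M]
  {F : Type*} [NormedAddCommGroup F] [NormedSpace ℂ F] [FiniteDimensional ℂ F]
  {V : M → Type*} [TopologicalSpace (TotalSpace F V)]
  [∀ x, NormedAddCommGroup (V x)] [∀ x, InnerProductSpace ℂ (V x)]
  [FiberBundle F V] [VectorBundle ℂ F V] [VectorBundle ℝ F V] [ContMDiffVectorBundle ∞ F V I]
  {κ : Type*} [RiemannianBundle (fun x : M => TangentSpace I x)]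
  [IsContMDiffRiemannianBundle I ∞ (EuclideanSpace ℝ (Fin n)) (fun x : M => TangentSpace I x)]

/-- Square matrices of the size of the spinor module. -/
abbrev SMat (n : ℕ) : Type := Matrix (Fin (2 ^ (n / 2))) (Fin (2 ^ (n / 2))) ℂ

variable (I) in
/-- The matrix-valued function `A` is smooth on `U`. -/
def SmoothMat (A : M → SMat n) (U : Set M) : Prop :=
  ∀ a b, ContMDiffOn I 𝓘(ℝ, ℂ) ∞ (fun y => A y a b) U

variable (I) in
/-- The derivative of a matrix-valued function. -/
def dMat (A : M → SMat n) (x : M) (v : TangentSpace I x) : SMat n :=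
  fun a b => mvfderiv I (fun y => A y a b) x v

variable (I F) in
/-- All components of `s` are smooth sections of `V` over `U`. -/
def SmoothPair (s : Π x : M, SFiber n V x) (U : Set M) : Prop :=
  ∀ a, SmoothSectionOn I F (fun y => (s y).1 a) U ∧ SmoothSectionOn I F (fun y => (s y).2 a) U

variable {s t : Π x : M, SFiber n V x} {U U' : Set M} {x : M} {A B : M → SMat n}

lemma contMDiffOn_complex_mul {f g : M → ℂ} (hf : ContMDiffOn I 𝓘(ℝ, ℂ) ∞ f U)
    (hg : ContMDiffOn I 𝓘(ℝ, ℂ) ∞ g U) : ContMDiffOn I 𝓘(ℝ, ℂ) ∞ (fun y => f y * g y) U :=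
  ((contDiff_mul (𝕜 := ℝ) (𝔸 := ℂ)).contMDiff.comp_contMDiffOn (hf.prodMk_space hg) :)

namespace SmoothMat

lemma mono (h : SmoothMat I A U) (hU : U' ⊆ U) : SmoothMat I A U' := fun a b => (h a b).mono hU

lemma const (C : SMat n) : SmoothMat I (fun _ : M => C) U := fun _ _ => contMDiffOn_const

lemma smul {f : M → ℝ} (hf : ContMDiffOn I 𝓘(ℝ, ℝ) ∞ f U) (hA : SmoothMat I A U) :
    SmoothMat I (fun y => f y • A y) U :=
  fun a b => hf.smul (hA a b)

lemma sum {ι : Type*} {S : Finset ι} {A : ι → M → SMat n} (hA : ∀ i ∈ S, SmoothMat I (A i) U) :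
    SmoothMat I (fun y => ∑ i ∈ S, A i y) U := by
  intro a b
  simp only [Matrix.sum_apply]
  exact ContMDiffOn.finset_sum_fun fun i hi => hA i hi a b

lemma conjTranspose (hA : SmoothMat I A U) : SmoothMat I (fun y => (A y)ᴴ) U := by
  intro a b
  simp only [Matrix.conjTranspose_apply]
  exact (Complex.conjCLE.toContinuousLinearMap.contMDiff.comp_contMDiffOn (hA b a) :)

end SmoothMat

lemma dMat_const (C : SMat n) (v : TangentSpace I x) : dMat I (fun _ : M => C) x v = 0 := by
  ext a b
  simp [dMat, mvfderiv_const]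

lemma dMat_congr (h : A =ᶠ[nhds x] B) (v : TangentSpace I x) : dMat I A x v = dMat I B x v := by
  ext a b
  simp only [dMat]
  rw [mvfderiv_congr (g := fun y => B y a b) (h.mono fun y hy => by simp only [hy])]

lemma mvfderiv_mul_complex {f g : M → ℂ} (hf : MDifferentiableAt I 𝓘(ℝ, ℂ) f x)
    (hg : MDifferentiableAt I 𝓘(ℝ, ℂ) g x) (v : TangentSpace I x) :
    mvfderiv I (fun y => f y * g y) x v = mvfderiv I f x v * g x + f x * mvfderiv I g x v := by
  have h := (hf.hasMFDerivAt.mul' hg.hasMFDerivAt).mfderiv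
  change (mfderiv I 𝓘(ℝ, ℂ) (f * g) x) v = _
  rw [h]
  change f x * mvfderiv I g x v + mvfderiv I f x v * g x = _
  ring

lemma dMat_mul (hU : IsOpen U) (hx : x ∈ U) (hA : SmoothMat I A U) (hB : SmoothMat I B U)
    (v : TangentSpace I x) :
    dMat I (fun y => A y * B y) x v = dMat I A x v * B x + A x * dMat I B x v := by
  ext a b
  simp only [dMat, Matrix.mul_apply, Matrix.add_apply]
  have hA' := fun a b => (hA a b).mdifferentiableAt_of_isOpen hU hx
  have hB' := fun a b => (hB a b).mdifferentiableAt_of_isOpen hU hx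
  rw [mvfderiv_finset_sum (f := fun c y => A y a c * B y c b)
    fun c _ => (contMDiffOn_complex_mul (hA a c) (hB c b)).mdifferentiableAt_of_isOpen hU hx,
    sum_apply, ← Finset.sum_add_distrib]
  exact Finset.sum_congr rfl fun c _ => mvfderiv_mul_complex (hA' a c) (hB' c b) v

lemma dMat_sum_smul (hU : IsOpen U) (hx : x ∈ U) {ι : Type*} {S : Finset ι} {f : ι → M → ℝ}
    (hf : ∀ i ∈ S, ContMDiffOn I 𝓘(ℝ, ℝ) ∞ (f i) U) (C : ι → SMat n) (v : TangentSpace I x) :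
    dMat I (fun y => ∑ i ∈ S, f i y • C i) x v = ∑ i ∈ S, mvfderiv I (f i) x v • C i := by
  ext a b
  simp only [dMat, Matrix.sum_apply, Matrix.smul_apply]
  rw [mvfderiv_finset_sum (f := fun i y => f i y • C i a b)
    fun i hi => ((hf i hi).smul contMDiffOn_const).mdifferentiableAt_of_isOpen hU hx, sum_apply]
  refine Finset.sum_congr rfl fun i hi => ?_
  rw [mvfderiv_fun_smul ((hf i hi).mdifferentiableAt_of_isOpen hU hx) mdifferentiableAt_const]
  simp [mvfderiv_const]

lemma dMat_conjTranspose (hU : IsOpen U) (hx : x ∈ U) (hA : SmoothMat I A U)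
    (v : TangentSpace I x) : dMat I (fun y => (A y)ᴴ) x v = (dMat I A x v)ᴴ := by
  ext a b
  exact mvfderiv_clm_comp Complex.conjCLE.toContinuousLinearMap
    ((hA b a).mdifferentiableAt_of_isOpen hU hx) v

namespace SmoothPair

lemma mono (h : SmoothPair I F s U) (hU : U' ⊆ U) : SmoothPair I F s U' :=
  fun a => ⟨(h a).1.mono hU, (h a).2.mono hU⟩

lemma congr (h : SmoothPair I F s U) (hst : ∀ y ∈ U, t y = s y) : SmoothPair I F t U :=
  fun a => ⟨(h a).1.congr fun y hy => by rw [hst y hy], (h a).2.congr fun y hy => by rw [hst y hy]⟩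

lemma of_local (h : ∀ y ∈ U, ∃ W, IsOpen W ∧ y ∈ W ∧ SmoothPair I F s (U ∩ W)) :
    SmoothPair I F s U :=
  fun a => ⟨.of_local fun y hy => by
    obtain ⟨W, hW, hyW, hs⟩ := h y hy
    exact ⟨W, hW, hyW, (hs a).1⟩, .of_local fun y hy => by
    obtain ⟨W, hW, hyW, hs⟩ := h y hy
    exact ⟨W, hW, hyW, (hs a).2⟩⟩

lemma zero : SmoothPair I F (fun x => (0 : SFiber n V x)) U := fun _ => ⟨.zero, .zero⟩

lemma add (hs : SmoothPair I F s U) (ht : SmoothPair I F t U) :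
    SmoothPair I F (fun y => s y + t y) U :=
  fun a => ⟨(hs a).1.add (ht a).1, (hs a).2.add (ht a).2⟩

lemma smul {f : M → ℝ} (hf : ContMDiffOn I 𝓘(ℝ, ℝ) ∞ f U) (hs : SmoothPair I F s U) :
    SmoothPair I F (fun y => f y • s y) U :=
  fun a => ⟨(hs a).1.smul hf, (hs a).2.smul hf⟩

lemma sum {ι : Type*} {S : Finset ι} {s : ι → Π x : M, SFiber n V x}
    (hs : ∀ i ∈ S, SmoothPair I F (s i) U) : SmoothPair I F (fun y => ∑ i ∈ S, s i y) U := by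
  refine fun a => ⟨(SmoothSectionOn.sum fun i hi => (hs i hi a).1).congr fun y _ => ?_,
    (SmoothSectionOn.sum fun i hi => (hs i hi a).2).congr fun y _ => ?_⟩
  · simp [Prod.fst_sum, Finset.sum_apply]
  · simp [Prod.snd_sum, Finset.sum_apply]

lemma act (hA : SmoothMat I A U) (hs : SmoothPair I F s U) :
    SmoothPair I F (fun y => _root_.act (A y) (s y)) U :=
  fun a => ⟨(SmoothSectionOn.sum (S := Finset.univ) fun b _ => (hs b).1.csmul (hA a b)).congr
      fun _ _ => rfl,
    (SmoothSectionOn.sum (S := Finset.univ) fun b _ => (hs b).2.csmul (hA a b)).congr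
      fun _ _ => rfl⟩

lemma cl (hA : SmoothMat I A U) (hs : SmoothPair I F s U) :
    SmoothPair I F (fun y => _root_.cl (A y) (s y)) U :=
  fun a => ⟨(SmoothSectionOn.sum (S := Finset.univ) fun b _ => (hs b).2.csmul (hA a b)).congr
      fun _ _ => rfl,
    (SmoothSectionOn.sum (S := Finset.univ) fun b _ => (hs b).1.csmul (hA a b)).congr
      fun _ _ => rfl⟩

lemma sigL (hs : SmoothPair I F s U) : SmoothPair I F (fun y => _root_.sigL (s y)) U :=
  fun a => ⟨(hs a).2.csmul (f := fun _ => -Complex.I) contMDiffOn_const,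
    (hs a).1.csmul (f := fun _ => Complex.I) contMDiffOn_const⟩

end SmoothPair

variable (d : SpinInitialData I M F V κ)

/-- The covariant derivative satisfies the Leibniz rule for real functions; splitting `f` into real
and imaginary parts and using the complex linearity of the connection extends it. -/
lemma conn_csmul (hU : IsOpen U) (hx : x ∈ U) {f : M → ℂ} (hf : ContMDiffOn I 𝓘(ℝ, ℂ) ∞ f U)
    {s : Π x : M, V x} (hs : SmoothSectionOn I F s U) (v : TangentSpace I x) :
    d.conn (fun y => f y • s y) x v = f x • d.conn s x v + mvfderiv I f x v • s x := by
  have e : (fun y => f y • s y) = fun y => (f y).re • s y + (f y).im • (Complex.I • s y) :=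
    funext fun y => complex_smul_eq _ _
  rw [e, d.conn.fun_add hU hx (hs.smul hf.complex_re) (hs.I_smul.smul hf.complex_im),
    add_apply, d.conn.fun_smul hU hx hf.complex_re hs,
    d.conn.fun_smul hU hx hf.complex_im hs.I_smul, d.complex_conn U hU s hs x hx]
  have h1 : mvfderiv I (fun y => (f y).re) x v = (mvfderiv I f x v).re :=
    mvfderiv_clm_comp Complex.reCLM (hf.mdifferentiableAt_of_isOpen hU hx) v
  have h2 : mvfderiv I (fun y => (f y).im) x v = (mvfderiv I f x v).im :=
    mvfderiv_clm_comp Complex.imCLM (hf.mdifferentiableAt_of_isOpen hU hx) v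
  rw [h1, h2, complex_smul_eq (f x), complex_smul_eq (mvfderiv I f x v)]
  abel

/-- The connection of `V` acting on the components of a pair of tuples. -/
def connS (s : Π x : M, SFiber n V x) (x : M) : TangentSpace I x →ₗ[ℝ] SFiber n V x where
  toFun v := (fun a => d.conn (fun y => (s y).1 a) x v, fun a => d.conn (fun y => (s y).2 a) x v)
  map_add' v w := by ext a <;> simp
  map_smul' r v := by ext a <;> simp

lemma connS_congr_nhds (h : ∀ᶠ y in nhds x, s y = t y) (hU : IsOpen U) (hx : x ∈ U)
    (ht : SmoothPair I F t U) : d.connS s x = d.connS t x := by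
  ext v a
  · exact congr($(d.conn.congr_nhds (h.mono fun y hy => by rw [hy]) hU hx (ht a).1) v)
  · exact congr($(d.conn.congr_nhds (h.mono fun y hy => by rw [hy]) hU hx (ht a).2) v)

lemma connS_add (hU : IsOpen U) (hx : x ∈ U) (hs : SmoothPair I F s U) (ht : SmoothPair I F t U) :
    d.connS (fun y => s y + t y) x = d.connS s x + d.connS t x := by
  ext v a
  · exact congr($(d.conn.fun_add hU hx (hs a).1 (ht a).1) v)
  · exact congr($(d.conn.fun_add hU hx (hs a).2 (ht a).2) v)

lemma connS_sum (hU : IsOpen U) (hx : x ∈ U) {ι : Type*} {S : Finset ι}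
    {s : ι → Π x : M, SFiber n V x} (hs : ∀ i ∈ S, SmoothPair I F (s i) U) :
    d.connS (fun y => ∑ i ∈ S, s i y) x = ∑ i ∈ S, d.connS (s i) x := by
  classical
  induction S using Finset.induction_on with
  | empty =>
    ext v a
    · exact congr($(d.conn.fun_zero) v)
    · exact congr($(d.conn.fun_zero) v)
  | insert i S hi ih =>
    simp only [Finset.sum_insert hi]
    rw [d.connS_add hU hx (hs i (Finset.mem_insert_self i S))
      (.sum fun j hj => hs j (Finset.mem_insert_of_mem hj)),
      ih fun j hj => hs j (Finset.mem_insert_of_mem hj)]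

lemma connS_smul (hU : IsOpen U) (hx : x ∈ U) {f : M → ℝ} (hf : ContMDiffOn I 𝓘(ℝ, ℝ) ∞ f U)
    (hs : SmoothPair I F s U) (v : TangentSpace I x) :
    d.connS (fun y => f y • s y) x v = f x • d.connS s x v + mvfderiv I f x v • s x := by
  ext a
  · exact d.conn.fun_smul hU hx hf (hs a).1 v
  · exact d.conn.fun_smul hU hx hf (hs a).2 v

lemma conn_matAct (hU : IsOpen U) (hx : x ∈ U) (hA : SmoothMat I A U)
    {s : Π x : M, Fin (2 ^ (n / 2)) → V x} (hs : ∀ b, SmoothSectionOn I F (fun y => s y b) U)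
    (v : TangentSpace I x) (a : Fin (2 ^ (n / 2))) :
    d.conn (fun y => matAct (A y) (s y) a) x v =
      matAct (dMat I A x v) (s x) a + matAct (A x) (fun b => d.conn (fun y => s y b) x v) a := by
  simp only [matAct]
  rw [d.conn.fun_sum hU hx fun b _ => (hs b).csmul (hA a b), sum_apply,
    ← Finset.sum_add_distrib]
  refine Finset.sum_congr rfl fun b _ => ?_
  rw [d.conn_csmul hU hx (hA a b) (hs b), add_comm]
  rfl

lemma connS_act (hU : IsOpen U) (hx : x ∈ U) (hA : SmoothMat I A U) (hs : SmoothPair I F s U)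
    (v : TangentSpace I x) :
    d.connS (fun y => act (A y) (s y)) x v =
      act (dMat I A x v) (s x) + act (A x) (d.connS s x v) := by
  ext a
  · exact d.conn_matAct hU hx hA (fun b => (hs b).1) v a
  · exact d.conn_matAct hU hx hA (fun b => (hs b).2) v a

lemma connS_cl (hU : IsOpen U) (hx : x ∈ U) (hA : SmoothMat I A U) (hs : SmoothPair I F s U)
    (v : TangentSpace I x) :
    d.connS (fun y => cl (A y) (s y)) x v =
      cl (dMat I A x v) (s x) + cl (A x) (d.connS s x v) := by
  ext a
  · exact d.conn_matAct hU hx hA (fun b => (hs b).2) v a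
  · exact d.conn_matAct hU hx hA (fun b => (hs b).1) v a

lemma connS_sigL (hU : IsOpen U) (hx : x ∈ U) (hs : SmoothPair I F s U) (v : TangentSpace I x) :
    d.connS (fun y => sigL (s y)) x v = sigL (d.connS s x v) := by
  ext a
  · have := d.conn_csmul hU hx (f := fun _ => -Complex.I) contMDiffOn_const (hs a).2 v
    rw [mvfderiv_const, zero_apply, zero_smul, add_zero] at this
    exact this
  · have := d.conn_csmul hU hx (f := fun _ => Complex.I) contMDiffOn_const (hs a).1 v
    rw [mvfderiv_const, zero_apply, zero_smul, add_zero] at this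
    exact this

lemma smoothPair_connS (hU : IsOpen U) {X : Π x : M, TangentSpace I x}
    (hX : SmoothSectionOn I (EuclideanSpace ℝ (Fin n)) X U) (hs : SmoothPair I F s U) :
    SmoothPair I F (fun y => d.connS s y (X y)) U :=
  fun a => ⟨d.smooth_conn U hU X _ hX (hs a).1, d.smooth_conn U hU X _ hX (hs a).2⟩

lemma smooth_herm (d : SpinInitialData I M F V κ) (hU : IsOpen U) (hs : SmoothPair I F s U)
    (ht : SmoothPair I F t U) :
    ContMDiffOn I 𝓘(ℝ, ℂ) ∞ (fun y => herm (s y) (t y)) U :=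
  (ContMDiffOn.finset_sum_fun fun a _ => d.smooth_inner U hU _ _ (hs a).1 (ht a).1).add
    (ContMDiffOn.finset_sum_fun fun a _ => d.smooth_inner U hU _ _ (hs a).2 (ht a).2)

lemma mvfderiv_herm (hU : IsOpen U) (hx : x ∈ U) (hs : SmoothPair I F s U)
    (ht : SmoothPair I F t U) (v : TangentSpace I x) :
    mvfderiv I (fun y => herm (s y) (t y)) x v =
      herm (d.connS s x v) (t x) + herm (s x) (d.connS t x v) := by
  have h1 := fun a => d.smooth_inner U hU _ _ (hs a).1 (ht a).1
  have h2 := fun a => d.smooth_inner U hU _ _ (hs a).2 (ht a).2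
  have e : mvfderiv I (fun y => herm (s y) (t y)) x v =
      ∑ a, mvfderiv I (fun y => inner ℂ ((s y).1 a) ((t y).1 a)) x v +
      ∑ a, mvfderiv I (fun y => inner ℂ ((s y).2 a) ((t y).2 a)) x v := by
    simp only [herm]
    rw [mvfderiv_fun_add
      ((ContMDiffOn.finset_sum_fun fun a _ => h1 a).mdifferentiableAt_of_isOpen hU hx)
      ((ContMDiffOn.finset_sum_fun fun a _ => h2 a).mdifferentiableAt_of_isOpen hU hx),
      mvfderiv_finset_sum fun a _ => (h1 a).mdifferentiableAt_of_isOpen hU hx,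
      mvfderiv_finset_sum fun a _ => (h2 a).mdifferentiableAt_of_isOpen hU hx]
    simp
  rw [e]
  simp only [fun a => d.metric_conn U hU _ _ (hs a).1 (ht a).1 x hx v,
    fun a => d.metric_conn U hU _ _ (hs a).2 (ht a).2 x hx v, Finset.sum_add_distrib, herm, connS,
    LinearMap.coe_mk, AddHom.coe_mk]
  ring

end SpinInitialData

namespace SpinInitialData

variable {n : ℕ} {H : Type*} [TopologicalSpace H]
  {I : ModelWithCorners ℝ (EuclideanSpace ℝ (Fin n)) H}
  {M : Type*} [TopologicalSpace M] [ChartedSpace H M] [IsManifold I ∞ M]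
  {F : Type*} [NormedAddCommGroup F] [NormedSpace ℂ F] [FiniteDimensional ℂ F]
  {V : M → Type*} [TopologicalSpace (TotalSpace F V)]
  [∀ x, NormedAddCommGroup (V x)] [∀ x, InnerProductSpace ℂ (V x)]
  [FiberBundle F V] [VectorBundle ℂ F V] [VectorBundle ℝ F V] [ContMDiffVectorBundle ∞ F V I]
  {κ : Type*} [RiemannianBundle (fun x : M => TangentSpace I x)]
  [IsContMDiffRiemannianBundle I ∞ (EuclideanSpace ℝ (Fin n)) (fun x : M => TangentSpace I x)]
  (d : SpinInitialData I M F V κ)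

section

/-! ### The Levi-Civita connection in orthonormal frames -/

variable {α β : κ} {x : M} {U : Set M} {X Y Z : Π x : M, TangentSpace I x}

lemma finrank_tangentSpace (x : M) : Module.finrank ℝ (TangentSpace I x) = n := by
  have : Module.finrank ℝ (EuclideanSpace ℝ (Fin n)) = n := by simp
  exact this

lemma finiteDimensional_tangentSpace (x : M) : FiniteDimensional ℝ (TangentSpace I x) :=
  inferInstanceAs (FiniteDimensional ℝ (EuclideanSpace ℝ (Fin n)))

lemma sum_inner_smul (hx : x ∈ d.spin.baseSet α) (v : TangentSpace I x) :
    ∑ i, (inner ℝ (d.spin.frame α i x) v : ℝ) • d.spin.frame α i x = v := by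
  have := finiteDimensional_tangentSpace (I := I) x
  have ho := d.spin.orthonormal_frame α x hx
  have hs : ⊤ ≤ Submodule.span ℝ (Set.range fun i => d.spin.frame α i x) := by
    rw [ho.linearIndependent.span_eq_top_of_card_eq_finrank' (by
      rw [finrank_tangentSpace]; simp)]
  have h := (OrthonormalBasis.mk ho hs).sum_repr' v
  simpa using h

lemma inner_frame (hx : x ∈ d.spin.baseSet α) (i j : Fin n) :
    (inner ℝ (d.spin.frame α i x) (d.spin.frame α j x) : ℝ) = if i = j then 1 else 0 :=
  orthonormal_iff_ite.1 (d.spin.orthonormal_frame α x hx) i j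

lemma eq_of_inner_frame (hx : x ∈ d.spin.baseSet α) {v w : TangentSpace I x}
    (h : ∀ i, (inner ℝ v (d.spin.frame α i x) : ℝ) = inner ℝ w (d.spin.frame α i x)) : v = w := by
  rw [← d.sum_inner_smul hx v, ← d.sum_inner_smul hx w]
  refine Finset.sum_congr rfl fun i _ => ?_
  rw [real_inner_comm, h, real_inner_comm]

/-- The matrix between two orthonormal bases is orthogonal, so a trace does not depend on the basis.
This allows the frame `e x`, which depends on the base point, to be replaced by one smooth frame on
a neighbourhood. -/
lemma sum_bilin_frame {W : Type*} [AddCommGroup W] [Module ℝ W] (hα : x ∈ d.spin.baseSet α)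
    (hβ : x ∈ d.spin.baseSet β) (B : TangentSpace I x →ₗ[ℝ] TangentSpace I x →ₗ[ℝ] W) :
    ∑ i, B (d.spin.frame α i x) (d.spin.frame α i x) =
      ∑ i, B (d.spin.frame β i x) (d.spin.frame β i x) := by
  have h1 : ∀ i, B (d.spin.frame β i x) (d.spin.frame β i x) =
      ∑ j, ∑ k, (inner ℝ (d.spin.frame α j x) (d.spin.frame β i x) *
        inner ℝ (d.spin.frame α k x) (d.spin.frame β i x) : ℝ) •
        B (d.spin.frame α j x) (d.spin.frame α k x) := by
    intro i
    conv_lhs => rw [← d.sum_inner_smul hα (d.spin.frame β i x)]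
    simp only [map_sum, map_smul, LinearMap.sum_apply, LinearMap.smul_apply, Finset.smul_sum,
      smul_smul]
    rw [Finset.sum_comm]
    refine Finset.sum_congr rfl fun j _ => Finset.sum_congr rfl fun k _ => ?_
    rw [mul_comm]
  rw [Finset.sum_congr rfl fun i _ => h1 i, Finset.sum_comm]
  refine Finset.sum_congr rfl fun j _ => ?_
  rw [Finset.sum_comm]
  simp only [← Finset.sum_smul]
  have h2 : ∀ k, ∑ i, (inner ℝ (d.spin.frame α j x) (d.spin.frame β i x) *
      inner ℝ (d.spin.frame α k x) (d.spin.frame β i x) : ℝ) = if j = k then 1 else 0 := by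
    intro k
    rw [← d.inner_frame hα j k]
    conv_rhs => rw [← d.sum_inner_smul hβ (d.spin.frame α k x)]
    rw [inner_sum]
    refine Finset.sum_congr rfl fun i _ => ?_
    rw [real_inner_smul_right, real_inner_comm (d.spin.frame α k x), mul_comm]
  simp [h2]

lemma smooth_inner_tangent (hX : SmoothSectionOn I (EuclideanSpace ℝ (Fin n)) X U)
    (hY : SmoothSectionOn I (EuclideanSpace ℝ (Fin n)) Y U) :
    ContMDiffOn I 𝓘(ℝ, ℝ) ∞ (fun y => (inner ℝ (X y) (Y y) : ℝ)) U :=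
  ContMDiffOn.inner_bundle (IM := I) hX hY

set_option synthInstance.maxHeartbeats 400000 in
lemma mvfderiv_inner (hU : IsOpen U) (hx : x ∈ U)
    (hX : SmoothSectionOn I (EuclideanSpace ℝ (Fin n)) X U)
    (hY : SmoothSectionOn I (EuclideanSpace ℝ (Fin n)) Y U) (v : TangentSpace I x) :
    mvfderiv I (fun y => (inner ℝ (X y) (Y y) : ℝ)) x v =
      inner ℝ (d.lc X x v) (Y x) + inner ℝ (X x) (d.lc Y x v) := by
  classical
  have := d.metric_lc.mvfderiv_inner_eq (Function.update (fun _ => 0) x v)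
    (hX.mdifferentiableAt hU hx) (hY.mdifferentiableAt hU hx)
  simpa using this

lemma mlieBracket_eq (hU : IsOpen U) (hx : x ∈ U)
    (hX : SmoothSectionOn I (EuclideanSpace ℝ (Fin n)) X U)
    (hY : SmoothSectionOn I (EuclideanSpace ℝ (Fin n)) Y U) :
    VectorField.mlieBracket I X Y x = d.lc Y x (X x) - d.lc X x (Y x) :=
  (d.lc.torsion_eq_zero_iff.1 d.torsion_lc (hX.mdifferentiableAt hU hx)
    (hY.mdifferentiableAt hU hx)).symm

lemma smooth_mlieBracket (hU : IsOpen U) (hX : SmoothSectionOn I (EuclideanSpace ℝ (Fin n)) X U)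
    (hY : SmoothSectionOn I (EuclideanSpace ℝ (Fin n)) Y U) :
    SmoothSectionOn I (EuclideanSpace ℝ (Fin n)) (VectorField.mlieBracket I X Y) U := by
  intro y hy
  have hX' := ContMDiffOn.contMDiffAt hX (hU.mem_nhds hy)
  have hY' := ContMDiffOn.contMDiffAt hY (hU.mem_nhds hy)
  have : IsManifold I (((⊤ : ℕ∞) : ℕ∞ω) + 1) M := ‹IsManifold I ∞ M›
  have : IsManifold I (minSmoothness ℝ 2) M := by
    simp only [minSmoothness_of_isRCLikeNormedField]
    infer_instance
  exact (ContMDiffAt.mlieBracket_vectorField (m := ⊤) (n := ⊤) hX' hY'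
    (by simp)).contMDiffWithinAt

lemma antisymm_frame (hx : x ∈ d.spin.baseSet α) (v : TangentSpace I x) (i j : Fin n) :
    (inner ℝ (d.lc (d.spin.frame α i) x v) (d.spin.frame α j x) : ℝ) =
      -inner ℝ (d.lc (d.spin.frame α j) x v) (d.spin.frame α i x) := by
  have h := d.mvfderiv_inner (d.spin.isOpen_baseSet α) hx (d.spin.smooth_frame α i)
    (d.spin.smooth_frame α j) v
  have e : mvfderiv I (fun y => (inner ℝ (d.spin.frame α i y) (d.spin.frame α j y) : ℝ)) x
      = mvfderiv I (fun _ : M => (if i = j then (1 : ℝ) else 0)) x :=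
    mvfderiv_congr (Filter.mem_of_superset ((d.spin.isOpen_baseSet α).mem_nhds hx)
      fun y hy => d.inner_frame hy i j)
  rw [e, mvfderiv_const, zero_apply, real_inner_comm _ (d.spin.frame α i x)] at h
  linarith

/-- The Koszul formula in an orthonormal frame: the inner products of the frame fields are constant,
so only brackets remain. Smoothness of the Levi-Civita connection is thereby a consequence of metric
compatibility and vanishing torsion. -/
lemma smooth_christoffel (i j k : Fin n) :
    ContMDiffOn I 𝓘(ℝ, ℝ) ∞ (fun y => (inner ℝ (d.lc (d.spin.frame α j) y (d.spin.frame α i y))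
      (d.spin.frame α k y) : ℝ)) (d.spin.baseSet α) := by
  have hs := d.spin.smooth_frame α
  have ho := d.spin.isOpen_baseSet α
  have hb : ∀ i j k, ContMDiffOn I 𝓘(ℝ, ℝ) ∞ (fun y => (inner ℝ
      (VectorField.mlieBracket I (d.spin.frame α i) (d.spin.frame α j) y)
      (d.spin.frame α k y) : ℝ)) (d.spin.baseSet α) := fun i j k =>
    smooth_inner_tangent (smooth_mlieBracket ho (hs i) (hs j)) (hs k)
  refine ((contMDiffOn_const (I' := 𝓘(ℝ, ℝ)) (c := (1 / 2 : ℝ))).smul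
    (((hb i j k).sub (hb j k i)).add (hb k i j))).congr fun y hy => ?_
  have hm := fun i j => d.mlieBracket_eq ho hy (hs i) (hs j)
  have ha := fun i j k => d.antisymm_frame hy (d.spin.frame α i y) j k
  simp only [Pi.smul_apply', smul_eq_mul, Pi.add_apply, hm,
    inner_sub_left]
  have h1 := ha i j k
  have h2 := ha j i k
  have h3 := ha k i j
  linarith

/-- The Levi-Civita connection maps smooth vector fields to smooth vector fields. -/
lemma smooth_lc (hU : IsOpen U) (hX : SmoothSectionOn I (EuclideanSpace ℝ (Fin n)) X U)
    (hY : SmoothSectionOn I (EuclideanSpace ℝ (Fin n)) Y U) :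
    SmoothSectionOn I (EuclideanSpace ℝ (Fin n)) (fun y => d.lc Y y (X y)) U := by
  refine .of_local fun x hx => ?_
  set α := d.spin.indexAt x
  have ho := d.spin.isOpen_baseSet α
  have hW : IsOpen (U ∩ d.spin.baseSet α) := hU.inter ho
  refine ⟨d.spin.baseSet α, ho, d.spin.mem_baseSet_at x, ?_⟩
  have hs := fun i => (d.spin.smooth_frame α i).mono (Set.inter_subset_right (s := U))
  have hX' := hX.mono (Set.inter_subset_left (t := d.spin.baseSet α))
  have hY' := hY.mono (Set.inter_subset_left (t := d.spin.baseSet α))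
  have hXi := fun i => smooth_inner_tangent (hs i) hX'
  have hYi := fun i => smooth_inner_tangent (hs i) hY'
  have hf : ∀ i j, SmoothSectionOn I (EuclideanSpace ℝ (Fin n))
      (fun y => d.lc (d.spin.frame α j) y (d.spin.frame α i y)) (U ∩ d.spin.baseSet α) := by
    intro i j
    refine (SmoothSectionOn.sum (S := Finset.univ) fun k _ => (hs k).smul
      ((d.smooth_christoffel i j k).mono Set.inter_subset_right)).congr fun y hy => ?_
    conv_lhs => rw [← d.sum_inner_smul hy.2 (d.lc (d.spin.frame α j) y (d.spin.frame α i y))]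
    exact Finset.sum_congr rfl fun k _ => by rw [real_inner_comm]
  have hj : ∀ j, SmoothSectionOn I (EuclideanSpace ℝ (Fin n))
      (fun y => d.lc (d.spin.frame α j) y (X y)) (U ∩ d.spin.baseSet α) := by
    intro j
    refine (SmoothSectionOn.sum (S := Finset.univ) fun i _ => (hf i j).smul (hXi i)).congr
      fun y hy => ?_
    conv_lhs => rw [← d.sum_inner_smul hy.2 (X y)]
    simp
  -- The derivative of a coefficient f along `X` is smooth because X(f) eⱼ = [X, f eⱼ] - f [X, eⱼ],
  -- and brackets of smooth fields are smooth.
  refine (SmoothSectionOn.sum (S := Finset.univ) fun j _ => ((hj j).smul (hYi j)).add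
    ((smooth_mlieBracket hW hX' ((hs j).smul (hYi j))).sub
      ((smooth_mlieBracket hW hX' (hs j)).smul (hYi j)))).congr fun y hy => ?_
  have e : d.lc Y y = d.lc (fun z => ∑ j, (inner ℝ (d.spin.frame α j z) (Y z) : ℝ) •
      d.spin.frame α j z) y :=
    d.lc.congr_on (fun z hz => (d.sum_inner_smul hz.2 (Y z)).symm) hW hy
      (.sum fun j _ => (hs j).smul (hYi j))
  rw [e, d.lc.fun_sum_smul hW hy (fun j _ => hYi j) fun j _ => hs j]
  refine Finset.sum_congr rfl fun j _ => ?_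
  have hb := VectorField.mlieBracket_smul_right (V := X)
    ((hYi j).mdifferentiableAt_of_isOpen hW hy) ((hs j).mdifferentiableAt hW hy)
  have hb' : VectorField.mlieBracket I X (fun z => (inner ℝ (d.spin.frame α j z) (Y z) : ℝ) •
      d.spin.frame α j z) y = _ := hb
  rw [hb']
  simp

/-! ### Curvature of the Levi-Civita connection -/

/-- Antisymmetry in the last pair comes from metric compatibility, and the cyclic identity from
vanishing torsion together with the Jacobi identity. -/
lemma isCurvatureArray_frame (hx : x ∈ d.spin.baseSet α) :
    IsCurvatureArray fun i j k l => (inner ℝ (curvatureOp d.lc (d.spin.frame α i)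
      (d.spin.frame α j) (d.spin.frame α k) x) (d.spin.frame α l x) : ℝ) where
  antisymm_left i j k l := by
    rw [← inner_neg_left]
    congr 1
    simp only [curvatureOp]
    rw [VectorField.mlieBracket_swap_apply, map_neg]
    abel
  antisymm_right i j k l := by
    have hs := d.spin.smooth_frame α
    have ho := d.spin.isOpen_baseSet α
    -- The relation g(∇_{eⱼ} eₖ, eₗ) = -g(∇_{eⱼ} eₗ, eₖ) is differentiated along eᵢ. When the result
    -- for (j, i) is subtracted, the products of first derivatives cancel.
    have h2 : ∀ i j : Fin n,
        (inner ℝ (d.lc (fun y => d.lc (d.spin.frame α k) y (d.spin.frame α j y)) x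
            (d.spin.frame α i x)) (d.spin.frame α l x) : ℝ)
          + inner ℝ (d.lc (d.spin.frame α k) x (d.spin.frame α j x))
            (d.lc (d.spin.frame α l) x (d.spin.frame α i x)) =
        -((inner ℝ (d.lc (fun y => d.lc (d.spin.frame α l) y (d.spin.frame α j y)) x
            (d.spin.frame α i x)) (d.spin.frame α k x) : ℝ)
          + inner ℝ (d.lc (d.spin.frame α l) x (d.spin.frame α j x))
            (d.lc (d.spin.frame α k) x (d.spin.frame α i x))) := by
      intro i j
      rw [← d.mvfderiv_inner ho hx (d.smooth_lc ho (hs j) (hs k)) (hs l),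
        ← d.mvfderiv_inner ho hx (d.smooth_lc ho (hs j) (hs l)) (hs k)]
      have e : mvfderiv I (fun y => (inner ℝ (d.lc (d.spin.frame α k) y (d.spin.frame α j y))
          (d.spin.frame α l y) : ℝ)) x
          = mvfderiv I (fun y => -(inner ℝ (d.lc (d.spin.frame α l) y (d.spin.frame α j y))
          (d.spin.frame α k y) : ℝ)) x :=
        mvfderiv_congr (Filter.mem_of_superset (ho.mem_nhds hx)
          fun y hy => d.antisymm_frame hy _ k l)
      rw [e, mvfderiv_fun_neg, neg_apply]
    have h3 := d.antisymm_frame hx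
      (VectorField.mlieBracket I (d.spin.frame α i) (d.spin.frame α j) x) k l
    have h4 := h2 i j
    have h5 := h2 j i
    simp only [curvatureOp, inner_sub_left]
    rw [real_inner_comm (d.lc (d.spin.frame α l) x (d.spin.frame α i x))] at h4
    rw [real_inner_comm (d.lc (d.spin.frame α l) x (d.spin.frame α j x))] at h5
    linarith
  bianchi i j k l := by
    have hs := d.spin.smooth_frame α
    have ho := d.spin.isOpen_baseSet α
    -- Vanishing torsion is applied to both brackets, so that the Jacobi identity becomes an
    -- identity between second covariant derivatives.
    have hb : ∀ i j k : Fin n,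
        VectorField.mlieBracket I (d.spin.frame α i)
          (VectorField.mlieBracket I (d.spin.frame α j) (d.spin.frame α k)) x =
        d.lc (fun y => d.lc (d.spin.frame α k) y (d.spin.frame α j y)) x (d.spin.frame α i x)
        - d.lc (fun y => d.lc (d.spin.frame α j) y (d.spin.frame α k y)) x (d.spin.frame α i x)
        - d.lc (d.spin.frame α i) x
          (VectorField.mlieBracket I (d.spin.frame α j) (d.spin.frame α k) x) := by
      intro i j k
      rw [d.mlieBracket_eq ho hx (hs i) (smooth_mlieBracket ho (hs j) (hs k))]
      congr 1
      rw [d.lc.congr_on (fun y hy => d.mlieBracket_eq ho hy (hs j) (hs k)) ho hx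
        ((d.smooth_lc ho (hs j) (hs k)).sub (d.smooth_lc ho (hs k) (hs j))),
        d.lc.fun_sub ho hx (d.smooth_lc ho (hs j) (hs k)) (d.smooth_lc ho (hs k) (hs j)),
        sub_apply]
    have hc := fun i => ((ContMDiffOn.contMDiffAt (hs i) (ho.mem_nhds hx)).of_le
      (m := minSmoothness ℝ 2) (by
        rw [minSmoothness_of_isRCLikeNormedField]
        exact WithTop.coe_le_coe.2 (le_top : (2 : ℕ∞) ≤ ⊤)))
    have : IsManifold I (minSmoothness ℝ 3) M := by
      simp only [minSmoothness_of_isRCLikeNormedField]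
      infer_instance
    have hj := VectorField.leibniz_identity_mlieBracket_apply (hc i) (hc j) (hc k)
    rw [VectorField.mlieBracket_swap_apply (V := VectorField.mlieBracket I _ _)] at hj
    have sw : VectorField.mlieBracket I (d.spin.frame α i) (d.spin.frame α k)
        = -VectorField.mlieBracket I (d.spin.frame α k) (d.spin.frame α i) :=
      VectorField.mlieBracket_swap
    have sw2 : VectorField.mlieBracket I (d.spin.frame α j)
        (VectorField.mlieBracket I (d.spin.frame α i) (d.spin.frame α k)) x
        = -VectorField.mlieBracket I (d.spin.frame α j)
          (VectorField.mlieBracket I (d.spin.frame α k) (d.spin.frame α i)) x := by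
      rw [sw]
      have := VectorField.mlieBracket_const_smul_right (c := (-1 : ℝ)) (V := d.spin.frame α j)
        ((smooth_mlieBracket ho (hs k) (hs i)).mdifferentiableAt ho hx)
      simpa using this
    rw [sw2, hb, hb, hb] at hj
    rw [← inner_add_left, ← inner_add_left]
    have : curvatureOp d.lc (d.spin.frame α i) (d.spin.frame α j) (d.spin.frame α k) x
        + curvatureOp d.lc (d.spin.frame α j) (d.spin.frame α k) (d.spin.frame α i) x
        + curvatureOp d.lc (d.spin.frame α k) (d.spin.frame α i) (d.spin.frame α j) x = 0 := by
      simp only [curvatureOp]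
      rw [← sub_eq_zero] at hj
      rw [← hj]
      abel
    rw [this, inner_zero_left]

/-! ### Divergence -/

lemma divX_eq_frame (hx : x ∈ d.spin.baseSet α) :
    d.divX X x = ∑ i, inner ℝ (d.lc X x (d.spin.frame α i x)) (d.spin.frame α i x) :=
  d.sum_bilin_frame (d.spin.mem_baseSet_at x) hx
    (LinearMap.mk₂ ℝ (fun v w => (inner ℝ (d.lc X x v) w : ℝ))
      (fun v v' w => by rw [map_add, inner_add_left])
      (fun r v w => by rw [map_smul, real_inner_smul_left, smul_eq_mul])
      (fun v w w' => by rw [inner_add_right])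
      (fun r v w => by rw [real_inner_smul_right, smul_eq_mul]))

lemma smooth_divX (hU : IsOpen U) (hX : SmoothSectionOn I (EuclideanSpace ℝ (Fin n)) X U) :
    ContMDiffOn I 𝓘(ℝ, ℝ) ∞ (d.divX X) U := by
  intro x hx
  set α := d.spin.indexAt x
  have ho := d.spin.isOpen_baseSet α
  have hs := fun i => (d.spin.smooth_frame α i).mono (Set.inter_subset_right (s := U))
  have hX' := hX.mono (Set.inter_subset_left (t := d.spin.baseSet α))
  have h : ContMDiffOn I 𝓘(ℝ, ℝ) ∞ (d.divX X) (U ∩ d.spin.baseSet α) :=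
    (ContMDiffOn.finset_sum_fun (S := Finset.univ) fun i _ =>
      smooth_inner_tangent (d.smooth_lc (hU.inter ho) (hs i) hX') (hs i)).congr
      fun y hy => d.divX_eq_frame hy.2
  exact (h x ⟨hx, d.spin.mem_baseSet_at x⟩).mono_of_mem_nhdsWithin
    (Filter.inter_mem self_mem_nhdsWithin (mem_nhdsWithin_of_mem_nhds
      (ho.mem_nhds (d.spin.mem_baseSet_at x))))

lemma divX_smul (hU : IsOpen U) (hx : x ∈ U) {f : M → ℝ} (hf : ContMDiffOn I 𝓘(ℝ, ℝ) ∞ f U)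
    (hX : SmoothSectionOn I (EuclideanSpace ℝ (Fin n)) X U) :
    d.divX (fun y => f y • X y) x = f x * d.divX X x + mvfderiv I f x (X x) := by
  simp only [divX, fun v => d.lc.fun_smul hU hx hf hX v, inner_add_left, real_inner_smul_left,
    Finset.sum_add_distrib, ← Finset.mul_sum]
  congr 1
  conv_rhs => rw [← d.sum_inner_smul (d.spin.mem_baseSet_at x) (X x)]
  simp only [map_sum, map_smul, smul_eq_mul, e]
  refine Finset.sum_congr rfl fun i _ => ?_
  rw [real_inner_comm, mul_comm]

lemma divX_sum (hU : IsOpen U) (hx : x ∈ U) {ι : Type*} {S : Finset ι}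
    {X : ι → Π x : M, TangentSpace I x}
    (hX : ∀ i ∈ S, SmoothSectionOn I (EuclideanSpace ℝ (Fin n)) (X i) U) :
    d.divX (fun y => ∑ i ∈ S, X i y) x = ∑ i ∈ S, d.divX (X i) x := by
  simp only [divX, d.lc.fun_sum hU hx hX, sum_apply, sum_inner]
  exact Finset.sum_comm

lemma divX_congr_nhds (h : ∀ᶠ y in nhds x, X y = Y y) (hU : IsOpen U) (hx : x ∈ U)
    (hY : SmoothSectionOn I (EuclideanSpace ℝ (Fin n)) Y U) : d.divX X x = d.divX Y x := by
  simp only [divX, d.lc.congr_nhds h hU hx hY]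

end

section

/-! ### The spinor connection in a trivialization -/

variable {α β δ : κ} {x : M} {U : Set M} {X : Π x : M, TangentSpace I x}
  {u : Π x : M, SFiber n V x}

/-- The transition matrices of the spinor bundle. -/
def trans (α β : κ) (y : M) : SMat n := d.spinor.rho (d.spin.lift α β y)

/-- The connection matrix `¼ ∑ g(∇_v eᵢ, eⱼ) γᵢ γⱼ` of the spinor connection in the trivialization
`α`. -/
def spinConn (α : κ) (x : M) (v : TangentSpace I x) : SMat n :=
  bivector d.spinor.gam fun i j => inner ℝ (d.lc (d.spin.frame α i) x v) (d.spin.frame α j x)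

lemma spinForm_eq (x : M) (v : TangentSpace I x) :
    d.spinForm x v = d.spinConn (d.spin.indexAt x) x v := by
  simp only [spinForm, spinConn, bivector, map_mul]
  rfl

lemma spinConn_add (v w : TangentSpace I x) :
    d.spinConn α x (v + w) = d.spinConn α x v + d.spinConn α x w := by
  simp only [spinConn, bivector, map_add, inner_add_left, add_smul, Finset.sum_add_distrib,
    smul_add]

lemma spinConn_smul (r : ℝ) (v : TangentSpace I x) :
    d.spinConn α x (r • v) = r • d.spinConn α x v := by
  simp only [spinConn, bivector, map_smul, real_inner_smul_left, mul_smul, ← Finset.smul_sum]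
  rw [smul_comm]

/-- Smoothness of the lifts is known after composition with real linear functionals, so every
complex entry is assembled from its real and imaginary parts. -/
lemma smooth_trans : SmoothMat I (d.trans α β) (d.spin.baseSet α ∩ d.spin.baseSet β) := by
  intro a b
  have hre := d.spin.smooth_lift α β (Complex.reLm ∘ₗ Matrix.entryLinearMap ℝ ℂ a b ∘ₗ
    d.spinor.rho.toLinearMap)
  have him := d.spin.smooth_lift α β (Complex.imLm ∘ₗ Matrix.entryLinearMap ℝ ℂ a b ∘ₗ
    d.spinor.rho.toLinearMap)
  refine (hre.complex_ofReal.add (contMDiffOn_complex_mul him.complex_ofReal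
    (contMDiffOn_const (c := Complex.I)))).congr fun y _ => ?_
  exact (Complex.re_add_im _).symm

lemma trans_mul_conjTranspose (hα : x ∈ d.spin.baseSet α) (hβ : x ∈ d.spin.baseSet β) :
    d.trans α β x * (d.trans α β x)ᴴ = 1 := by
  rw [trans, ← SpinorModule.rho_star, ← map_mul,
    spinGroup.mul_star_self_of_mem (d.spin.lift_mem α β x ⟨hα, hβ⟩), map_one]

lemma conjTranspose_mul_trans (hα : x ∈ d.spin.baseSet α) (hβ : x ∈ d.spin.baseSet β) :
    (d.trans α β x)ᴴ * d.trans α β x = 1 := by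
  rw [trans, ← SpinorModule.rho_star, ← map_mul,
    spinGroup.star_mul_self_of_mem (d.spin.lift_mem α β x ⟨hα, hβ⟩), map_one]

lemma trans_mul_trans (hα : x ∈ d.spin.baseSet α) (hβ : x ∈ d.spin.baseSet β)
    (hδ : x ∈ d.spin.baseSet δ) : d.trans α β x * d.trans β δ x = d.trans α δ x := by
  rw [trans, trans, ← map_mul, d.spin.lift_cocycle α β δ x ⟨⟨hα, hβ⟩, hδ⟩, trans]

/-- The cocycle identity makes this matrix idempotent, and it is invertible. -/
lemma trans_self (hα : x ∈ d.spin.baseSet α) : d.trans α α x = 1 := by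
  have h := d.trans_mul_trans hα hα hα
  have h2 := d.conjTranspose_mul_trans hα hα
  calc d.trans α α x = (d.trans α α x)ᴴ * (d.trans α α x * d.trans α α x) := by
        rw [← mul_assoc, h2, one_mul]
    _ = 1 := by rw [h, h2]

lemma trans_mem_evenSpan (hα : x ∈ d.spin.baseSet α) (hβ : x ∈ d.spin.baseSet β) :
    d.trans α β x ∈ evenSpan d.spinor.gam ∅ :=
  d.spinor.rho_mem_evenSpan (spinGroup.mem_even (d.spin.lift_mem α β x ⟨hα, hβ⟩))

lemma conjTranspose_trans_mem_evenSpan (hα : x ∈ d.spin.baseSet α) (hβ : x ∈ d.spin.baseSet β) :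
    (d.trans α β x)ᴴ ∈ evenSpan d.spinor.gam ∅ := by
  rw [trans, ← SpinorModule.rho_star]
  exact d.spinor.rho_mem_evenSpan
    (spinGroup.mem_even (spinGroup.star_mem (d.spin.lift_mem α β x ⟨hα, hβ⟩)))

lemma trans_mul_gam (hα : x ∈ d.spin.baseSet α) (hβ : x ∈ d.spin.baseSet β) (j : Fin n) :
    d.trans α β x * d.spinor.gam j = ∑ i, (inner ℝ (d.spin.frame α i x) (d.spin.frame β j x) : ℝ) •
      (d.spinor.gam i * d.trans α β x) := by
  have h := congrArg d.spinor.rho (d.spin.lift_conj α β x ⟨hα, hβ⟩ j)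
  simp only [map_mul, map_sum, map_smul, SpinorModule.rho_star] at h
  have h2 : d.trans α β x * d.spinor.gam j * (d.trans α β x)ᴴ =
    ∑ i, (inner ℝ (d.spin.frame α i x) (d.spin.frame β j x) : ℝ) • d.spinor.gam i := h
  calc d.trans α β x * d.spinor.gam j
      = d.trans α β x * d.spinor.gam j * (d.trans α β x)ᴴ * d.trans α β x := by
        rw [mul_assoc _ _ (d.trans α β x), d.conjTranspose_mul_trans hα hβ, mul_one]
    _ = _ := by rw [h2, Finset.sum_mul]; simp only [smul_mul_assoc]

/-- A subspace is cut out by the linear functionals that vanish on it, and the derivative of the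
zero function is zero. It is applied to the even elements. -/
lemma dMat_mem_submodule {A : M → SMat n} (hU : IsOpen U) (hx : x ∈ U) (hA : SmoothMat I A U)
    {S : Submodule ℝ (SMat n)} (hS : ∀ y ∈ U, A y ∈ S) (v : TangentSpace I x) :
    dMat I A x v ∈ S := by
  rw [← Subspace.forall_mem_dualAnnihilator_apply_eq_zero_iff]
  intro φ hφ
  rw [Submodule.mem_dualAnnihilator] at hφ
  let L : Fin (2 ^ (n / 2)) → Fin (2 ^ (n / 2)) → ℂ →L[ℝ] ℝ := fun a b =>
    LinearMap.toContinuousLinearMap (φ ∘ₗ Matrix.singleLinearMap ℝ a b)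
  have hL : ∀ B : SMat n, φ B = ∑ a, ∑ b, L a b (B a b) := by
    intro B
    conv_lhs => rw [Matrix.matrix_eq_sum_single B]
    simp only [map_sum]
    rfl
  have hd := fun a b => (hA a b).mdifferentiableAt_of_isOpen hU hx
  have hd2 : ∀ a b, MDifferentiableAt I 𝓘(ℝ, ℝ) (fun y => L a b (A y a b)) x := fun a b =>
    (((L a b).contMDiff (n := ∞)).comp_contMDiffOn (hA a b) :
      ContMDiffOn I 𝓘(ℝ, ℝ) ∞ (fun y => L a b (A y a b)) U).mdifferentiableAt_of_isOpen hU hx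
  have hd3 : ∀ a, MDifferentiableAt I 𝓘(ℝ, ℝ) (fun y => ∑ b, L a b (A y a b)) x := fun a =>
    (ContMDiffOn.finset_sum_fun (S := Finset.univ) fun b _ =>
      (((L a b).contMDiff (n := ∞)).comp_contMDiffOn (hA a b) :
        ContMDiffOn I 𝓘(ℝ, ℝ) ∞ (fun y => L a b (A y a b)) U)).mdifferentiableAt_of_isOpen hU hx
  have h : mvfderiv I (fun y => ∑ a, ∑ b, L a b (A y a b)) x v = φ (dMat I A x v) := by
    rw [mvfderiv_finset_sum fun a _ => hd3 a, sum_apply, hL]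
    refine Finset.sum_congr rfl fun a _ => ?_
    rw [mvfderiv_finset_sum fun b _ => hd2 a b, sum_apply]
    exact Finset.sum_congr rfl fun b _ => mvfderiv_clm_comp (L a b) (hd a b) v
  rw [← h, mvfderiv_congr (g := fun _ => (0 : ℝ)), mvfderiv_const, zero_apply]
  exact Filter.mem_of_superset (hU.mem_nhds hx) fun y hy => by
    simpa [← hL] using hφ _ (hS y hy)

/-- The transformation law of the connection matrices under a change of trivialization. -/
lemma dMat_trans (hα : x ∈ d.spin.baseSet α) (hβ : x ∈ d.spin.baseSet β) (v : TangentSpace I x) :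
    dMat I (d.trans α β) x v + d.spinConn α x v * d.trans α β x =
      d.trans α β x * d.spinConn β x v := by
  set G := d.trans α β x with hG
  set G' := dMat I (d.trans α β) x v with hG'
  set γ := d.spinor.gam with hγ
  set a : Fin n → Fin n → ℝ := fun i k => inner ℝ (d.spin.frame α i x) (d.spin.frame β k x) with ha
  set A : Fin n → Fin n → ℝ := fun i j =>
    inner ℝ (d.lc (d.spin.frame α i) x v) (d.spin.frame α j x) with hA
  set B : Fin n → Fin n → ℝ := fun i j =>
    inner ℝ (d.lc (d.spin.frame β i) x v) (d.spin.frame β j x) with hB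
  have hO : IsOpen (d.spin.baseSet α ∩ d.spin.baseSet β) :=
    (d.spin.isOpen_baseSet α).inter (d.spin.isOpen_baseSet β)
  have hx : x ∈ d.spin.baseSet α ∩ d.spin.baseSet β := ⟨hα, hβ⟩
  have hsm := d.smooth_trans (α := α) (β := β)
  have hfα := fun i => (d.spin.smooth_frame α i).mono
    (Set.inter_subset_left (t := d.spin.baseSet β))
  have hfβ := fun i => (d.spin.smooth_frame β i).mono
    (Set.inter_subset_right (s := d.spin.baseSet α))
  have hAs : ∀ i j, A i j = -A j i := fun i j => d.antisymm_frame hα v i j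
  have hBs : ∀ i j, B i j = -B j i := fun i j => d.antisymm_frame hβ v i j
  have hGG : Gᴴ * G = 1 := d.conjTranspose_mul_trans hα hβ
  have hGG2 : G * Gᴴ = 1 := d.trans_mul_conjTranspose hα hβ
  have hGγ : ∀ k, G * γ k = ∑ i, a i k • (γ i * G) := d.trans_mul_gam hα hβ
  -- The derivative of GᴴG = 1.
  have hskew : G'ᴴ * G + Gᴴ * G' = 0 := by
    have h1 := dMat_mul hO hx hsm.conjTranspose hsm v
    rw [dMat_conjTranspose hO hx hsm] at h1
    rw [← h1, dMat_congr (B := fun _ => 1), dMat_const]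
    exact Filter.mem_of_superset (hO.mem_nhds hx) fun y hy =>
      d.conjTranspose_mul_trans hy.1 hy.2
  -- The derivative of the rotation between the two frames, expressed by the two sets of connection
  -- coefficients.
  have hda : ∀ i k,
      mvfderiv I (fun y => (inner ℝ (d.spin.frame α i y) (d.spin.frame β k y) : ℝ)) x v
      = -∑ j, a j k * A j i + ∑ m, B k m * a i m := by
    intro i k
    rw [d.mvfderiv_inner hO hx (hfα i) (hfβ k) v]
    congr 1
    · conv_lhs => rw [← d.sum_inner_smul hα (d.spin.frame β k x)]
      rw [inner_sum, ← Finset.sum_neg_distrib]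
      refine Finset.sum_congr rfl fun j _ => ?_
      rw [real_inner_smul_right]
      change a j k * A i j = _
      rw [hAs i j]; ring
    · conv_lhs => rw [← d.sum_inner_smul hβ (d.lc (d.spin.frame β k) x v)]
      rw [inner_sum]
      refine Finset.sum_congr rfl fun m _ => ?_
      rw [real_inner_smul_right, real_inner_comm]
  -- The derivative of the relation `hGγ`, by which G conjugates the generators into their rotated
  -- combinations.
  have hd : ∀ k, G' * γ k = ∑ i, ((-∑ j, a j k * A j i + ∑ m, B k m * a i m) • (γ i * G)
      + a i k • (γ i * G')) := by
    intro k
    have e1 := dMat_mul hO hx hsm (SmoothMat.const (γ k)) v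
    rw [dMat_const, mul_zero, add_zero] at e1
    have ha' : ∀ i, ContMDiffOn I 𝓘(ℝ, ℝ) ∞
        (fun y => (inner ℝ (d.spin.frame α i y) (d.spin.frame β k y) : ℝ))
        (d.spin.baseSet α ∩ d.spin.baseSet β) := fun i => smooth_inner_tangent (hfα i) (hfβ k)
    have hsum : SmoothMat I (fun y => ∑ i, (inner ℝ (d.spin.frame α i y) (d.spin.frame β k y) : ℝ)
        • γ i) (d.spin.baseSet α ∩ d.spin.baseSet β) :=
      .sum fun i _ => (SmoothMat.const (γ i)).smul (ha' i)
    have e2 := dMat_mul hO hx hsum hsm v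
    rw [dMat_sum_smul hO hx (fun i _ => ha' i)] at e2
    have e3 : dMat I (fun y => d.trans α β y * γ k) x v =
        dMat I (fun y => (∑ i, (inner ℝ (d.spin.frame α i y) (d.spin.frame β k y) : ℝ)
          • γ i) * d.trans α β y) x v :=
      dMat_congr (Filter.mem_of_superset (hO.mem_nhds hx) fun y hy => by
        simp only [Set.mem_ofPred_eq]
        rw [d.trans_mul_gam hy.1 hy.2, Finset.sum_mul]
        simp only [smul_mul_assoc]
        rfl) v
    rw [e1, e2] at e3
    rw [hG', e3, Finset.sum_mul, Finset.sum_mul, ← Finset.sum_add_distrib]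
    refine Finset.sum_congr rfl fun i _ => ?_
    rw [hda, smul_mul_assoc, smul_mul_assoc]
  -- Θ is the connection matrix of α transformed by G; the claim is that it is the connection matrix
  -- of β. By `eq_bivector` it suffices that Θ is even, skew-Hermitian and has the right commutators
  -- with the generators.
  set Θ := Gᴴ * (G' + d.spinConn α x v * G) with hΘ
  have hGΘ : G * Θ = G' + d.spinConn α x v * G := by rw [hΘ, ← mul_assoc, hGG2, one_mul]
  have key : Θ = bivector γ B := by
    refine d.spinor.eq_bivector hBs ?_ ?_ ?_
    · refine mul_mem_evenSpan (d.conjTranspose_trans_mem_evenSpan hα hβ) (Submodule.add_mem _ ?_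
        (mul_mem_evenSpan (bivector_mem_evenSpan _) (d.trans_mem_evenSpan hα hβ)))
      exact dMat_mem_submodule hO hx hsm (fun y hy => d.trans_mem_evenSpan hy.1 hy.2) v
    · have e := d.spinor.bivector_conjTranspose hAs
      rw [hΘ, mul_add, Matrix.conjTranspose_add, Matrix.conjTranspose_mul, Matrix.conjTranspose_mul,
        Matrix.conjTranspose_mul, Matrix.conjTranspose_conjTranspose]
      have e' : (d.spinConn α x v)ᴴ = -d.spinConn α x v := e
      rw [e', eq_neg_of_add_eq_zero_left hskew]
      simp only [mul_neg, neg_mul, mul_assoc]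
      abel
    · intro k
      -- After multiplication by the invertible G the commutator can be computed from `hd`: the
      -- coefficients of α cancel against those in the derivative of the rotation, and those of β
      -- remain.
      have h1 : G * (Θ * γ k) = G * (γ k * Θ + ∑ j, B k j • γ j) := by
        rw [← mul_assoc, hGΘ, add_mul, hd, mul_assoc, hGγ, Finset.mul_sum, mul_add, ← mul_assoc,
          hGγ, Finset.sum_mul, Finset.mul_sum]
        have e1 : ∀ i, d.spinConn α x v * (a i k • (γ i * G)) =
            a i k • (γ i * (d.spinConn α x v * G)) + ∑ j, (a i k * A i j) • (γ j * G) := by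
          intro i
          rw [mul_smul_comm, ← mul_assoc]
          have := d.spinor.cliffRel_gam.bivector_comm hAs i
          rw [spinConn, this, add_mul, smul_add, mul_assoc, Finset.sum_mul, Finset.smul_sum]
          simp only [smul_mul_assoc, smul_smul]
          rfl
        have e2 : ∀ i, a i k • (γ i * G) * Θ =
            a i k • (γ i * G') + a i k • (γ i * (d.spinConn α x v * G)) := by
          intro i
          rw [smul_mul_assoc, mul_assoc, hGΘ, mul_add, smul_add]
        have e3 : ∀ j, G * (B k j • γ j) = ∑ i, (B k j * a i j) • (γ i * G) := by
          intro j
          rw [mul_smul_comm, hGγ, Finset.smul_sum]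
          simp only [smul_smul]
        simp only [e1, e2, e3, Finset.sum_add_distrib, add_smul, neg_smul, Finset.sum_smul,
          Finset.sum_neg_distrib]
        rw [Finset.sum_comm (f := fun i j => (a j k * A j i) • (γ i * G)),
          Finset.sum_comm (f := fun i m => (B k m * a i m) • (γ i * G))]
        abel
      have h2 := congrArg (fun z => Gᴴ * z) h1
      simpa only [← mul_assoc, hGG, one_mul] using h2
  rw [← hGΘ, key]
  rfl

/-! ### Expressions in a trivialization -/

/-- The components in the trivialization `α` of a point in the fibre over `x`. -/
def rep (α : κ) (x : M) : SFiber n V x →ₗ[ℝ] SFiber n V x := act (d.trans α (d.spin.indexAt x) x)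

lemma localRep_eq (u : Π x : M, SFiber n V x) (α : κ) (y : M) :
    d.localRep u α y = d.rep α y (u y) := rfl

lemma rep_indexAt (w : SFiber n V x) : d.rep (d.spin.indexAt x) x w = w := by
  rw [rep, d.trans_self (d.spin.mem_baseSet_at x), act_one]

lemma rep_trans (hα : x ∈ d.spin.baseSet α) (hβ : x ∈ d.spin.baseSet β) (w : SFiber n V x) :
    d.rep α x w = act (d.trans α β x) (d.rep β x w) := by
  rw [rep, rep, ← act_mul, d.trans_mul_trans hα hβ (d.spin.mem_baseSet_at x)]

lemma herm_rep (hα : x ∈ d.spin.baseSet α) (w z : SFiber n V x) :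
    herm (d.rep α x w) (d.rep α x z) = herm w z := by
  rw [rep, herm_act, ← act_mul, d.conjTranspose_mul_trans hα (d.spin.mem_baseSet_at x), act_one]

lemma rep_sigL (w : SFiber n V x) : d.rep α x (sigL w) = sigL (d.rep α x w) := by
  rw [rep, sigL_act]

lemma rep_injective (hα : x ∈ d.spin.baseSet α) : Function.Injective (d.rep (V := V) α x) := by
  intro w z h
  have h2 := congrArg (act (d.trans α (d.spin.indexAt x) x)ᴴ) h
  simpa only [rep, ← act_mul, d.conjTranspose_mul_trans hα (d.spin.mem_baseSet_at x), act_one]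
    using h2

/-- The matrix `∑ w(eᵢ) γᵢ` of Clifford multiplication by a covector in the trivialization `α`. -/
def gamForm (α : κ) {x : M} (w : TangentSpace I x →ₗ[ℝ] ℝ) : SMat n :=
  ∑ i, w (d.spin.frame α i x) • d.spinor.gam i

lemma c_eq (w : TangentSpace I x →ₗ[ℝ] ℝ) (z : SFiber n V x) :
    d.c w z = cl (d.gamForm (d.spin.indexAt x) w) z := by
  rw [c, SpinorModule.rho_iota]
  rfl

/-- The spin lift conjugates the generators by the rotation between the frames, which compensates
the change of the components of `w`. Hence Clifford multiplication does not depend on the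
trivialization. -/
lemma trans_mul_gamForm (hα : x ∈ d.spin.baseSet α) (hβ : x ∈ d.spin.baseSet β)
    (w : TangentSpace I x →ₗ[ℝ] ℝ) :
    d.trans α β x * d.gamForm β w = d.gamForm α w * d.trans α β x := by
  simp only [gamForm, Finset.mul_sum, Finset.sum_mul, mul_smul_comm, smul_mul_assoc,
    d.trans_mul_gam hα hβ, Finset.smul_sum, smul_smul]
  rw [Finset.sum_comm]
  refine Finset.sum_congr rfl fun i _ => ?_
  rw [← Finset.sum_smul]
  congr 1
  conv_rhs => rw [← d.sum_inner_smul hβ (d.spin.frame α i x)]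
  simp only [map_sum, map_smul, smul_eq_mul]
  refine Finset.sum_congr rfl fun j _ => ?_
  rw [real_inner_comm, mul_comm]

lemma rep_c (hα : x ∈ d.spin.baseSet α) (w : TangentSpace I x →ₗ[ℝ] ℝ) (z : SFiber n V x) :
    d.rep α x (d.c w z) = cl (d.gamForm α w) (d.rep α x z) := by
  rw [c_eq, rep, act_cl, d.trans_mul_gamForm hα (d.spin.mem_baseSet_at x), cl_act]

/-- The connection `∇` of `S` in the trivialization `α`. -/
def nab (α : κ) (s : Π x : M, SFiber n V x) (x : M) : TangentSpace I x →ₗ[ℝ] SFiber n V x where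
  toFun v := d.connS s x v + act (d.spinConn α x v) (s x)
  map_add' v w := by
    simp only [map_add, spinConn_add, LinearMap.add_apply]
    abel
  map_smul' r v := by
    simp only [map_smul, spinConn_smul, LinearMap.smul_apply, RingHom.id_apply, smul_add]

lemma nab_apply (s : Π x : M, SFiber n V x) (v : TangentSpace I x) :
    d.nab α s x v = d.connS s x v + act (d.spinConn α x v) (s x) := rfl

lemma nabla_eq (u : Π x : M, SFiber n V x) (x : M) :
    d.nabla u x = d.nab (d.spin.indexAt x) (d.localRep u (d.spin.indexAt x)) x := by
  ext v : 1
  rw [nab_apply, localRep_eq, rep_indexAt, ← spinForm_eq]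
  rfl

lemma SmoothOn.localRep (hu : d.SmoothOn u U) (α : κ) :
    SmoothPair I F (d.localRep u α) (d.spin.baseSet α ∩ U) := hu α

/-- The definition of `nabla` uses a different trivialization at each point. The transformation law
`dMat_trans` shows that in any fixed trivialization it is given by one formula, so that it can be
differentiated again. -/
lemma rep_nabla (hU : IsOpen U) (hx : x ∈ U) (hu : d.SmoothOn u U) (hα : x ∈ d.spin.baseSet α)
    (v : TangentSpace I x) :
    d.rep α x (d.nabla u x v) = d.nab α (d.localRep u α) x v := by
  set β := d.spin.indexAt x with hβdef
  have hβ : x ∈ d.spin.baseSet β := d.spin.mem_baseSet_at x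
  set W := d.spin.baseSet α ∩ d.spin.baseSet β ∩ U
  have hW : IsOpen W :=
    ((d.spin.isOpen_baseSet α).inter (d.spin.isOpen_baseSet β)).inter hU
  have hxW : x ∈ W := ⟨⟨hα, hβ⟩, hx⟩
  have hsm : SmoothMat I (d.trans α β) W := d.smooth_trans.mono Set.inter_subset_left
  have hs : SmoothPair I F (d.localRep u β) W := SmoothPair.mono (hu β)
    fun y hy => ⟨hy.1.2, hy.2⟩
  have e : d.connS (d.localRep u α) x = d.connS (fun y => act (d.trans α β y)
      (d.localRep u β y)) x :=
    d.connS_congr_nhds (Filter.mem_of_superset (hW.mem_nhds hxW)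
      fun y hy => d.rep_trans hy.1.1 hy.1.2 (u y)) hW hxW (hs.act hsm)
  rw [nab_apply, e, d.connS_act hW hxW hsm hs, localRep_eq, localRep_eq, d.rep_trans hα hβ (u x),
    rep_indexAt, nabla_eq, nab_apply, localRep_eq, rep_indexAt, rep, map_add, ← act_mul, ← act_mul,
    ← d.dMat_trans hα hβ, map_add, LinearMap.add_apply]
  abel

end

section

/-! ### Clifford multiplication by tangent vectors -/

variable {α β : κ} {x : M} {U U' : Set M} {X Y : Π x : M, TangentSpace I x}
  {u v : Π x : M, SFiber n V x}

/-- Clifford multiplication by a tangent vector, identified with a covector by the metric. -/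
def cv {x : M} : TangentSpace I x →ₗ[ℝ] SFiber n V x →ₗ[ℝ] SFiber n V x :=
  LinearMap.mk₂ ℝ (fun v z => d.c (innerSL ℝ v : TangentSpace I x →L[ℝ] ℝ) z)
    (fun v w z => by rw [map_add, ContinuousLinearMap.toLinearMap_add, c_add_left])
    (fun r v z => by rw [map_smul, ContinuousLinearMap.toLinearMap_smul, c_smul_left])
    (fun v z z' => by simp only [c_eq, map_add])
    (fun r v z => by simp only [c_eq, map_smul])

lemma c_coframe (x : M) (i : Fin n) (z : SFiber n V x) :
    d.c (d.coframe x i) z = d.cv (d.e x i x) z := rfl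

lemma rep_cv (hα : x ∈ d.spin.baseSet α) (v : TangentSpace I x) (z : SFiber n V x) :
    d.rep α x (d.cv v z) =
      cl (∑ i, (inner ℝ (d.spin.frame α i x) v : ℝ) • d.spinor.gam i) (d.rep α x z) := by
  have h := d.rep_c hα (innerSL ℝ v : TangentSpace I x →L[ℝ] ℝ) z
  refine h.trans ?_
  simp only [gamForm]
  congr 2
  refine Finset.sum_congr rfl fun i _ => ?_
  congr 1
  exact real_inner_comm (d.spin.frame α i x) v

lemma rep_cv_frame (hα : x ∈ d.spin.baseSet α) (i : Fin n) (z : SFiber n V x) :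
    d.rep α x (d.cv (d.spin.frame α i x) z) = cl (d.spinor.gam i) (d.rep α x z) := by
  rw [rep_cv _ hα]
  simp only [d.inner_frame hα, ite_smul, one_smul, zero_smul, Finset.sum_ite_eq', Finset.mem_univ,
    if_true]

lemma cv_e (i : Fin n) (z : SFiber n V x) :
    d.cv (d.e x i x) z = cl (d.spinor.gam i) z := by
  have h := d.rep_cv_frame (d.spin.mem_baseSet_at x) i z
  rwa [rep_indexAt, rep_indexAt] at h

lemma c_eq_sum (hα : x ∈ d.spin.baseSet α) (w : TangentSpace I x →ₗ[ℝ] ℝ) (z : SFiber n V x) :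
    d.c w z = ∑ i, w (d.spin.frame α i x) • d.cv (d.spin.frame α i x) z := by
  apply d.rep_injective hα
  rw [d.rep_c hα, gamForm]
  simp only [map_sum, map_smul, d.rep_cv_frame hα, LinearMap.sum_apply, LinearMap.smul_apply]

lemma cv_swap (i j : Fin n) (z : SFiber n V x) :
    d.cv (d.e x i x) (d.cv (d.e x j x) z) =
      (if i = j then (-2 : ℝ) else 0) • z - d.cv (d.e x j x) (d.cv (d.e x i x) z) := by
  rw [cv_e, cv_e, cv_e, cv_e, cl_cl, cl_cl, d.spinor.cliffRel_gam.swap i j, map_sub, map_smul,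
    LinearMap.sub_apply, LinearMap.smul_apply, act_one]

lemma sigL_cv (v : TangentSpace I x) (z : SFiber n V x) :
    sigL (d.cv v z) = -d.cv v (sigL z) := by
  apply d.rep_injective (d.spin.mem_baseSet_at x)
  rw [map_neg, rep_sigL, rep_cv _ (d.spin.mem_baseSet_at x), rep_cv _ (d.spin.mem_baseSet_at x),
    sigL_cl, rep_sigL]

lemma sigL_c (w : TangentSpace I x →ₗ[ℝ] ℝ) (z : SFiber n V x) :
    sigL (d.c w z) = -d.c w (sigL z) := by
  rw [c_eq, c_eq, sigL_cl]

lemma herm_cv (v : TangentSpace I x) (z w : SFiber n V x) :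
    herm (d.cv v z) w = -herm z (d.cv v w) := by
  have h := d.spin.mem_baseSet_at x
  rw [← d.herm_rep h, rep_cv _ h, herm_cl, ← d.herm_rep h z, rep_cv _ h, Matrix.conjTranspose_sum]
  simp only [Matrix.conjTranspose_smul, SpinorModule.gam_conjTranspose, star_trivial, smul_neg,
    Finset.sum_neg_distrib, map_neg, LinearMap.neg_apply, herm_eq_hermL]

lemma herm_c (w : TangentSpace I x →ₗ[ℝ] ℝ) (z z' : SFiber n V x) :
    herm (d.c w z) z' = -herm z (d.c w z') := by
  rw [d.c_eq_sum (d.spin.mem_baseSet_at x), d.c_eq_sum (d.spin.mem_baseSet_at x)]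
  simp only [herm_eq_hermL, map_sum, map_smul, LinearMap.sum_apply, LinearMap.smul_apply]
  simp only [← herm_eq_hermL, d.herm_cv, smul_neg, Finset.sum_neg_distrib]

/-- Clifford multiplication is skew-Hermitian, σ is Hermitian, and they anticommute, so the signs
cancel. This is why the zeroth order term of ∇̃ does not change sign under the adjoint. -/
lemma herm_c_sigL (w : TangentSpace I x →ₗ[ℝ] ℝ) (z z' : SFiber n V x) :
    herm (d.c w (sigL z)) z' = herm z (d.c w (sigL z')) := by
  rw [herm_c, herm_sigL, sigL_c]
  simp only [herm_eq_hermL, map_neg, neg_neg]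

/-! ### Smooth sections of `S` -/

namespace SmoothOn

variable {d}

lemma mono (hu : d.SmoothOn u U) (h : U' ⊆ U) : d.SmoothOn u U' :=
  fun α => SmoothPair.mono (hu α) (Set.inter_subset_inter_right _ h)

lemma congr (hu : d.SmoothOn u U) (h : ∀ y ∈ U, v y = u y) : d.SmoothOn v U :=
  fun α => SmoothPair.congr (hu α) fun y hy => by rw [localRep_eq, localRep_eq, h y hy.2]

lemma of_local (h : ∀ y ∈ U, ∃ W, IsOpen W ∧ y ∈ W ∧ d.SmoothOn u (U ∩ W)) : d.SmoothOn u U :=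
  fun α => SmoothPair.of_local fun y hy => by
    obtain ⟨W, hW, hyW, hs⟩ := h y hy.2
    exact ⟨W, hW, hyW, by rw [Set.inter_assoc]; exact hs α⟩

lemma zero : d.SmoothOn (fun x => (0 : SFiber n V x)) U :=
  fun α => SmoothPair.zero.congr fun y _ => by rw [localRep_eq, map_zero]

lemma add (hu : d.SmoothOn u U) (hv : d.SmoothOn v U) : d.SmoothOn (fun y => u y + v y) U :=
  fun α => (SmoothPair.add (hu α) (hv α)).congr fun _ _ => map_add (d.rep α _) _ _

lemma smul {f : M → ℝ} (hf : ContMDiffOn I 𝓘(ℝ, ℝ) ∞ f U) (hu : d.SmoothOn u U) :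
    d.SmoothOn (fun y => f y • u y) U :=
  fun α => (SmoothPair.smul (hf.mono Set.inter_subset_right) (hu α)).congr
    fun _ _ => map_smul (d.rep α _) _ _

lemma const_smul (r : ℝ) (hu : d.SmoothOn u U) : d.SmoothOn (fun y => r • u y) U :=
  hu.smul (f := fun _ => r) contMDiffOn_const

lemma neg (hu : d.SmoothOn u U) : d.SmoothOn (fun y => -u y) U :=
  (hu.const_smul (-1)).congr fun y _ => by rw [neg_smul, one_smul]

lemma sub (hu : d.SmoothOn u U) (hv : d.SmoothOn v U) : d.SmoothOn (fun y => u y - v y) U :=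
  (hu.add hv.neg).congr fun _ _ => sub_eq_add_neg _ _

lemma sum {ι : Type*} {S : Finset ι} {u : ι → Π x : M, SFiber n V x}
    (hu : ∀ i ∈ S, d.SmoothOn (u i) U) : d.SmoothOn (fun y => ∑ i ∈ S, u i y) U :=
  fun α => (SmoothPair.sum fun i hi => hu i hi α).congr fun _ _ => map_sum (d.rep α _) _ _

lemma sigL (hu : d.SmoothOn u U) : d.SmoothOn (fun y => _root_.sigL (u y)) U :=
  fun α => (SmoothPair.sigL (hu α)).congr fun _ _ => d.rep_sigL _

lemma cv (hX : SmoothSectionOn I (EuclideanSpace ℝ (Fin n)) X U) (hu : d.SmoothOn u U) :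
    d.SmoothOn (fun y => d.cv (X y) (u y)) U :=
  fun α => (SmoothPair.cl (SmoothMat.sum (S := Finset.univ) fun i _ =>
    (SmoothMat.const (d.spinor.gam i)).smul (smooth_inner_tangent
      ((d.spin.smooth_frame α i).mono Set.inter_subset_left) (hX.mono Set.inter_subset_right)))
    (hu α)).congr fun _ hy => d.rep_cv hy.1 _ _

end SmoothOn

lemma smooth_k_apply (hX : SmoothSectionOn I (EuclideanSpace ℝ (Fin n)) X U)
    (hY : SmoothSectionOn I (EuclideanSpace ℝ (Fin n)) Y U) :
    ContMDiffOn I 𝓘(ℝ, ℝ) ∞ (fun y => d.k y (X y) (Y y)) U := by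
  intro x hx
  have h : ContMDiffWithinAt I (I.prod 𝓘(ℝ, ℝ)) ∞
      (fun m => TotalSpace.mk' ℝ (E := Bundle.Trivial M ℝ) m (d.k m (X m) (Y m))) U x := by
    apply ContMDiffWithinAt.clm_bundle_apply₂ (F₁ := EuclideanSpace ℝ (Fin n))
      (F₂ := EuclideanSpace ℝ (Fin n)) (b := fun m : M => m)
    · exact d.smooth_k.contMDiffAt.contMDiffWithinAt
    · exact hX x hx
    · exact hY x hx
  simp only [contMDiffWithinAt_totalSpace] at h
  exact h.2

lemma smooth_c_kForm (hX : SmoothSectionOn I (EuclideanSpace ℝ (Fin n)) X U)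
    (hu : d.SmoothOn u U) : d.SmoothOn (fun y => d.c (d.kForm (X y)) (u y)) U := by
  refine SmoothOn.of_local fun x hx => ?_
  set α := d.spin.indexAt x
  refine ⟨d.spin.baseSet α, d.spin.isOpen_baseSet α, d.spin.mem_baseSet_at x, ?_⟩
  have hs := fun i => (d.spin.smooth_frame α i).mono (Set.inter_subset_right (s := U))
  have hX' := hX.mono (Set.inter_subset_left (t := d.spin.baseSet α))
  have hu' := hu.mono (Set.inter_subset_left (t := d.spin.baseSet α))
  exact (SmoothOn.sum (S := Finset.univ) fun i _ => (hu'.cv (hs i)).smul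
    (d.smooth_k_apply hX' (hs i))).congr fun y hy => d.c_eq_sum hy.2 _ _

lemma smoothOn_nabla (hU : IsOpen U) (hX : SmoothSectionOn I (EuclideanSpace ℝ (Fin n)) X U)
    (hu : d.SmoothOn u U) : d.SmoothOn (fun y => d.nabla u y (X y)) U := by
  intro α
  have hW : IsOpen (d.spin.baseSet α ∩ U) := (d.spin.isOpen_baseSet α).inter hU
  have hX' := hX.mono (Set.inter_subset_right (s := d.spin.baseSet α))
  have hs := fun i => (d.spin.smooth_frame α i).mono (Set.inter_subset_left (t := U))
  have hA : SmoothMat I (fun y => d.spinConn α y (X y)) (d.spin.baseSet α ∩ U) :=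
    SmoothMat.smul (f := fun _ => (1 / 4 : ℝ)) contMDiffOn_const <|
      .sum (S := Finset.univ) fun i _ => .sum (S := Finset.univ) fun j _ =>
        (SmoothMat.const _).smul (smooth_inner_tangent (d.smooth_lc hW hX' (hs i)) (hs j))
  exact ((d.smoothPair_connS hW hX' (hu.localRep d α)).add ((hu.localRep d α).act hA)).congr
    fun y hy => d.rep_nabla hU hy.2 hu hy.1 _

lemma contMDiffOn_herm (hU : IsOpen U) (hu : d.SmoothOn u U) (hv : d.SmoothOn v U) :
    ContMDiffOn I 𝓘(ℝ, ℂ) ∞ (fun y => herm (u y) (v y)) U := by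
  intro x hx
  set α := d.spin.indexAt x
  have ho := d.spin.isOpen_baseSet α
  have h : ContMDiffOn I 𝓘(ℝ, ℂ) ∞ (fun y => herm (u y) (v y)) (d.spin.baseSet α ∩ U) :=
    (smooth_herm d (ho.inter hU) (hu.localRep d α) (hv.localRep d α)).congr
      fun y hy => (d.herm_rep hy.1 _ _).symm
  exact (h x ⟨d.spin.mem_baseSet_at x, hx⟩).mono_of_mem_nhdsWithin
    (Filter.inter_mem (mem_nhdsWithin_of_mem_nhds (ho.mem_nhds (d.spin.mem_baseSet_at x)))
      self_mem_nhdsWithin)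

/-! ### Rules for the connection of `S` -/

lemma nabla_congr_nhds (h : ∀ᶠ y in nhds x, u y = v y) (hU : IsOpen U) (hx : x ∈ U)
    (hv : d.SmoothOn v U) : d.nabla u x = d.nabla v x := by
  ext1 w
  rw [nabla_eq, nabla_eq, nab_apply, nab_apply, localRep_eq, localRep_eq, h.self_of_nhds,
    d.connS_congr_nhds (t := d.localRep v (d.spin.indexAt x))
      (h.mono fun y hy => by rw [localRep_eq, localRep_eq, hy])
      ((d.spin.isOpen_baseSet _).inter hU) ⟨d.spin.mem_baseSet_at x, hx⟩ (hv.localRep d _)]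

lemma nabla_congr_on (h : ∀ y ∈ U, u y = v y) (hU : IsOpen U) (hx : x ∈ U)
    (hv : d.SmoothOn v U) : d.nabla u x = d.nabla v x :=
  d.nabla_congr_nhds (Filter.mem_of_superset (hU.mem_nhds hx) h) hU hx hv

lemma nabla_sum (hU : IsOpen U) (hx : x ∈ U) {ι : Type*} {S : Finset ι}
    {u : ι → Π x : M, SFiber n V x} (hu : ∀ i ∈ S, d.SmoothOn (u i) U) (w : TangentSpace I x) :
    d.nabla (fun y => ∑ i ∈ S, u i y) x w = ∑ i ∈ S, d.nabla (u i) x w := by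
  have e : d.localRep (fun y => ∑ i ∈ S, u i y) (d.spin.indexAt x) =
      fun y => ∑ i ∈ S, d.localRep (u i) (d.spin.indexAt x) y :=
    funext fun y => map_sum (d.rep _ y) _ _
  simp only [nabla_eq, nab_apply, e]
  rw [d.connS_sum ((d.spin.isOpen_baseSet _).inter hU) ⟨d.spin.mem_baseSet_at x, hx⟩
    fun i hi => (hu i hi).localRep d _, map_sum, LinearMap.sum_apply, Finset.sum_add_distrib]

lemma nabla_add (hU : IsOpen U) (hx : x ∈ U) (hu : d.SmoothOn u U) (hv : d.SmoothOn v U)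
    (w : TangentSpace I x) :
    d.nabla (fun y => u y + v y) x w = d.nabla u x w + d.nabla v x w := by
  have e : d.localRep (fun y => u y + v y) (d.spin.indexAt x) =
      fun y => d.localRep u (d.spin.indexAt x) y + d.localRep v (d.spin.indexAt x) y :=
    funext fun y => map_add (d.rep _ y) _ _
  simp only [nabla_eq, nab_apply, e]
  rw [d.connS_add ((d.spin.isOpen_baseSet _).inter hU) ⟨d.spin.mem_baseSet_at x, hx⟩
    (hu.localRep d _) (hv.localRep d _), map_add, LinearMap.add_apply]
  abel

lemma nabla_smul (hU : IsOpen U) (hx : x ∈ U) {f : M → ℝ} (hf : ContMDiffOn I 𝓘(ℝ, ℝ) ∞ f U)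
    (hu : d.SmoothOn u U) (w : TangentSpace I x) :
    d.nabla (fun y => f y • u y) x w = f x • d.nabla u x w + mvfderiv I f x w • u x := by
  have e : d.localRep (fun y => f y • u y) (d.spin.indexAt x) =
      fun y => f y • d.localRep u (d.spin.indexAt x) y :=
    funext fun y => map_smul (d.rep _ y) _ _
  simp only [nabla_eq, nab_apply, e]
  rw [d.connS_smul ((d.spin.isOpen_baseSet _).inter hU) ⟨d.spin.mem_baseSet_at x, hx⟩
    (hf.mono Set.inter_subset_right) (hu.localRep d _), map_smul, smul_add]
  rw [localRep_eq, rep_indexAt]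
  abel

lemma nabla_const_smul (hU : IsOpen U) (hx : x ∈ U) (r : ℝ) (hu : d.SmoothOn u U)
    (w : TangentSpace I x) : d.nabla (fun y => r • u y) x w = r • d.nabla u x w := by
  rw [d.nabla_smul hU hx (f := fun _ => r) contMDiffOn_const hu, mvfderiv_const, zero_apply,
    zero_smul, add_zero]

lemma nabla_zero (w : TangentSpace I x) : d.nabla (fun y => (0 : SFiber n V y)) x w = 0 := by
  have h := d.nabla_sum isOpen_univ (Set.mem_univ x) (S := (∅ : Finset (Fin n)))
    (u := fun _ _ => 0) (fun i hi => by simp at hi) w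
  simpa using h

lemma nabla_eq_zero_of_notMem {K : Set M} (hK : IsClosed K) (h0 : ∀ y ∉ K, u y = 0) (hx : x ∉ K)
    (w : TangentSpace I x) : d.nabla u x w = 0 := by
  rw [d.nabla_congr_on (v := fun _ => 0) (U := Kᶜ) h0 hK.isOpen_compl hx SmoothOn.zero,
    nabla_zero]

lemma nabla_sigL (hU : IsOpen U) (hx : x ∈ U) (hu : d.SmoothOn u U) (w : TangentSpace I x) :
    d.nabla (fun y => sigL (u y)) x w = sigL (d.nabla u x w) := by
  have e : d.localRep (fun y => sigL (u y)) (d.spin.indexAt x) =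
      fun y => sigL (d.localRep u (d.spin.indexAt x) y) := funext fun y => d.rep_sigL _
  simp only [nabla_eq, nab_apply, e]
  rw [d.connS_sigL ((d.spin.isOpen_baseSet _).inter hU) ⟨d.spin.mem_baseSet_at x, hx⟩
    (hu.localRep d _), map_add, sigL_act]

/-- Clifford multiplication is parallel. -/
lemma nabla_cv (hU : IsOpen U) (hx : x ∈ U)
    (hY : SmoothSectionOn I (EuclideanSpace ℝ (Fin n)) Y U) (hu : d.SmoothOn u U)
    (w : TangentSpace I x) :
    d.nabla (fun y => d.cv (Y y) (u y)) x w =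
      d.cv (d.lc Y x w) (u x) + d.cv (Y x) (d.nabla u x w) := by
  set α := d.spin.indexAt x with hα
  have ho := d.spin.isOpen_baseSet α
  have hxα : x ∈ d.spin.baseSet α := d.spin.mem_baseSet_at x
  have hW : IsOpen (d.spin.baseSet α ∩ U) := ho.inter hU
  have hxW : x ∈ d.spin.baseSet α ∩ U := ⟨hxα, hx⟩
  have hs := fun i => (d.spin.smooth_frame α i).mono (Set.inter_subset_left (t := U))
  have hY' := hY.mono (Set.inter_subset_right (s := d.spin.baseSet α))
  have hf := fun i => smooth_inner_tangent (hs i) hY'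
  have hA : SmoothMat I (fun y => ∑ i, (inner ℝ (d.spin.frame α i y) (Y y) : ℝ) • d.spinor.gam i)
      (d.spin.baseSet α ∩ U) :=
    .sum (S := Finset.univ) fun i _ => (SmoothMat.const (d.spinor.gam i)).smul (hf i)
  have hu' := hu.localRep d α
  have e1 : d.connS (d.localRep (fun y => d.cv (Y y) (u y)) α) x = d.connS (fun y =>
      cl (∑ i, (inner ℝ (d.spin.frame α i y) (Y y) : ℝ) • d.spinor.gam i) (d.localRep u α y)) x :=
    d.connS_congr_nhds (Filter.mem_of_superset (hW.mem_nhds hxW)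
      fun y hy => d.rep_cv hy.1 (Y y) (u y)) hW hxW (hu'.cl hA)
  have e2 : dMat I (fun y => ∑ i, (inner ℝ (d.spin.frame α i y) (Y y) : ℝ) • d.spinor.gam i) x w =
      ∑ i, (inner ℝ (d.lc (d.spin.frame α i) x w) (Y x) : ℝ) • d.spinor.gam i
      + ∑ i, (inner ℝ (d.spin.frame α i x) (d.lc Y x w) : ℝ) • d.spinor.gam i := by
    rw [dMat_sum_smul hW hxW fun i _ => hf i, ← Finset.sum_add_distrib]
    refine Finset.sum_congr rfl fun i _ => ?_
    rw [d.mvfderiv_inner hW hxW (hs i) hY', add_smul]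
  -- The commutator of the connection matrix with the generators cancels the derivative of the frame
  -- vectors in `e2`; the term with the derivative of `Y` is left.
  have e3 : d.spinConn α x w * ∑ i, (inner ℝ (d.spin.frame α i x) (Y x) : ℝ) • d.spinor.gam i =
      (∑ i, (inner ℝ (d.spin.frame α i x) (Y x) : ℝ) • d.spinor.gam i) * d.spinConn α x w
      - ∑ i, (inner ℝ (d.lc (d.spin.frame α i) x w) (Y x) : ℝ) • d.spinor.gam i := by
    have h1 : ∀ i, (inner ℝ (d.lc (d.spin.frame α i) x w) (Y x) : ℝ) =
        -∑ j, (inner ℝ (d.spin.frame α j x) (Y x) : ℝ) *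
          inner ℝ (d.lc (d.spin.frame α j) x w) (d.spin.frame α i x) := by
      intro i
      conv_lhs => rw [← d.sum_inner_smul hxα (Y x)]
      rw [inner_sum, ← Finset.sum_neg_distrib]
      refine Finset.sum_congr rfl fun j _ => ?_
      rw [real_inner_smul_right, d.antisymm_frame hxα w i j, mul_neg]
    have h2 := d.spinor.cliffRel_gam.bivector_comm (fun i j => d.antisymm_frame hxα w i j)
    simp only [h1, neg_smul, Finset.sum_neg_distrib, sub_neg_eq_add, Finset.sum_smul]
    rw [Finset.sum_comm, Finset.mul_sum, Finset.sum_mul, ← Finset.sum_add_distrib]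
    refine Finset.sum_congr rfl fun j _ => ?_
    rw [mul_smul_comm, smul_mul_assoc, spinConn, h2, smul_add, Finset.smul_sum]
    simp only [smul_smul]
  apply d.rep_injective hxα
  rw [map_add, d.rep_cv hxα, d.rep_cv hxα, hα, rep_indexAt, rep_indexAt, rep_indexAt, ← hα,
    nabla_eq, nabla_eq, ← hα, nab_apply, nab_apply, e1, d.connS_cl hW hxW hA hu',
    localRep_eq, localRep_eq, d.rep_cv hxα, hα, rep_indexAt, ← hα, act_cl, e3, e2, map_add,
    map_sub, map_add, cl_act, LinearMap.add_apply, LinearMap.sub_apply]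
  abel

/-- The connection matrices are skew-Hermitian, so their two contributions cancel and the
compatibility of the connection of `V` remains. -/
lemma mvfderiv_herm_nabla (hU : IsOpen U) (hx : x ∈ U) (hu : d.SmoothOn u U)
    (hv : d.SmoothOn v U) (w : TangentSpace I x) :
    mvfderiv I (fun y => herm (u y) (v y)) x w =
      herm (d.nabla u x w) (v x) + herm (u x) (d.nabla v x w) := by
  set α := d.spin.indexAt x with hα
  have ho := d.spin.isOpen_baseSet α
  have hxα : x ∈ d.spin.baseSet α := d.spin.mem_baseSet_at x
  have hW : IsOpen (d.spin.baseSet α ∩ U) := ho.inter hU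
  have e : mvfderiv I (fun y => herm (u y) (v y)) x =
      mvfderiv I (fun y => herm (d.localRep u α y) (d.localRep v α y)) x :=
    mvfderiv_congr (Filter.mem_of_superset (ho.mem_nhds hxα)
      fun y hy => (d.herm_rep hy _ _).symm)
  have e2 : (d.spinConn α x w)ᴴ = -d.spinConn α x w :=
    d.spinor.bivector_conjTranspose fun i j => d.antisymm_frame hxα w i j
  rw [e, d.mvfderiv_herm hW ⟨hxα, hx⟩ (hu.localRep d α) (hv.localRep d α), nabla_eq, nabla_eq,
    nab_apply, nab_apply, ← hα, localRep_eq, localRep_eq, hα, rep_indexAt, rep_indexAt, ← hα,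
    herm_add_left, herm_add_right, herm_act, e2]
  simp only [herm_eq_hermL, map_neg, LinearMap.neg_apply]
  ring

end

section

/-! ### The operators in an arbitrary orthonormal frame -/

variable {α β : κ} {x : M} {U U' : Set M} {X Y : Π x : M, TangentSpace I x}
  {u v : Π x : M, SFiber n V x} {Ψ : Π x : M, TangentSpace I x →ₗ[ℝ] SFiber n V x}

lemma nablaT_apply (u : Π x : M, SFiber n V x) (w : TangentSpace I x) :
    d.nablaT u x w = d.nabla u x w - (1 / 2 : ℝ) • d.c (d.kForm w) (sigL (u x)) := rfl

/-- Clifford multiplication by `k(v, ·)`. -/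
def cK {x : M} : TangentSpace I x →ₗ[ℝ] SFiber n V x →ₗ[ℝ] SFiber n V x :=
  LinearMap.mk₂ ℝ (fun v z => d.c (d.kForm v) z)
    (fun v w z => by rw [kForm_add, c_add_left])
    (fun r v z => by rw [kForm_smul, c_smul_left])
    (fun v z z' => by simp only [c_eq, map_add])
    (fun r v z => by simp only [c_eq, map_smul])

lemma cK_apply (v : TangentSpace I x) (z : SFiber n V x) : d.cK v z = d.c (d.kForm v) z := rfl

lemma cK_eq_sum (hα : x ∈ d.spin.baseSet α) (v : TangentSpace I x) (z : SFiber n V x) :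
    d.cK v z = ∑ j, d.k x v (d.spin.frame α j x) • d.cv (d.spin.frame α j x) z :=
  d.c_eq_sum hα _ _

/-- The tensor `k` is symmetric, so its Clifford contraction retains only the trace. -/
lemma sum_cv_cK (z : SFiber n V x) :
    ∑ i, d.cv (d.e x i x) (d.cK (d.e x i x) z) = -d.trK x • z := by
  have h := d.spinor.cliffRel_gam.sum_symm
    (a := fun i j => d.k x (d.e x i x) (d.e x j x)) fun i j => d.symm_k x _ _
  have h2 := congrArg (fun A => act A z) h
  simp only [map_sum, map_smul, LinearMap.sum_apply, LinearMap.smul_apply, act_one] at h2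
  refine Eq.trans (Finset.sum_congr rfl fun i _ => ?_) h2
  rw [d.cK_eq_sum (d.spin.mem_baseSet_at x), map_sum]
  refine Finset.sum_congr rfl fun j _ => ?_
  change d.cv (d.e x i x) (d.k x (d.e x i x) (d.e x j x) • d.cv (d.e x j x) z) = _
  rw [map_smul, cv_e, cv_e, cl_cl]

theorem nablaT_eq (u : Π x : M, SFiber n V x) (x : M) (w : TangentSpace I x) :
    d.nablaT u x w = d.nabla u x w + (1 / 2 : ℝ) • sig (d.c (d.kForm w) (u x)) := by
  rw [nablaT_apply, sig_eq_sigL, sigL_c, smul_neg, sub_eq_add_neg]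

theorem DT_eq (u : Π x : M, SFiber n V x) (x : M) :
    d.DT u x = d.D u x + (d.trK x / 2) • sig (u x) := by
  have h := d.sum_cv_cK (x := x) (sigL (u x))
  simp only [DT, D, c_coframe, nablaT_apply, map_sub, map_smul, Finset.sum_sub_distrib,
    ← Finset.smul_sum]
  simp only [cK_apply] at h
  rw [h, sig_eq_sigL]
  module

lemma D_eq_frame (hα : x ∈ d.spin.baseSet α) (u : Π x : M, SFiber n V x) :
    d.D u x = ∑ i, d.cv (d.spin.frame α i x) (d.nabla u x (d.spin.frame α i x)) :=
  d.sum_bilin_frame (d.spin.mem_baseSet_at x) hα (d.cv.compl₂ (d.nabla u x))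

lemma trK_eq_frame (hα : x ∈ d.spin.baseSet α) :
    d.trK x = ∑ i, d.k x (d.spin.frame α i x) (d.spin.frame α i x) :=
  d.sum_bilin_frame (d.spin.mem_baseSet_at x) hα
    (LinearMap.mk₂ ℝ (fun v w => d.k x v w) (by simp) (by simp) (by simp) (by simp))

lemma hermForm_eq_frame (hα : x ∈ d.spin.baseSet α)
    (Φ Ψ : TangentSpace I x →ₗ[ℝ] SFiber n V x) :
    d.hermForm Φ Ψ = ∑ i, herm (Φ (d.spin.frame α i x)) (Ψ (d.spin.frame α i x)) :=
  d.sum_bilin_frame (d.spin.mem_baseSet_at x) hα ((hermL.comp Φ).compl₂ Ψ)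

lemma smooth_trK : ContMDiff I 𝓘(ℝ, ℝ) ∞ d.trK := by
  intro x
  set α := d.spin.indexAt x
  have ho := d.spin.isOpen_baseSet α
  have hs := d.spin.smooth_frame α
  have h : ContMDiffOn I 𝓘(ℝ, ℝ) ∞ d.trK (d.spin.baseSet α) :=
    (ContMDiffOn.finset_sum_fun (S := Finset.univ) fun i _ =>
      d.smooth_k_apply (hs i) (hs i)).congr fun y hy => d.trK_eq_frame hy
  exact h.contMDiffAt (ho.mem_nhds (d.spin.mem_baseSet_at x))

lemma smoothOn_D (hU : IsOpen U) (hu : d.SmoothOn u U) : d.SmoothOn (d.D u) U := by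
  refine SmoothOn.of_local fun x hx => ?_
  set α := d.spin.indexAt x
  have ho := d.spin.isOpen_baseSet α
  refine ⟨d.spin.baseSet α, ho, d.spin.mem_baseSet_at x, ?_⟩
  have hs := fun i => (d.spin.smooth_frame α i).mono (Set.inter_subset_right (s := U))
  have hu' := hu.mono (Set.inter_subset_left (t := d.spin.baseSet α))
  exact (SmoothOn.sum (S := Finset.univ) fun i _ =>
    (d.smoothOn_nabla (hU.inter ho) (hs i) hu').cv (hs i)).congr
      fun y hy => d.D_eq_frame hy.2 u

lemma smooth_trK_div_two : ContMDiffOn I 𝓘(ℝ, ℝ) ∞ (fun y => d.trK y / 2) U :=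
  ((d.smooth_trK.contMDiffOn (s := U)).smul
    (contMDiffOn_const (I' := 𝓘(ℝ, ℝ)) (c := (1 / 2 : ℝ)))).congr
      fun y _ => by simp [div_eq_mul_inv]

lemma smoothOn_nablaT (hU : IsOpen U) (hX : SmoothSectionOn I (EuclideanSpace ℝ (Fin n)) X U)
    (hu : d.SmoothOn u U) : d.SmoothOn (fun y => d.nablaT u y (X y)) U :=
  ((d.smoothOn_nabla hU hX hu).sub
    ((d.smooth_c_kForm hX hu.sigL).const_smul (1 / 2))).congr fun _ _ => rfl

lemma smoothFormOn_nabla (hU : IsOpen U) (hu : d.SmoothOn u U) : d.SmoothFormOn (d.nabla u) U :=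
  fun α i => d.smoothOn_nabla ((d.spin.isOpen_baseSet α).inter hU)
    ((d.spin.smooth_frame α i).mono Set.inter_subset_left) (hu.mono Set.inter_subset_right)

lemma smoothFormOn_nablaT (hU : IsOpen U) (hu : d.SmoothOn u U) :
    d.SmoothFormOn (d.nablaT u) U :=
  fun α i => d.smoothOn_nablaT ((d.spin.isOpen_baseSet α).inter hU)
    ((d.spin.smooth_frame α i).mono Set.inter_subset_left) (hu.mono Set.inter_subset_right)

lemma SmoothFormOn.mono {d : SpinInitialData I M F V κ} (hΨ : d.SmoothFormOn Ψ U) (h : U' ⊆ U) :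
    d.SmoothFormOn Ψ U' :=
  fun α i => (hΨ α i).mono (Set.inter_subset_inter_right _ h)

lemma SmoothFormOn.apply {d : SpinInitialData I M F V κ} (hΨ : d.SmoothFormOn Ψ U)
    (hX : SmoothSectionOn I (EuclideanSpace ℝ (Fin n)) X U) :
    d.SmoothOn (fun y => Ψ y (X y)) U := by
  refine SmoothOn.of_local fun x hx => ?_
  set α := d.spin.indexAt x
  refine ⟨d.spin.baseSet α, d.spin.isOpen_baseSet α, d.spin.mem_baseSet_at x, ?_⟩
  have hs := fun i => (d.spin.smooth_frame α i).mono (Set.inter_subset_right (s := U))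
  have hX' := hX.mono (Set.inter_subset_left (t := d.spin.baseSet α))
  refine (SmoothOn.sum (S := Finset.univ) fun i _ => SmoothOn.smul
    (smooth_inner_tangent (hs i) hX') ((hΨ α i).mono (Set.inter_comm _ _).subset)).congr
      fun y hy => ?_
  conv_lhs => rw [← d.sum_inner_smul hy.2 (X y)]
  simp only [map_sum, map_smul]

/-! ### The covariant derivative of `S`-valued 1-forms -/

/-- `(∇_v Ψ)(Y) = ∇_v (Ψ(Y)) - Ψ(∇_v Y)`. -/
def covForm (Ψ : Π x : M, TangentSpace I x →ₗ[ℝ] SFiber n V x) (Y : Π x : M, TangentSpace I x)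
    (x : M) (v : TangentSpace I x) : SFiber n V x :=
  d.nabla (fun y => Ψ y (Y y)) x v - Ψ x (d.lc Y x v)

lemma nablaStar_eq (Ψ : Π x : M, TangentSpace I x →ₗ[ℝ] SFiber n V x) (x : M) :
    d.nablaStar Ψ x = -∑ i, d.covForm Ψ (d.e x i) x (d.e x i x) := by
  simp only [nablaStar, covForm, ← Finset.sum_neg_distrib]
  exact Finset.sum_congr rfl fun i _ => by abel

/-- The term +½ c(k) σ contained in -∇̃ combines with -c(k) σ, which leaves half of the latter. -/
lemma nablaTStar_eq (Ψ : Π x : M, TangentSpace I x →ₗ[ℝ] SFiber n V x) (x : M) :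
    d.nablaTStar Ψ x = d.nablaStar Ψ x -
      (1 / 2 : ℝ) • ∑ i, d.cK (d.e x i x) (sigL (Ψ x (d.e x i x))) := by
  rw [nablaTStar, nablaStar, Finset.smul_sum, ← Finset.sum_sub_distrib]
  refine Finset.sum_congr rfl fun i _ => ?_
  rw [nablaT_apply, sig_eq_sigL, cK_apply]
  module

/-- The covariant derivative of a 1-form is tensorial in `Y`: the derivatives of the coefficients
cancel between ∇(Ψ(Y)) and Ψ(∇Y). -/
lemma covForm_eq_sum (hU : IsOpen U) (hx : x ∈ U) (hα : x ∈ d.spin.baseSet α)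
    (hΨ : d.SmoothFormOn Ψ U)
    (hY : SmoothSectionOn I (EuclideanSpace ℝ (Fin n)) Y U) (v : TangentSpace I x) :
    d.covForm Ψ Y x v = ∑ j, (inner ℝ (d.spin.frame α j x) (Y x) : ℝ) •
      d.covForm Ψ (d.spin.frame α j) x v := by
  have hW : IsOpen (d.spin.baseSet α ∩ U) := (d.spin.isOpen_baseSet α).inter hU
  have hxW : x ∈ d.spin.baseSet α ∩ U := ⟨hα, hx⟩
  have hs := fun i => (d.spin.smooth_frame α i).mono (Set.inter_subset_left (t := U))
  have hY' := hY.mono (Set.inter_subset_right (s := d.spin.baseSet α))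
  have hf := fun i => smooth_inner_tangent (hs i) hY'
  have e1 : d.lc Y x = d.lc (fun z => ∑ j, (inner ℝ (d.spin.frame α j z) (Y z) : ℝ) •
      d.spin.frame α j z) x :=
    d.lc.congr_on (fun z hz => (d.sum_inner_smul hz.1 (Y z)).symm) hW hxW
      (.sum fun j _ => (hs j).smul (hf j))
  have e2 : d.nabla (fun y => Ψ y (Y y)) x = d.nabla (fun y => ∑ j,
      (inner ℝ (d.spin.frame α j y) (Y y) : ℝ) • Ψ y (d.spin.frame α j y)) x := by
    refine d.nabla_congr_on (fun y hy => ?_) hW hxW (.sum fun j _ => (hΨ α j).smul (hf j))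
    conv_lhs => rw [← d.sum_inner_smul hy.1 (Y y)]
    simp only [map_sum, map_smul]
  rw [covForm, e1, e2, d.nabla_sum hW hxW fun j _ => (hΨ α j).smul (hf j),
    d.lc.fun_sum_smul hW hxW (fun j _ => hf j) fun j _ => hs j, map_sum, ← Finset.sum_sub_distrib]
  refine Finset.sum_congr rfl fun j _ => ?_
  rw [d.nabla_smul hW hxW (hf j) (hΨ α j), map_add, map_smul, map_smul, covForm, smul_sub]
  abel

lemma covForm_add (Y : Π x : M, TangentSpace I x) (v w : TangentSpace I x) :
    d.covForm Ψ Y x (v + w) = d.covForm Ψ Y x v + d.covForm Ψ Y x w := by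
  simp only [covForm, map_add]
  abel

lemma covForm_smul (Y : Π x : M, TangentSpace I x) (r : ℝ) (v : TangentSpace I x) :
    d.covForm Ψ Y x (r • v) = r • d.covForm Ψ Y x v := by
  simp only [covForm, map_smul, smul_sub]

lemma nablaStar_eq_frame (hU : IsOpen U) (hx : x ∈ U) (hα : x ∈ d.spin.baseSet α)
    (hΨ : d.SmoothFormOn Ψ U) :
    d.nablaStar Ψ x = -∑ i, d.covForm Ψ (d.spin.frame α i) x (d.spin.frame α i x) := by
  -- `covForm` takes a vector field as its second argument. Expanding that field in the frame at `x`
  -- turns it into a bilinear map on the tangent space, to which frame independence applies.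
  have h := d.sum_bilin_frame (d.spin.mem_baseSet_at x) hα
    (LinearMap.mk₂ ℝ (fun v w => ∑ j, (inner ℝ (d.e x j x) w : ℝ) • d.covForm Ψ (d.e x j) x v)
      (fun v v' w => by simp only [covForm_add, smul_add, Finset.sum_add_distrib])
      (fun r v w => by
        simp only [covForm_smul, Finset.smul_sum]
        exact Finset.sum_congr rfl fun j _ => smul_comm _ _ _)
      (fun v w w' => by simp only [inner_add_right, add_smul, Finset.sum_add_distrib])
      (fun r v w => by simp only [real_inner_smul_right, mul_smul, Finset.smul_sum]))
  rw [nablaStar_eq]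
  congr 1
  have key : ∀ β i (_ : x ∈ d.spin.baseSet β), d.covForm Ψ (d.spin.frame β i) x
      (d.spin.frame β i x) = ∑ j, (inner ℝ (d.e x j x) (d.spin.frame β i x) : ℝ) •
        d.covForm Ψ (d.e x j) x (d.spin.frame β i x) := fun β i hβ =>
    d.covForm_eq_sum ((d.spin.isOpen_baseSet β).inter hU) ⟨hβ, hx⟩ (d.spin.mem_baseSet_at x)
      (hΨ.mono Set.inter_subset_right)
      ((d.spin.smooth_frame β i).mono Set.inter_subset_left) _
  rw [Finset.sum_congr rfl fun i _ => key α i hα]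
  exact (Finset.sum_congr rfl fun i _ => key _ i (d.spin.mem_baseSet_at x)).trans h

lemma smoothOn_nablaStar (hU : IsOpen U) (hΨ : d.SmoothFormOn Ψ U) :
    d.SmoothOn (d.nablaStar Ψ) U := by
  refine SmoothOn.of_local fun x hx => ?_
  set α := d.spin.indexAt x
  have ho := d.spin.isOpen_baseSet α
  have hW := hU.inter ho
  refine ⟨d.spin.baseSet α, ho, d.spin.mem_baseSet_at x, ?_⟩
  have hs := fun i => (d.spin.smooth_frame α i).mono (Set.inter_subset_right (s := U))
  have hΨ' := hΨ.mono (Set.inter_subset_left (t := d.spin.baseSet α))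
  exact (SmoothOn.sum (S := Finset.univ) fun i _ =>
    (d.smoothOn_nabla hW (hs i) (hΨ'.apply (hs i))).sub
      (hΨ'.apply (d.smooth_lc hW (hs i) (hs i)))).neg.congr
        fun y hy => d.nablaStar_eq_frame hU hy.1 hy.2 hΨ

lemma sum_cK_eq_frame (hα : x ∈ d.spin.baseSet α) (Φ : TangentSpace I x →ₗ[ℝ] SFiber n V x) :
    ∑ i, d.cK (d.e x i x) (sigL (Φ (d.e x i x))) =
      ∑ i, d.cK (d.spin.frame α i x) (sigL (Φ (d.spin.frame α i x))) :=
  d.sum_bilin_frame (d.spin.mem_baseSet_at x) hα (d.cK.compl₂ (sigL.comp Φ))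

lemma smoothOn_sum_cK (hΨ : d.SmoothFormOn Ψ U) :
    d.SmoothOn (fun x => ∑ i, d.cK (d.e x i x) (sigL (Ψ x (d.e x i x)))) U := by
  refine SmoothOn.of_local fun x hx => ?_
  set α := d.spin.indexAt x
  refine ⟨d.spin.baseSet α, d.spin.isOpen_baseSet α, d.spin.mem_baseSet_at x, ?_⟩
  have hs := fun i => (d.spin.smooth_frame α i).mono (Set.inter_subset_right (s := U))
  have hΨ' := hΨ.mono (Set.inter_subset_left (t := d.spin.baseSet α))
  exact (SmoothOn.sum (S := Finset.univ) fun i _ =>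
    d.smooth_c_kForm (hs i) (hΨ'.apply (hs i)).sigL).congr fun y hy => d.sum_cK_eq_frame hy.2 _

lemma smoothOn_nablaTStar (hU : IsOpen U) (hΨ : d.SmoothFormOn Ψ U) :
    d.SmoothOn (d.nablaTStar Ψ) U :=
  ((d.smoothOn_nablaStar hU hΨ).sub ((d.smoothOn_sum_cK hΨ).const_smul (1 / 2))).congr
    fun y _ => d.nablaTStar_eq Ψ y

/-! ### The divergence of the vector field dual to a 1-form -/

/-- The vector field dual to the real 1-form `θ`. -/
def sharp (θ : Π x : M, TangentSpace I x →ₗ[ℝ] ℝ) (x : M) : TangentSpace I x :=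
  ∑ i, θ x (d.e x i x) • d.e x i x

lemma sharp_eq_frame {θ : Π x : M, TangentSpace I x →ₗ[ℝ] ℝ} (hα : x ∈ d.spin.baseSet α) :
    d.sharp θ x = ∑ i, θ x (d.spin.frame α i x) • d.spin.frame α i x :=
  d.sum_bilin_frame (d.spin.mem_baseSet_at x) hα
    (LinearMap.mk₂ ℝ (fun v w => θ x v • w) (by simp [add_smul]) (by simp [mul_smul])
      (by simp) (by intro r v w; exact smul_comm _ _ _))

lemma smooth_sharp {θ : Π x : M, TangentSpace I x →ₗ[ℝ] ℝ}
    (hθ : ∀ α i, ContMDiffOn I 𝓘(ℝ, ℝ) ∞ (fun y => θ y (d.spin.frame α i y))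
      (d.spin.baseSet α ∩ U)) :
    SmoothSectionOn I (EuclideanSpace ℝ (Fin n)) (d.sharp θ) U := by
  refine SmoothSectionOn.of_local fun x hx => ?_
  set α := d.spin.indexAt x
  refine ⟨d.spin.baseSet α, d.spin.isOpen_baseSet α, d.spin.mem_baseSet_at x, ?_⟩
  exact (SmoothSectionOn.sum (S := Finset.univ) fun i _ =>
    ((d.spin.smooth_frame α i).mono (Set.inter_subset_right (s := U))).smul
      ((hθ α i).mono (Set.inter_comm _ _).subset)).congr fun y hy => d.sharp_eq_frame hy.2

lemma divX_sharp {θ : Π x : M, TangentSpace I x →ₗ[ℝ] ℝ} (hU : IsOpen U) (hx : x ∈ U)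
    (hθ : ∀ α i, ContMDiffOn I 𝓘(ℝ, ℝ) ∞ (fun y => θ y (d.spin.frame α i y))
      (d.spin.baseSet α ∩ U)) :
    d.divX (d.sharp θ) x = ∑ i, (mvfderiv I (fun y => θ y (d.e x i y)) x (d.e x i x)
      - θ x (d.lc (d.e x i) x (d.e x i x))) := by
  set α := d.spin.indexAt x with hα
  have ho := d.spin.isOpen_baseSet α
  have hxα : x ∈ d.spin.baseSet α := d.spin.mem_baseSet_at x
  have hW : IsOpen (d.spin.baseSet α ∩ U) := ho.inter hU
  have hxW : x ∈ d.spin.baseSet α ∩ U := ⟨hxα, hx⟩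
  have hs := fun i => (d.spin.smooth_frame α i).mono (Set.inter_subset_left (t := U))
  have hsh := (d.smooth_sharp hθ).mono (Set.inter_subset_right (s := d.spin.baseSet α))
  have hin : ∀ y ∈ d.spin.baseSet α, ∀ w, (inner ℝ (d.sharp θ y) w : ℝ) = θ y w := by
    intro y hy w
    conv_rhs => rw [← d.sum_inner_smul hy w]
    rw [d.sharp_eq_frame hy, sum_inner, map_sum]
    refine Finset.sum_congr rfl fun i _ => ?_
    rw [real_inner_smul_left, map_smul, smul_eq_mul, mul_comm]
  refine Finset.sum_congr rfl fun i _ => ?_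
  have h := d.mvfderiv_inner hW hxW hsh (hs i) (d.spin.frame α i x)
  rw [hin x hxα, mvfderiv_congr (g := fun y => θ y (d.spin.frame α i y))
    (Filter.mem_of_superset (ho.mem_nhds hxα) fun y hy => hin y hy _)] at h
  exact eq_sub_of_add_eq h.symm

end

section

/-! ### The curvature of `S` -/

variable {α β : κ} {x : M} {U U' : Set M} {X Y : Π x : M, TangentSpace I x}
  {u v : Π x : M, SFiber n V x} {Ψ Φ : Π x : M, TangentSpace I x →ₗ[ℝ] SFiber n V x}

lemma dMat_bivector (hU : IsOpen U) (hx : x ∈ U) {γ : Fin n → SMat n} {a : M → Fin n → Fin n → ℝ}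
    (ha : ∀ i j, ContMDiffOn I 𝓘(ℝ, ℝ) ∞ (fun y => a y i j) U) (w : TangentSpace I x) :
    dMat I (fun y => bivector γ (a y)) x w =
      bivector γ (fun i j => mvfderiv I (fun y => a y i j) x w) := by
  have e : ∀ b : Fin n → Fin n → ℝ, bivector γ b =
      ∑ p : Fin n × Fin n, b p.1 p.2 • ((1 / 4 : ℝ) • (γ p.1 * γ p.2)) := by
    intro b
    rw [bivector, Fintype.sum_prod_type, Finset.smul_sum]
    refine Finset.sum_congr rfl fun i _ => ?_
    rw [Finset.smul_sum]
    exact Finset.sum_congr rfl fun j _ => smul_comm _ _ _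
  simp only [e]
  exact dMat_sum_smul hU hx (fun p _ => ha p.1 p.2) _ w

lemma bivector_add (γ : Fin n → SMat n) (a b : Fin n → Fin n → ℝ) :
    bivector γ a + bivector γ b = bivector γ fun i j => a i j + b i j := by
  simp only [bivector, ← smul_add, ← Finset.sum_add_distrib, ← add_smul]

lemma bivector_sub (γ : Fin n → SMat n) (a b : Fin n → Fin n → ℝ) :
    bivector γ a - bivector γ b = bivector γ fun i j => a i j - b i j := by
  simp only [bivector, ← smul_sub, ← Finset.sum_sub_distrib, ← sub_smul]

lemma inner_eq_sum (hα : x ∈ d.spin.baseSet α) (v w : TangentSpace I x) :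
    (inner ℝ v w : ℝ) = ∑ m, inner ℝ v (d.spin.frame α m x) * inner ℝ w (d.spin.frame α m x) := by
  conv_lhs => rw [← d.sum_inner_smul hα w]
  rw [inner_sum]
  refine Finset.sum_congr rfl fun m _ => ?_
  rw [real_inner_smul_right, real_inner_comm, mul_comm]

/-- The curvature of the connection matrices of the spinor connection. -/
lemma curvature_spinConn (hU : IsOpen U) (hx : x ∈ U) (hα : x ∈ d.spin.baseSet α)
    (hX : SmoothSectionOn I (EuclideanSpace ℝ (Fin n)) X U)
    (hY : SmoothSectionOn I (EuclideanSpace ℝ (Fin n)) Y U) :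
    dMat I (fun y => d.spinConn α y (Y y)) x (X x) - dMat I (fun y => d.spinConn α y (X y)) x (Y x)
      + (d.spinConn α x (X x) * d.spinConn α x (Y x)
        - d.spinConn α x (Y x) * d.spinConn α x (X x))
      - d.spinConn α x (VectorField.mlieBracket I X Y x) =
    bivector d.spinor.gam fun k l =>
      inner ℝ (curvatureOp d.lc X Y (d.spin.frame α k) x) (d.spin.frame α l x) := by
  have hW : IsOpen (d.spin.baseSet α ∩ U) := (d.spin.isOpen_baseSet α).inter hU
  have hxW : x ∈ d.spin.baseSet α ∩ U := ⟨hα, hx⟩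
  have hs := fun i => (d.spin.smooth_frame α i).mono (Set.inter_subset_left (t := U))
  have hX' := hX.mono (Set.inter_subset_right (s := d.spin.baseSet α))
  have hY' := hY.mono (Set.inter_subset_right (s := d.spin.baseSet α))
  have hd : ∀ X Y : Π x : M, TangentSpace I x,
      SmoothSectionOn I (EuclideanSpace ℝ (Fin n)) Y (d.spin.baseSet α ∩ U) →
      dMat I (fun y => d.spinConn α y (Y y)) x (X x) = bivector d.spinor.gam fun k l =>
        inner ℝ (d.lc (fun y => d.lc (d.spin.frame α k) y (Y y)) x (X x)) (d.spin.frame α l x)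
        + inner ℝ (d.lc (d.spin.frame α k) x (Y x)) (d.lc (d.spin.frame α l) x (X x)) := by
    intro X Y hY
    have h := dMat_bivector hW hxW (γ := d.spinor.gam) (a := fun y k l =>
      inner ℝ (d.lc (d.spin.frame α k) y (Y y)) (d.spin.frame α l y))
      (fun k l => smooth_inner_tangent (d.smooth_lc hW hY (hs k)) (hs l)) (X x)
    refine h.trans ?_
    congr 1
    ext k l
    exact d.mvfderiv_inner hW hxW (d.smooth_lc hW hY (hs k)) (hs l) _
  -- The commutator of the connection matrices cancels the products of first derivatives of the
  -- frame that arise in differentiating the connection coefficients.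
  have hc := d.spinor.cliffRel_gam.bivector_comm_bivector
    (fun i j => d.antisymm_frame hα (X x) i j) (fun i j => d.antisymm_frame hα (Y x) i j)
  have hc' : d.spinConn α x (X x) * d.spinConn α x (Y x)
      - d.spinConn α x (Y x) * d.spinConn α x (X x) = _ := sub_eq_of_eq_add' hc
  rw [hd X Y hY', hd Y X hX', hc', spinConn, bivector_sub, bivector_add, bivector_sub]
  congr 1
  ext k l
  rw [Finset.sum_sub_distrib, ← d.inner_eq_sum hα, ← d.inner_eq_sum hα]
  simp only [curvatureOp, inner_sub_left]
  ring

/-- The two terms with one derivative of `u` are exchanged when `w` and the value of `Y` are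
exchanged, so they disappear from the curvature. -/
lemma rep_nabla_nabla (hU : IsOpen U) (hx : x ∈ U) (hα : x ∈ d.spin.baseSet α)
    (hu : d.SmoothOn u U) (hY : SmoothSectionOn I (EuclideanSpace ℝ (Fin n)) Y U)
    (w : TangentSpace I x) :
    d.rep α x (d.nabla (fun y => d.nabla u y (Y y)) x w) =
      d.connS (fun y => d.connS (d.localRep u α) y (Y y)) x w
      + act (dMat I (fun y => d.spinConn α y (Y y)) x w) (d.rep α x (u x))
      + act (d.spinConn α x (Y x)) (d.connS (d.localRep u α) x w)
      + act (d.spinConn α x w) (d.connS (d.localRep u α) x (Y x))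
      + act (d.spinConn α x w * d.spinConn α x (Y x)) (d.rep α x (u x)) := by
  have hW : IsOpen (d.spin.baseSet α ∩ U) := (d.spin.isOpen_baseSet α).inter hU
  have hxW : x ∈ d.spin.baseSet α ∩ U := ⟨hα, hx⟩
  have hY' := hY.mono (Set.inter_subset_right (s := d.spin.baseSet α))
  have hs := fun i => (d.spin.smooth_frame α i).mono (Set.inter_subset_left (t := U))
  have hA : SmoothMat I (fun y => d.spinConn α y (Y y)) (d.spin.baseSet α ∩ U) :=
    SmoothMat.smul (f := fun _ => (1 / 4 : ℝ)) contMDiffOn_const <|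
      .sum (S := Finset.univ) fun i _ => .sum (S := Finset.univ) fun j _ =>
        (SmoothMat.const _).smul (smooth_inner_tangent (d.smooth_lc hW hY' (hs i)) (hs j))
  have hu' := hu.localRep d α
  have e : d.connS (d.localRep (fun y => d.nabla u y (Y y)) α) x = d.connS (fun y =>
      d.connS (d.localRep u α) y (Y y) + act (d.spinConn α y (Y y)) (d.localRep u α y)) x :=
    d.connS_congr_nhds (Filter.mem_of_superset (hW.mem_nhds hxW)
      fun y hy => d.rep_nabla hU hy.2 hu hy.1 (Y y)) hW hxW
      ((d.smoothPair_connS hW hY' hu').add (hu'.act hA))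
  rw [d.rep_nabla hU hx (d.smoothOn_nabla hU hY hu) hα, nab_apply, e,
    d.connS_add hW hxW (d.smoothPair_connS hW hY' hu') (hu'.act hA), LinearMap.add_apply,
    d.connS_act hW hxW hA hu', localRep_eq _ (fun y => d.nabla u y (Y y)),
    d.rep_nabla hU hx hu hα, nab_apply, map_add, act_mul, localRep_eq]
  abel

/-- The curvature of `S` is the sum of the curvatures of the spinor bundle and of `V`. -/
lemma nabla_nabla_sub (hU : IsOpen U) (hx : x ∈ U) (hu : d.SmoothOn u U)
    (hX : SmoothSectionOn I (EuclideanSpace ℝ (Fin n)) X U)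
    (hY : SmoothSectionOn I (EuclideanSpace ℝ (Fin n)) Y U) :
    d.nabla (fun y => d.nabla u y (Y y)) x (X x) - d.nabla (fun y => d.nabla u y (X y)) x (Y x)
      - d.nabla u x (VectorField.mlieBracket I X Y x) =
    act (bivector d.spinor.gam fun k l =>
      inner ℝ (curvatureOp d.lc X Y (d.e x k) x) (d.e x l x)) (u x) + d.twistCurv X Y u x := by
  set α := d.spin.indexAt x with hα
  have hxα : x ∈ d.spin.baseSet α := d.spin.mem_baseSet_at x
  have h1 := d.rep_nabla_nabla hU hx hxα hu hY (X x)
  have h2 := d.rep_nabla_nabla hU hx hxα hu hX (Y x)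
  have h3 := d.rep_nabla hU hx hu hxα (VectorField.mlieBracket I X Y x)
  have h4 := d.curvature_spinConn hU hx hxα hX hY
  have ht : d.twistCurv X Y u x =
      d.connS (fun y => d.connS (d.localRep u α) y (Y y)) x (X x)
      - d.connS (fun y => d.connS (d.localRep u α) y (X y)) x (Y x)
      - d.connS (d.localRep u α) x (VectorField.mlieBracket I X Y x) := rfl
  rw [hα, rep_indexAt, rep_indexAt, ← hα] at h1 h2
  rw [hα, rep_indexAt, ← hα, nab_apply, localRep_eq, hα, rep_indexAt, ← hα] at h3
  have h5 := congrArg (fun A => act A (u x)) h4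
  simp only [map_add, map_sub, LinearMap.add_apply, LinearMap.sub_apply] at h5
  rw [h1, h2, h3, ht]
  refine Eq.trans ?_ (congrArg (· + _) h5)
  abel

/-! ### The Lichnerowicz formulas -/

lemma sum_split_Ioi {W : Type*} [AddCommGroup W] (f : Fin n → Fin n → W) :
    ∑ i, ∑ j, f i j = ∑ i, f i i + ∑ i, ∑ j ∈ Finset.Ioi i, (f i j + f j i) := by
  have split : ∀ i, ∑ j, f i j =
      f i i + (∑ j ∈ Finset.Ioi i, f i j + ∑ j ∈ Finset.Iio i, f i j) := by
    intro i
    have e : (Finset.univ : Finset (Fin n)) = insert i (Finset.Ioi i ∪ Finset.Iio i) := by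
      ext j
      simp only [Finset.mem_univ, Finset.mem_insert, Finset.mem_union, Finset.mem_Ioi,
        Finset.mem_Iio, true_iff]
      rcases lt_trichotomy i j with h | h | h
      · exact Or.inr (Or.inl h)
      · exact Or.inl h.symm
      · exact Or.inr (Or.inr h)
    rw [e, Finset.sum_insert (by simp), Finset.sum_union]
    exact Finset.disjoint_left.2 fun j h1 h2 =>
      lt_asymm (Finset.mem_Ioi.1 h1) (Finset.mem_Iio.1 h2)
  rw [Finset.sum_congr rfl fun i _ => split i, Finset.sum_add_distrib, Finset.sum_add_distrib,
    Finset.sum_comm' (s := Finset.univ) (t := fun i => Finset.Iio i) (t' := Finset.univ)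
      (s' := fun j => Finset.Ioi j) (by simp)]
  simp only [Finset.sum_add_distrib]

/-- On the diagonal c(eⁱ)² = -1; off the diagonal the factors anticommute, so only the antisymmetric
part of `T` matters. -/
lemma sum_cv_cv (T : Fin n → Fin n → SFiber n V x) :
    ∑ i, ∑ j, d.cv (d.e x i x) (d.cv (d.e x j x) (T i j)) =
      -∑ i, T i i + ∑ i, ∑ j ∈ Finset.Ioi i,
        d.cv (d.e x i x) (d.cv (d.e x j x) (T i j - T j i)) := by
  rw [sum_split_Ioi]
  congr 1
  · rw [← Finset.sum_neg_distrib]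
    refine Finset.sum_congr rfl fun i _ => ?_
    rw [cv_e, cv_e, cl_cl, d.spinor.cliffRel_gam.sq, map_neg, LinearMap.neg_apply, act_one]
  · refine Finset.sum_congr rfl fun i _ => Finset.sum_congr rfl fun j hj => ?_
    rw [d.cv_swap j i, if_neg (Finset.mem_Ioi.1 hj).ne', zero_smul, zero_sub, map_sub, map_sub,
      sub_eq_add_neg]

/-- The coefficients g(∇_w eⱼ, eₘ) are antisymmetric, so a derivative of the frame can be moved from
the Clifford factor to the argument of `L` at the cost of a sign. -/
lemma sum_cv_lc (w : TangentSpace I x) (L : TangentSpace I x →ₗ[ℝ] SFiber n V x) :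
    ∑ j, d.cv (d.lc (d.e x j) x w) (L (d.e x j x)) =
      -∑ j, d.cv (d.e x j x) (L (d.lc (d.e x j) x w)) := by
  have hx := d.spin.mem_baseSet_at x
  have e : ∀ j, d.lc (d.e x j) x w =
      ∑ m, (inner ℝ (d.lc (d.e x j) x w) (d.e x m x) : ℝ) • d.e x m x := by
    intro j
    conv_lhs => rw [← d.sum_inner_smul hx (d.lc (d.e x j) x w)]
    exact Finset.sum_congr rfl fun m _ => by rw [real_inner_comm]; rfl
  have h1 : ∀ j, d.cv (d.lc (d.e x j) x w) (L (d.e x j x)) =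
      ∑ m, (inner ℝ (d.lc (d.e x j) x w) (d.e x m x) : ℝ) • d.cv (d.e x m x) (L (d.e x j x)) := by
    intro j
    conv_lhs => rw [e j]
    simp only [map_sum, map_smul, LinearMap.sum_apply, LinearMap.smul_apply]
  have h2 : ∀ j, d.cv (d.e x j x) (L (d.lc (d.e x j) x w)) =
      ∑ m, (inner ℝ (d.lc (d.e x j) x w) (d.e x m x) : ℝ) • d.cv (d.e x j x) (L (d.e x m x)) := by
    intro j
    conv_lhs => rw [e j]
    simp only [map_sum, map_smul]
  simp only [h1, h2, ← Finset.sum_neg_distrib]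
  rw [Finset.sum_comm]
  refine Finset.sum_congr rfl fun m _ => Finset.sum_congr rfl fun j _ => ?_
  have := d.antisymm_frame hx w j m
  rw [show (inner ℝ (d.lc (d.e x j) x w) (d.e x m x) : ℝ) = _ from this, neg_smul]
  rfl

/-- Clifford multiplication is parallel, and by `sum_cv_lc` the derivatives of the frame are just
those that complete ∇_{eᵢ} ∇_{eⱼ} u to the second covariant derivative. No frame with vanishing
derivative at `x` is needed. -/
lemma D_D_eq (hu : d.SmoothOn u Set.univ) (x : M) :
    d.D (d.D u) x = ∑ i, ∑ j, d.cv (d.e x i x) (d.cv (d.e x j x)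
      (d.covForm (d.nabla u) (d.e x j) x (d.e x i x))) := by
  set α := d.spin.indexAt x
  have ho := d.spin.isOpen_baseSet α
  have hx : x ∈ d.spin.baseSet α := d.spin.mem_baseSet_at x
  have hs := d.spin.smooth_frame α
  have hu' := hu.mono (Set.subset_univ (d.spin.baseSet α))
  have e : d.nabla (d.D u) x = d.nabla (fun y => ∑ j, d.cv (d.spin.frame α j y)
      (d.nabla u y (d.spin.frame α j y))) x :=
    d.nabla_congr_on (fun y hy => d.D_eq_frame hy u) ho hx
      (.sum fun j _ => (d.smoothOn_nabla ho (hs j) hu').cv (hs j))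
  simp only [D, c_coframe]
  refine Finset.sum_congr rfl fun i _ => ?_
  rw [← map_sum]
  congr 1
  rw [e, d.nabla_sum ho hx fun j _ => (d.smoothOn_nabla ho (hs j) hu').cv (hs j)]
  have h1 : ∀ j, d.nabla (fun y => d.cv (d.spin.frame α j y) (d.nabla u y (d.spin.frame α j y))) x
      (d.e x i x) = _ := fun j => d.nabla_cv ho hx (hs j) (d.smoothOn_nabla ho (hs j) hu') _
  rw [Finset.sum_congr rfl fun j _ => h1 j, Finset.sum_add_distrib]
  have h2 := d.sum_cv_lc (d.e x i x) (d.nabla u x)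
  refine (congrArg (· + _) h2).trans ?_
  simp only [covForm, map_sub, Finset.sum_sub_distrib]
  rw [neg_add_eq_sub]
  rfl

/-- The Lichnerowicz formula. -/
theorem D_D (hu : d.SmoothOn u Set.univ) (x : M) :
    d.D (d.D u) x = d.nablaStar (d.nabla u) x + d.Rcurv u x := by
  set α := d.spin.indexAt x
  have ho := d.spin.isOpen_baseSet α
  have hx : x ∈ d.spin.baseSet α := d.spin.mem_baseSet_at x
  have hs := d.spin.smooth_frame α
  have hu' := hu.mono (Set.subset_univ (d.spin.baseSet α))
  rw [d.D_D_eq hu, sum_cv_cv, ← nablaStar_eq]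
  congr 1
  -- The antisymmetric part of the second covariant derivative is the curvature, since vanishing
  -- torsion identifies the bracket with the difference of the two frame derivatives.
  have hc : ∀ i j, d.covForm (d.nabla u) (d.e x j) x (d.e x i x)
      - d.covForm (d.nabla u) (d.e x i) x (d.e x j x) =
      act (bivector d.spinor.gam fun k l =>
        inner ℝ (curvatureOp d.lc (d.e x i) (d.e x j) (d.e x k) x) (d.e x l x)) (u x)
      + d.twistCurv (d.e x i) (d.e x j) u x := by
    intro i j
    have hb : VectorField.mlieBracket I (d.e x i) (d.e x j) x =
      d.lc (d.e x j) x (d.e x i x) - d.lc (d.e x i) x (d.e x j x) :=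
      d.mlieBracket_eq ho hx (hs i) (hs j)
    have h : _ = act (bivector d.spinor.gam fun k l =>
        inner ℝ (curvatureOp d.lc (d.e x i) (d.e x j) (d.e x k) x) (d.e x l x)) (u x)
      + d.twistCurv (d.e x i) (d.e x j) u x := d.nabla_nabla_sub ho hx hu' (hs i) (hs j)
    rw [← h]
    change _ = d.nabla (fun y => d.nabla u y (d.e x j y)) x (d.e x i x)
      - d.nabla (fun y => d.nabla u y (d.e x i y)) x (d.e x j x)
      - d.nabla u x (VectorField.mlieBracket I (d.e x i) (d.e x j) x)
    rw [hb, map_sub, covForm, covForm]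
    abel
  simp only [hc, map_add, Finset.sum_add_distrib, Rcurv, RE, c_coframe]
  congr 1
  have hR := d.spinor.cliffRel_gam.sum_curvature (d.isCurvatureArray_frame hx)
  have h2 := congrArg (fun A => act A (u x)) hR
  simp only [map_sum, map_smul, LinearMap.sum_apply, LinearMap.smul_apply, act_one, act_mul] at h2
  refine Eq.trans (Finset.sum_congr rfl fun i _ => Finset.sum_congr rfl fun j _ => ?_) h2
  rw [cv_e, cv_e, cl_cl, act_mul]
  rfl

lemma D_add (hU : IsOpen U) (hx : x ∈ U) (hu : d.SmoothOn u U) (hv : d.SmoothOn v U) :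
    d.D (fun y => u y + v y) x = d.D u x + d.D v x := by
  simp only [D, c_coframe, d.nabla_add hU hx hu hv, map_add, Finset.sum_add_distrib]

lemma D_smul (hU : IsOpen U) (hx : x ∈ U) {f : M → ℝ} (hf : ContMDiffOn I 𝓘(ℝ, ℝ) ∞ f U)
    (hu : d.SmoothOn u U) :
    d.D (fun y => f y • u y) x = f x • d.D u x
      + ∑ i, mvfderiv I f x (d.e x i x) • d.cv (d.e x i x) (u x) := by
  simp only [D, c_coframe, d.nabla_smul hU hx hf hu, map_add, map_smul, Finset.sum_add_distrib,
    Finset.smul_sum]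

lemma D_sigL (hU : IsOpen U) (hx : x ∈ U) (hu : d.SmoothOn u U) :
    d.D (fun y => sigL (u y)) x = -sigL (d.D u x) := by
  simp only [D, c_coframe, d.nabla_sigL hU hx hu, map_sum, sigL_cv, Finset.sum_neg_distrib, neg_neg]

/-- In the square of D + ½ (tr k) σ the mixed terms cancel because D anticommutes with σ, except for
the derivative of tr k; σ² = 1 gives the last term. -/
lemma DT_DT_eq (hu : d.SmoothOn u Set.univ) (x : M) :
    d.DT (d.DT u) x = d.D (d.D u) x
      + (1 / 2 : ℝ) • ∑ i, mvfderiv I d.trK x (d.e x i x) • d.cv (d.e x i x) (sigL (u x))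
      + (d.trK x ^ 2 / 4) • u x := by
  have hx := Set.mem_univ x
  have hDu := d.smoothOn_D isOpen_univ hu
  have ht := d.smooth_trK.contMDiffOn (s := Set.univ)
  have hsu := (hu.sigL.const_smul (1 / 2 : ℝ)).smul ht
  have e : d.DT u = fun y => d.D u y + d.trK y • ((1 / 2 : ℝ) • sigL (u y)) := by
    funext y
    rw [DT_eq, sig_eq_sigL]
    module
  have e2 := d.D_smul isOpen_univ hx (f := fun _ => (1 / 2 : ℝ)) contMDiffOn_const hu.sigL
  simp only [mvfderiv_const, zero_apply, zero_smul, Finset.sum_const_zero, add_zero] at e2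
  rw [DT_eq, e, d.D_add isOpen_univ hx hDu hsu, d.D_smul isOpen_univ hx ht
    (hu.sigL.const_smul (1 / 2 : ℝ)), e2, d.D_sigL isOpen_univ hx hu, sig_eq_sigL, map_add,
    map_smul, map_smul, sigL_sigL]
  simp only [map_smul, Finset.smul_sum, smul_comm (1 / 2 : ℝ)]
  module

lemma smoothFormOn_cK (hu : d.SmoothOn u U) : d.SmoothFormOn (fun y => d.cK.flip (u y)) U :=
  fun α i => d.smooth_c_kForm ((d.spin.smooth_frame α i).mono Set.inter_subset_left)
    (hu.mono Set.inter_subset_right)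

lemma nablaStar_sub_smul (hU : IsOpen U) (hx : x ∈ U) (hΨ : d.SmoothFormOn Ψ U)
    (hΦ : d.SmoothFormOn Φ U) (r : ℝ) :
    d.nablaStar (fun y => Ψ y - r • Φ y) x = d.nablaStar Ψ x - r • d.nablaStar Φ x := by
  have hW := (d.spin.isOpen_baseSet (d.spin.indexAt x)).inter hU
  have hxW : x ∈ d.spin.baseSet (d.spin.indexAt x) ∩ U := ⟨d.spin.mem_baseSet_at x, hx⟩
  have hΨ' : ∀ i, d.SmoothOn (fun y => Ψ y (d.e x i y)) _ := hΨ (d.spin.indexAt x)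
  have hΦ' : ∀ i, d.SmoothOn (fun y => Φ y (d.e x i y)) _ := hΦ (d.spin.indexAt x)
  simp only [nablaStar, Finset.smul_sum, ← Finset.sum_sub_distrib]
  refine Finset.sum_congr rfl fun i _ => ?_
  have h1 : d.nabla (fun y => (Ψ y - r • Φ y) (d.e x i y)) x (d.e x i x) =
      d.nabla (fun y => Ψ y (d.e x i y)) x (d.e x i x)
      + (-r) • d.nabla (fun y => Φ y (d.e x i y)) x (d.e x i x) := by
    rw [← d.nabla_const_smul hW hxW (-r) (hΦ' i), ← d.nabla_add hW hxW (hΨ' i)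
      ((hΦ' i).const_smul (-r))]
    simp only [LinearMap.sub_apply, LinearMap.smul_apply, neg_smul, ← sub_eq_add_neg]
  rw [h1, LinearMap.sub_apply, LinearMap.smul_apply]
  module

/-- The Leibniz rule for v ↦ c(k(v, ·)) u: one part differentiates `u`, the other is Clifford
multiplication by the divergence of `k`. The derivatives of the frame are absorbed into the
covariant derivative of `k` by `sum_cv_lc`. -/
lemma nablaStar_cK (hU : IsOpen U) (hx : x ∈ U) (hu : d.SmoothOn u U) :
    d.nablaStar (fun y => d.cK.flip (u y)) x =
      -(∑ i, d.cK (d.e x i x) (d.nabla u x (d.e x i x))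
        + ∑ j, (∑ i, covTwoTensor d.lc d.k (d.e x i) (d.e x i) (d.e x j) x) •
          d.cv (d.e x j x) (u x)) := by
  set α := d.spin.indexAt x
  have hxα : x ∈ d.spin.baseSet α := d.spin.mem_baseSet_at x
  have hW := (d.spin.isOpen_baseSet α).inter hU
  have hxW : x ∈ d.spin.baseSet α ∩ U := ⟨hxα, hx⟩
  have hs : ∀ i, SmoothSectionOn I (EuclideanSpace ℝ (Fin n)) (d.e x i) (d.spin.baseSet α ∩ U) :=
    fun i => (d.spin.smooth_frame α i).mono (Set.inter_subset_left (t := U))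
  have hu' := hu.mono (Set.inter_subset_right (s := d.spin.baseSet α))
  have hk := fun i j => d.smooth_k_apply (hs i) (hs j)
  rw [nablaStar_eq]
  simp only [Finset.sum_smul]
  rw [Finset.sum_comm, ← Finset.sum_add_distrib]
  congr 1
  refine Finset.sum_congr rfl fun i _ => ?_
  have e1 : d.nabla (fun y => d.cK (d.e x i y) (u y)) x = d.nabla (fun y => ∑ j,
      d.k y (d.e x i y) (d.e x j y) • d.cv (d.e x j y) (u y)) x :=
    d.nabla_congr_on (fun y hy => d.cK_eq_sum hy.1 _ _) hW hxW
      (.sum fun j _ => (hu'.cv (hs j)).smul (hk i j))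
  have e2 : ∀ j, d.nabla (fun y => d.k y (d.e x i y) (d.e x j y) • d.cv (d.e x j y) (u y)) x
      (d.e x i x) = d.k x (d.e x i x) (d.e x j x) • (d.cv (d.lc (d.e x j) x (d.e x i x)) (u x)
        + d.cv (d.e x j x) (d.nabla u x (d.e x i x)))
      + mvfderiv I (fun y => d.k y (d.e x i y) (d.e x j y)) x (d.e x i x) •
        d.cv (d.e x j x) (u x) := by
    intro j
    rw [← d.nabla_cv hW hxW (hs j) hu']
    exact d.nabla_smul hW hxW (hk i j) (hu'.cv (hs j)) _
  have e3 := d.sum_cv_lc (d.e x i x)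
    ((LinearMap.toSpanSingleton ℝ _ (u x)).comp (d.kForm (d.e x i x)))
  simp only [LinearMap.comp_apply, LinearMap.toSpanSingleton_apply, map_smul] at e3
  rw [covForm]
  change d.nabla (fun y => d.cK (d.e x i y) (u y)) x (d.e x i x)
    - d.cK (d.lc (d.e x i) x (d.e x i x)) (u x) = _
  rw [e1, d.nabla_sum hW hxW fun j _ => (hu'.cv (hs j)).smul (hk i j),
    Finset.sum_congr rfl fun j _ => e2 j, d.cK_eq_sum hxα, d.cK_eq_sum hxα]
  simp only [smul_add, Finset.sum_add_distrib]
  have e3' : ∑ j, d.k x (d.e x i x) (d.e x j x) • d.cv (d.lc (d.e x j) x (d.e x i x)) (u x) =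
    -∑ j, d.k x (d.e x i x) (d.lc (d.e x j) x (d.e x i x)) • d.cv (d.e x j x) (u x) := e3
  rw [e3']
  simp only [covTwoTensor, sub_smul, Finset.sum_sub_distrib]
  change _ + ∑ j, d.k x (d.e x i x) (d.e x j x) • d.cv (d.e x j x) (d.nabla u x (d.e x i x)) + _
    - ∑ j, d.k x (d.lc (d.e x i) x (d.e x i x)) (d.e x j x) • d.cv (d.e x j x) (u x) =
    ∑ j, d.k x (d.e x i x) (d.e x j x) • d.cv (d.e x j x) (d.nabla u x (d.e x i x)) + _
  abel

/-- Each summand is the square of Clifford multiplication by the covector k(eᵢ, ·), which is minus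
its squared norm. -/
lemma sum_cK_cK (z : SFiber n V x) :
    ∑ i, d.cK (d.e x i x) (d.cK (d.e x i x) z) = -d.normSqK x • z := by
  rw [normSqK, ← Finset.sum_neg_distrib, Finset.sum_smul]
  refine Finset.sum_congr rfl fun i _ => ?_
  have h := d.spinor.cliffRel_gam.sum_symm
    (a := fun j l => d.k x (d.e x i x) (d.e x j x) * d.k x (d.e x i x) (d.e x l x))
      fun j l => mul_comm _ _
  have h2 := congrArg (fun A => act A z) h
  simp only [map_sum, map_smul, LinearMap.sum_apply, LinearMap.smul_apply, act_one] at h2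
  simp only [pow_two]
  rw [← h2, d.cK_eq_sum (d.spin.mem_baseSet_at x)]
  refine Finset.sum_congr rfl fun j _ => ?_
  rw [d.cK_eq_sum (d.spin.mem_baseSet_at x), map_sum, Finset.smul_sum]
  refine Finset.sum_congr rfl fun l _ => ?_
  change d.k x (d.e x i x) (d.e x j x) • d.cv (d.e x j x)
    (d.k x (d.e x i x) (d.e x l x) • d.cv (d.e x l x) z) = _
  rw [map_smul, cv_e, cv_e, cl_cl, smul_smul]

/-- The terms c(k(eᵢ, ·)) σ ∇_{eᵢ} u from ∇* and from its correction have opposite signs and cancel.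
The quadratic term is -¼ ∑ c(k(eᵢ, ·))², by the anticommutation of σ with Clifford multiplication.
-/
lemma nablaTStar_nablaT_eq (hu : d.SmoothOn u Set.univ) (x : M) :
    d.nablaTStar (d.nablaT u) x = d.nablaStar (d.nabla u) x
      + (1 / 2 : ℝ) • ∑ j, (∑ i, covTwoTensor d.lc d.k (d.e x i) (d.e x i) (d.e x j) x) •
          d.cv (d.e x j x) (sigL (u x))
      + (d.normSqK x / 4) • u x := by
  have hx := Set.mem_univ x
  have e : d.nablaT u = fun y => d.nabla u y - (1 / 2 : ℝ) • d.cK.flip (sigL (u y)) := rfl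
  have h1 : ∀ i, d.cK (d.e x i x) (sigL (d.nablaT u x (d.e x i x))) =
      d.cK (d.e x i x) (sigL (d.nabla u x (d.e x i x)))
      + (1 / 2 : ℝ) • d.cK (d.e x i x) (d.cK (d.e x i x) (u x)) := by
    intro i
    rw [nablaT_apply, map_sub, map_smul, sigL_c, sigL_sigL, ← cK_apply, map_sub, map_smul, map_neg]
    module
  rw [nablaTStar_eq, Finset.sum_congr rfl fun i _ => h1 i, e,
    d.nablaStar_sub_smul isOpen_univ hx (d.smoothFormOn_nabla isOpen_univ hu)
      (d.smoothFormOn_cK hu.sigL), d.nablaStar_cK isOpen_univ hx hu.sigL,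
    Finset.sum_add_distrib, ← Finset.smul_sum, sum_cK_cK]
  simp only [d.nabla_sigL isOpen_univ hx hu]
  module

/-- The Lichnerowicz formula for the modified Dirac operator. -/
theorem DT_DT (hu : d.SmoothOn u Set.univ) (x : M) :
    d.DT (d.DT u) x = d.nablaTStar (d.nablaT u) x + d.RcurvT u x := by
  -- Subtracting the two expansions leaves ¼ (R_g - |k|² + (tr k)²) = μ/2, the twisting curvature,
  -- and half the difference of d(tr k) and div k, which is -J/2.
  rw [d.DT_DT_eq hu, d.nablaTStar_nablaT_eq hu, d.D_D hu]
  simp only [Rcurv, RcurvT, muE, mu, J, c_coframe, sig_eq_sigL, sub_smul, Finset.sum_sub_distrib]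
  module

end

end SpinInitialData

/-! ### Coordinate vector fields -/

lemma det_gram_comp {n : ℕ} {W : Type*} [NormedAddCommGroup W] [InnerProductSpace ℝ W]
    (B : EuclideanSpace ℝ (Fin n) →ₗ[ℝ] W)
    (L : EuclideanSpace ℝ (Fin n) →ₗ[ℝ] EuclideanSpace ℝ (Fin n)) :
    (Matrix.of fun i j => (inner ℝ (B (L (EuclideanSpace.single i 1)))
      (B (L (EuclideanSpace.single j 1))) : ℝ)).det =
    L.det ^ 2 * (Matrix.of fun i j => (inner ℝ (B (EuclideanSpace.single i 1))
      (B (EuclideanSpace.single j 1)) : ℝ)).det := by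
  let b := (EuclideanSpace.basisFun (Fin n) ℝ).toBasis
  have hb : ∀ i, b i = EuclideanSpace.single i 1 := fun i => by simp [b]
  set J := LinearMap.toMatrix b b L with hJ
  have hL : ∀ i, L (EuclideanSpace.single i 1) = ∑ k, J k i • EuclideanSpace.single k (1 : ℝ) := by
    intro i
    conv_lhs => rw [← hb, ← b.sum_repr (L (b i))]
    simp only [hb, hJ, LinearMap.toMatrix_apply]
  have e : (Matrix.of fun i j => (inner ℝ (B (L (EuclideanSpace.single i 1)))
      (B (L (EuclideanSpace.single j 1))) : ℝ)) = Jᵀ * (Matrix.of fun i j =>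
        (inner ℝ (B (EuclideanSpace.single i 1)) (B (EuclideanSpace.single j 1)) : ℝ)) * J := by
    ext i j
    simp only [Matrix.of_apply, Matrix.mul_apply, Matrix.transpose_apply, hL, map_sum, map_smul,
      sum_inner, inner_sum, real_inner_smul_left, real_inner_smul_right, Finset.sum_mul]
    exact Finset.sum_congr rfl fun k _ => Finset.sum_congr rfl fun l _ => by ring
  rw [e, Matrix.det_mul, Matrix.det_mul, Matrix.det_transpose, hJ, LinearMap.det_toMatrix]
  ring

section CoordField

variable {n : ℕ} {H : Type*} [TopologicalSpace H]
  {I : ModelWithCorners ℝ (EuclideanSpace ℝ (Fin n)) H}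
  {M : Type*} [TopologicalSpace M] [ChartedSpace H M] [IsManifold I ∞ M]

variable (I) in
/-- The derivative at `p` of the inverse of the chart at `x`. -/
def chartDeriv (x p : M) : EuclideanSpace ℝ (Fin n) →L[ℝ] TangentSpace I p :=
  (mfderivWithin 𝓘(ℝ, EuclideanSpace ℝ (Fin n)) I (extChartAt I x).symm (Set.range I)
    (extChartAt I x p) : EuclideanSpace ℝ (Fin n) →L[ℝ] EuclideanSpace ℝ (Fin n))

variable (I) in
/-- The `i`-th coordinate vector field of the chart at `x`. -/
def coordField (x : M) (i : Fin n) (p : M) : TangentSpace I p :=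
  chartDeriv I x p (EuclideanSpace.single i 1)

variable {x x' p : M}

lemma chartDeriv_eq_symmL (hp : p ∈ (extChartAt I x).source) :
    chartDeriv I x p = (trivializationAt (EuclideanSpace ℝ (Fin n))
      (TangentSpace I : M → Type _) x).symmL ℝ p := by
  rw [extChartAt_source] at hp
  exact (TangentBundle.symmL_trivializationAt hp).symm

lemma coordField_eq_localFrame (hp : p ∈ (extChartAt I x).source) (i : Fin n) :
    coordField I x i p = (trivializationAt (EuclideanSpace ℝ (Fin n))
      (TangentSpace I : M → Type _) x).localFrame
        (EuclideanSpace.basisFun (Fin n) ℝ).toBasis i p := by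
  have hp' : p ∈ (trivializationAt (EuclideanSpace ℝ (Fin n))
      (TangentSpace I : M → Type _) x).baseSet := by
    rw [extChartAt_source] at hp
    exact hp
  rw [Trivialization.localFrame_apply_of_mem_baseSet _ _ hp', coordField, chartDeriv_eq_symmL hp]
  simp only [Trivialization.basisAt, Module.Basis.map_apply, OrthonormalBasis.coe_toBasis,
    EuclideanSpace.basisFun_apply]
  exact Trivialization.symmL_apply _ hp' _

lemma isLocalFrameOn_coordField (x : M) :
    IsLocalFrameOn I (EuclideanSpace ℝ (Fin n)) ∞ (coordField I x) (extChartAt I x).source := by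
  have h := (trivializationAt (EuclideanSpace ℝ (Fin n))
    (TangentSpace I : M → Type _) x).isLocalFrameOn_localFrame_baseSet I ∞
      (EuclideanSpace.basisFun (Fin n) ℝ).toBasis
  have hb : (extChartAt I x).source = (trivializationAt (EuclideanSpace ℝ (Fin n))
      (TangentSpace I : M → Type _) x).baseSet := extChartAt_source I x
  rw [← hb] at h
  exact h.congr fun i p hp => (coordField_eq_localFrame hp i).symm

lemma smooth_coordField (x : M) (i : Fin n) :
    SmoothSectionOn I (EuclideanSpace ℝ (Fin n)) (coordField I x i) (extChartAt I x).source :=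
  (isLocalFrameOn_coordField x).contMDiffOn i

/-- The components of a vector field with respect to the coordinate vector fields. -/
lemma exists_coord_components {X : Π x : M, TangentSpace I x} (x : M)
    (hX : SmoothSectionOn I (EuclideanSpace ℝ (Fin n)) X (extChartAt I x).source) :
    ∃ f : Fin n → M → ℝ, (∀ i, ContMDiffOn I 𝓘(ℝ, ℝ) ∞ (f i) (extChartAt I x).source) ∧
      (∀ p ∈ (extChartAt I x).source, X p = ∑ i, f i p • coordField I x i p) ∧
      ∀ i, ∀ p, X p = 0 → f i p = 0 := by
  set e := trivializationAt (EuclideanSpace ℝ (Fin n)) (TangentSpace I : M → Type _) x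
  set b := (EuclideanSpace.basisFun (Fin n) ℝ).toBasis
  have hb : (extChartAt I x).source = e.baseSet := extChartAt_source I x
  refine ⟨fun i p => e.localFrameCoeff I b i p (X p), fun i => ?_, fun p hp => ?_, fun i p h => ?_⟩
  · exact contMDiffOn_localFrameCoeff b (isOpen_extChartAt_source x) hb.subset hX i
  · have h := e.eq_sum_localFrameCoeff_smul (I := I) (b := b) (s := X) (hb ▸ hp)
    refine h.trans (Finset.sum_congr rfl fun i _ => ?_)
    rw [coordField_eq_localFrame hp]
  · simp only [h, map_zero]

/-- Coordinate fields are pullbacks of constant fields under the chart, and the bracket commutes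
with pullback. -/
lemma mlieBracket_coordField (hp : p ∈ (extChartAt I x).source) (i j : Fin n) :
    VectorField.mlieBracket I (coordField I x i) (coordField I x j) p = 0 := by
  have hc : ∀ i, coordField I x i =ᶠ[nhds p] VectorField.mpullback I
      𝓘(ℝ, EuclideanSpace ℝ (Fin n)) (extChartAt I x) (fun _ => EuclideanSpace.single i 1) := by
    intro i
    filter_upwards [(isOpen_extChartAt_source x).mem_nhds hp] with q hq
    have h1 := mfderiv_extChartAt_comp_mfderivWithin_extChartAt_symm' hq
    have h2 := mfderivWithin_extChartAt_symm_comp_mfderiv_extChartAt' hq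
    exact congr($(ContinuousLinearMap.inverse_eq h1 h2) (EuclideanSpace.single i 1)).symm
  have : IsManifold I (minSmoothness ℝ 2) M := by
    simp only [minSmoothness_of_isRCLikeNormedField]
    infer_instance
  have : IsManifold I (minSmoothness ℝ 3) M := by
    simp only [minSmoothness_of_isRCLikeNormedField]
    infer_instance
  rw [Filter.EventuallyEq.mlieBracket_vectorField_eq (hc i) (hc j)]
  have h := VectorField.mpullback_mlieBracket (I := I) (I' := 𝓘(ℝ, EuclideanSpace ℝ (Fin n)))
    (n := ∞) (f := extChartAt I x) (x₀ := p) (V := fun _ => EuclideanSpace.single i (1 : ℝ))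
    (W := fun _ => EuclideanSpace.single j (1 : ℝ)) ?_ ?_ ?_ ?_
  · rw [← h]
    have h0 : VectorField.mlieBracket 𝓘(ℝ, EuclideanSpace ℝ (Fin n))
        (fun _ => EuclideanSpace.single i (1 : ℝ)) (fun _ => EuclideanSpace.single j (1 : ℝ))
        (extChartAt I x p) = 0 :=
      (congrFun (VectorField.mlieBracketWithin_eq_lieBracketWithin (s := Set.univ)) _).trans
        (by simp [VectorField.lieBracketWithin]; rfl)
    exact (congrArg (mfderiv I 𝓘(ℝ, EuclideanSpace ℝ (Fin n)) (extChartAt I x) p).inverse h0).trans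
      (map_zero _)
  · exact ((contMDiff_vectorSpace_iff_contDiff (n := 1)).2 contDiff_const).mdifferentiable
      one_ne_zero _
  · exact ((contMDiff_vectorSpace_iff_contDiff (n := 1)).2 contDiff_const).mdifferentiable
      one_ne_zero _
  · exact contMDiffAt_extChartAt' (by rwa [extChartAt_source] at hp)
  · rw [minSmoothness_of_isRCLikeNormedField]
    exact WithTop.coe_le_coe.2 (le_top : (2 : ℕ∞) ≤ ⊤)

end CoordField

/-! ### The Riemannian volume in charts -/

section Volume

variable {n : ℕ} {H : Type*} [TopologicalSpace H]
  {I : ModelWithCorners ℝ (EuclideanSpace ℝ (Fin n)) H}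
  {M : Type*} [TopologicalSpace M] [ChartedSpace H M] [IsManifold I ∞ M]
  [RiemannianBundle (fun x : M => TangentSpace I x)]
  {x x' p : M}

lemma chartGram_apply (hp : p ∈ (extChartAt I x).source) :
    chartGram I M x (extChartAt I x p) =
      Matrix.of fun i j => (inner ℝ (coordField I x i p) (coordField I x j p) : ℝ) := by
  ext i j
  -- The fibre at the point recovered from the coordinates of `p` is the fibre at `p` only after
  -- rewriting, so the two inner products are identified by substitution.
  have key : ∀ (q : M) (_ : q = p) (v w : EuclideanSpace ℝ (Fin n)),
      @inner ℝ (TangentSpace I q) _ v w = @inner ℝ (TangentSpace I p) _ v w := by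
    rintro q rfl v w
    rfl
  exact key _ ((extChartAt I x).left_inv hp) (coordField I x i p) (coordField I x j p)

lemma det_chartGram (hp : p ∈ (extChartAt I x).source) (hp' : p ∈ (extChartAt I x').source) :
    (chartGram I M x (extChartAt I x p)).det =
      ((mfderiv I 𝓘(ℝ, EuclideanSpace ℝ (Fin n)) (extChartAt I x') p ∘L chartDeriv I x p :
        EuclideanSpace ℝ (Fin n) →L[ℝ] EuclideanSpace ℝ (Fin n)).det) ^ 2 *
      (chartGram I M x' (extChartAt I x' p)).det := by
  rw [chartGram_apply hp, chartGram_apply hp']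
  have h := det_gram_comp (chartDeriv I x' p).toLinearMap
    (mfderiv I 𝓘(ℝ, EuclideanSpace ℝ (Fin n)) (extChartAt I x') p ∘L chartDeriv I x p :
        EuclideanSpace ℝ (Fin n) →L[ℝ] EuclideanSpace ℝ (Fin n)).toLinearMap
  have hc := mfderivWithin_extChartAt_symm_comp_mfderiv_extChartAt' hp'
  have hc' : ∀ v : TangentSpace I p, chartDeriv I x' p
      (mfderiv I 𝓘(ℝ, EuclideanSpace ℝ (Fin n)) (extChartAt I x') p v) = v :=
    fun v => congr($hc v)
  refine Eq.trans ?_ h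
  congr 1
  ext i j
  simp only [Matrix.of_apply, coordField]
  congr 1
  · exact (hc' _).symm
  · exact (hc' _).symm

lemma measurableSet_extChartAt_target (x : M) : MeasurableSet (extChartAt I x).target := by
  rw [extChartAt_target]
  exact ((I.continuous_symm.isOpen_preimage _ (chartAt H x).open_target).measurableSet).inter
    I.isClosed_range.measurableSet

variable [MeasurableSpace M] [BorelSpace M]

lemma aemeasurable_extChartAt_symm (x : M) : AEMeasurable (extChartAt I x).symm
    ((volume : Measure (EuclideanSpace ℝ (Fin n))).restrict (extChartAt I x).target) :=
  (continuousOn_extChartAt_symm x).aemeasurable (measurableSet_extChartAt_target x)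

lemma chartVolume_apply (x : M) {A : Set M} (hA : MeasurableSet A) :
    chartVolume I M x A = ∫⁻ y in (extChartAt I x).symm ⁻¹' A ∩ (extChartAt I x).target,
      ENNReal.ofReal (Real.sqrt (chartGram I M x y).det) := by
  rw [chartVolume, Measure.map_apply_of_aemeasurable
    ((aemeasurable_extChartAt_symm x).mono_ac (withDensity_absolutelyContinuous _ _)) hA,
    withDensity_apply', Measure.restrict_restrict' (measurableSet_extChartAt_target x)]

lemma measurableSet_preimage_inter (x : M) {A : Set M} (hA : MeasurableSet A) :
    MeasurableSet ((extChartAt I x).symm ⁻¹' A ∩ (extChartAt I x).target) := by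
  have h : Measurable ((extChartAt I x).target.domRestrict (extChartAt I x).symm) :=
    (continuousOn_iff_continuous_domRestrict.1 (continuousOn_extChartAt_symm x)).measurable
  have h2 := (measurableSet_extChartAt_target x).subtype_image (h hA)
  convert h2 using 1
  ext y
  constructor
  · exact fun h => ⟨⟨y, h.2⟩, h.1, rfl⟩
  · rintro ⟨z, hz, rfl⟩
    exact ⟨hz, z.2⟩

/-- The chart volumes agree on overlaps. -/
lemma chartVolume_eq (x x' : M) {A : Set M} (hA : MeasurableSet A)
    (hx : A ⊆ (extChartAt I x).source) (hx' : A ⊆ (extChartAt I x').source) :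
    chartVolume I M x A = chartVolume I M x' A := by
  rw [chartVolume_apply x hA, chartVolume_apply x' hA]
  set B := (extChartAt I x).symm ⁻¹' A ∩ (extChartAt I x).target with hB
  set T : EuclideanSpace ℝ (Fin n) → EuclideanSpace ℝ (Fin n) :=
    extChartAt I x' ∘ (extChartAt I x).symm with hT
  have himg : T '' B = (extChartAt I x').symm ⁻¹' A ∩ (extChartAt I x').target := by
    ext z
    constructor
    · rintro ⟨y, ⟨hyA, hy⟩, rfl⟩
      refine ⟨?_, (extChartAt I x').map_source (hx' hyA)⟩
      simp only [hT, Set.mem_preimage, Function.comp_apply, (extChartAt I x').left_inv (hx' hyA)]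
      exact hyA
    · rintro ⟨hzA, hz⟩
      refine ⟨extChartAt I x ((extChartAt I x').symm z), ⟨?_, (extChartAt I x).map_source (hx hzA)⟩,
        ?_⟩
      · simp only [Set.mem_preimage, (extChartAt I x).left_inv (hx hzA)]
        exact hzA
      · simp only [hT, Function.comp_apply, (extChartAt I x).left_inv (hx hzA),
          (extChartAt I x').right_inv hz]
  have hinj : Set.InjOn T B := by
    intro y hy z hz h
    have h1 := (extChartAt I x').injOn (hx' hy.1) (hx' hz.1) h
    exact (extChartAt I x).symm.injOn hy.2 hz.2 h1
  let T' : EuclideanSpace ℝ (Fin n) → EuclideanSpace ℝ (Fin n) →L[ℝ] EuclideanSpace ℝ (Fin n) :=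
    fun y => mfderiv I 𝓘(ℝ, EuclideanSpace ℝ (Fin n)) (extChartAt I x') ((extChartAt I x).symm y) ∘L
      chartDeriv I x ((extChartAt I x).symm y)
  -- At boundary points the coordinate change need not be differentiable on a full neighbourhood;
  -- the change of variables formula only asks for a derivative within `B`.
  have hderiv : ∀ y ∈ B, HasFDerivWithinAt T (T' y) B y := by
    intro y hy
    have h1 : HasMFDerivWithinAt 𝓘(ℝ, EuclideanSpace ℝ (Fin n)) I (extChartAt I x).symm
        (Set.range I) y (chartDeriv I x ((extChartAt I x).symm y)) := by
      have := (mdifferentiableWithinAt_extChartAt_symm (I := I) hy.2).hasMFDerivWithinAt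
      convert this using 1
      rw [chartDeriv, (extChartAt I x).right_inv hy.2]
    have h2 : HasMFDerivAt I 𝓘(ℝ, EuclideanSpace ℝ (Fin n)) (extChartAt I x')
        ((extChartAt I x).symm y) _ :=
      (mdifferentiableAt_extChartAt (by
        rw [← extChartAt_source (I := I)]; exact hx' hy.1)).hasMFDerivAt
    have h3 := h2.comp_hasMFDerivWithinAt y h1
    exact (hasMFDerivWithinAt_iff_hasFDerivWithinAt.1 h3).mono
      (Set.inter_subset_right.trans (extChartAt_target_subset_range x))
  rw [← himg, lintegral_image_eq_lintegral_abs_det_fderiv_mul _ (measurableSet_preimage_inter x hA)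
    hderiv hinj]
  refine setLIntegral_congr_fun (measurableSet_preimage_inter x hA) fun y hy => ?_
  have h := det_chartGram (I := I) (hx hy.1) (hx' hy.1)
  rw [(extChartAt I x).right_inv hy.2] at h
  simp only [h]
  -- The Gram determinant picks up the square of the Jacobian determinant, whose root is the
  -- absolute value in the change of variables formula.
  rw [← ENNReal.ofReal_mul (abs_nonneg _), Real.sqrt_mul (sq_nonneg _), Real.sqrt_sq_eq_abs]
  rfl

lemma chartVolume_compl_source (x : M) : chartVolume I M x (extChartAt I x).sourceᶜ = 0 := by
  rw [chartVolume_apply x (isOpen_extChartAt_source x).measurableSet.compl]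
  have : (extChartAt I x).symm ⁻¹' (extChartAt I x).sourceᶜ ∩ (extChartAt I x).target = ∅ := by
    ext y
    simp only [Set.mem_inter_iff, Set.mem_preimage, Set.mem_compl_iff, Set.mem_empty_iff_false,
      iff_false, not_and]
    exact fun h hy => h ((extChartAt I x).map_target hy)
  rw [this]
  simp

lemma chartVolume_inter_source (x : M) (A : Set M) :
    chartVolume I M x (A ∩ (extChartAt I x).source) = chartVolume I M x A :=
  measure_inter_conull (chartVolume_compl_source x)

variable [SigmaCompactSpace M]

/-- The Riemannian volume is given by the chart volume on each chart domain. -/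
lemma riemannianVolume_eq (x : M) {A : Set M} (hA : MeasurableSet A)
    (hx : A ⊆ (extChartAt I x).source) : riemannianVolume I M A = chartVolume I M x A := by
  refine le_antisymm ?_ ((le_iSup (fun x => chartVolume I M x) x : _) A)
  obtain ⟨t, htc, ht⟩ := countable_cover_nhds_of_sigmaCompact
    fun x : M => (isOpen_extChartAt_source (I := I) x).mem_nhds (mem_extChartAt_source x)
  have hne : t.Nonempty := by
    by_contra h
    rw [Set.not_nonempty_iff_eq_empty] at h
    rw [h] at ht
    simp only [Set.mem_empty_iff_false, Set.iUnion_of_empty, Set.iUnion_empty] at ht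
    exact (ht.symm ▸ Set.mem_univ x : x ∈ (∅ : Set M))
  obtain ⟨f, hf⟩ := htc.exists_eq_range hne
  have hcov : ⋃ k, (extChartAt I (f k)).source = Set.univ := by
    rw [← ht, hf, Set.biUnion_range]
  set S := disjointed fun k => (extChartAt I (f k)).source with hS
  have hSm : ∀ k, MeasurableSet (S k) := fun k =>
    MeasurableSet.disjointed (fun k => (isOpen_extChartAt_source (f k)).measurableSet) k
  have hSd : Pairwise (Function.onFun Disjoint S) := disjoint_disjointed _
  have hSu : ⋃ k, S k = Set.univ := by rw [hS, iUnion_disjointed, hcov]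
  have hSs : ∀ k, S k ⊆ (extChartAt I (f k)).source := fun k => disjointed_subset _ k
  -- Chart volumes are glued over a countable partition of `M` into pieces of chart domains. As they
  -- agree on overlaps, ν equals each chart volume on its domain, so it dominates all of them and
  -- hence their supremum.
  set ν : Measure M := Measure.sum fun k => (chartVolume I M (f k)).restrict (S k) with hν
  have key : ∀ (z : M) (B : Set M), MeasurableSet B → B ⊆ (extChartAt I z).source →
      ν B = chartVolume I M z B := by
    intro z B hB hz
    rw [hν, Measure.sum_apply _ hB]
    have e1 : B = ⋃ k, B ∩ S k := by rw [← Set.inter_iUnion, hSu, Set.inter_univ]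
    conv_rhs => rw [e1]
    rw [measure_iUnion (fun i j hij => (hSd hij).mono Set.inter_subset_right
      Set.inter_subset_right) fun k => hB.inter (hSm k)]
    refine tsum_congr fun k => ?_
    rw [Measure.restrict_apply hB]
    exact chartVolume_eq _ _ (hB.inter (hSm k)) (Set.inter_subset_right.trans (hSs k))
      (Set.inter_subset_left.trans hz)
  have hle : riemannianVolume I M ≤ ν := by
    refine iSup_le fun z => Measure.le_iff.2 fun B hB => ?_
    rw [← chartVolume_inter_source, ← key z _
      (hB.inter (isOpen_extChartAt_source z).measurableSet) Set.inter_subset_right]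
    exact measure_mono Set.inter_subset_left
  exact (hle A).trans (key x A hA hx).le

lemma riemannianVolume_restrict (x : M) :
    (riemannianVolume I M).restrict (extChartAt I x).source = chartVolume I M x := by
  ext A hA
  rw [Measure.restrict_apply hA, riemannianVolume_eq x
    (hA.inter (isOpen_extChartAt_source x).measurableSet) Set.inter_subset_right,
    chartVolume_inter_source]

end Volume

namespace SpinInitialData

variable {n : ℕ} {H : Type*} [TopologicalSpace H]
  {I : ModelWithCorners ℝ (EuclideanSpace ℝ (Fin n)) H}
  {M : Type*} [TopologicalSpace M] [ChartedSpace H M] [IsManifold I ∞ M]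
  {F : Type*} [NormedAddCommGroup F] [NormedSpace ℂ F] [FiniteDimensional ℂ F]
  {V : M → Type*} [TopologicalSpace (TotalSpace F V)]
  [∀ x, NormedAddCommGroup (V x)] [∀ x, InnerProductSpace ℂ (V x)]
  [FiberBundle F V] [VectorBundle ℂ F V] [VectorBundle ℝ F V] [ContMDiffVectorBundle ∞ F V I]
  {κ : Type*} [RiemannianBundle (fun x : M => TangentSpace I x)]
  [IsContMDiffRiemannianBundle I ∞ (EuclideanSpace ℝ (Fin n)) (fun x : M => TangentSpace I x)]
  (d : SpinInitialData I M F V κ)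

section

/-! ### The volume density of a chart -/

variable {α : κ} {x p : M} {U : Set M} {X : Π x : M, TangentSpace I x}

/-- The derivative of the determinant along a direction in which `A' = C A`. -/
lemma mvfderiv_det (hU : IsOpen U) (hp : p ∈ U) {A : M → Matrix (Fin n) (Fin n) ℝ}
    (hA : ∀ i k, ContMDiffOn I 𝓘(ℝ, ℝ) ∞ (fun q => A q i k) U) (w : TangentSpace I p)
    {C : Matrix (Fin n) (Fin n) ℝ}
    (hC : ∀ i k, mvfderiv I (fun q => A q i k) p w = ∑ m, C i m * A p m k) :
    ContMDiffOn I 𝓘(ℝ, ℝ) ∞ (fun q => (A q).det) U ∧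
      mvfderiv I (fun q => (A q).det) p w = (∑ i, C i i) * (A p).det := by
  let Δ : ContinuousMultilinearMap ℝ (fun _ : Fin n => Fin n → ℝ) ℝ :=
    ⟨(Matrix.detRowAlternating (R := ℝ) (n := Fin n)).toMultilinearMap,
      (continuous_id.matrix_det : Continuous fun B : Matrix (Fin n) (Fin n) ℝ => B.det)⟩
  have hΔ : ∀ B : Matrix (Fin n) (Fin n) ℝ, Δ B = B.det := fun B => rfl
  let A' : M → Fin n → Fin n → ℝ := fun q => A q
  have hA' : ContMDiffOn I 𝓘(ℝ, Fin n → Fin n → ℝ) ∞ A' U :=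
    contMDiffOn_pi_space.2 fun i => contMDiffOn_pi_space.2 fun k => hA i k
  have hsm : ContMDiffOn I 𝓘(ℝ, ℝ) ∞ (fun q => (A q).det) U :=
    (Δ.contDiff.contMDiff.comp_contMDiffOn hA' :)
  refine ⟨hsm, ?_⟩
  have hd := hA'.mdifferentiableAt_of_isOpen hU hp
  have hcomp := ((Δ.hasFDerivAt (A' p)).hasMFDerivAt.comp p hd.hasMFDerivAt).mfderiv
  have e1 : mvfderiv I (fun q => (A q).det) p w =
      ∑ i, Δ (Function.update (A' p) i (mvfderiv I A' p w i)) := by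
    change (mfderiv I 𝓘(ℝ, ℝ) (Δ ∘ A') p) w = _
    rw [hcomp, ← ContinuousMultilinearMap.linearDeriv_apply]
    rfl
  have e2 : ∀ i, mvfderiv I A' p w i = ∑ m, C i m • A p m := by
    intro i
    ext k
    have h := mvfderiv_clm_comp ((ContinuousLinearMap.proj k : (Fin n → ℝ) →L[ℝ] ℝ).comp
      (ContinuousLinearMap.proj i : (Fin n → Fin n → ℝ) →L[ℝ] (Fin n → ℝ))) hd w
    refine h.symm.trans ((hC i k).trans ?_)
    simp [Finset.sum_apply]
  rw [e1, Finset.sum_mul]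
  refine Finset.sum_congr rfl fun i _ => ?_
  rw [e2]
  -- Replacing row i by a combination of all rows keeps only the multiple of row i, the others
  -- giving repeated rows.
  exact Matrix.det_updateRow_sum (A p) i (C i)

/-- The matrix of the coordinate vector fields with respect to an orthonormal frame. -/
def frameMat (α : κ) (x p : M) : Matrix (Fin n) (Fin n) ℝ :=
  Matrix.of fun i k => inner ℝ (d.spin.frame α i p) (coordField I x k p)

/-- The Gram matrix is AᵀA for the matrix A of the coordinate fields in an orthonormal frame. The
density is therefore |det A|, and no square root has to be differentiated. -/
lemma det_chartGram_eq_sq (hp : p ∈ (extChartAt I x).source) (hα : p ∈ d.spin.baseSet α) :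
    (chartGram I M x (extChartAt I x p)).det = (d.frameMat α x p).det ^ 2 := by
  rw [chartGram_apply hp, show (d.frameMat α x p).det ^ 2 =
    ((d.frameMat α x p)ᵀ * d.frameMat α x p).det by rw [Matrix.det_mul, Matrix.det_transpose, sq]]
  congr 1
  ext i j
  simp only [Matrix.of_apply, Matrix.mul_apply, Matrix.transpose_apply, frameMat]
  rw [d.inner_eq_sum hα]
  refine Finset.sum_congr rfl fun m _ => ?_
  rw [real_inner_comm, real_inner_comm (coordField I x j p)]

lemma det_frameMat_ne_zero (hp : p ∈ (extChartAt I x).source) (hα : p ∈ d.spin.baseSet α) :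
    (d.frameMat α x p).det ≠ 0 := by
  intro h
  obtain ⟨v, hv, h0⟩ := Matrix.exists_mulVec_eq_zero_iff.2 h
  apply hv
  have hli := (isLocalFrameOn_coordField (I := I) x).linearIndependent hp
  have hz : ∑ k, v k • coordField I x k p = 0 := by
    refine d.eq_of_inner_frame hα fun i => ?_
    have := congrFun h0 i
    simp only [Matrix.mulVec, dotProduct, frameMat, Matrix.of_apply, Pi.zero_apply] at this
    rw [inner_zero_left, ← this, sum_inner]
    refine Finset.sum_congr rfl fun k _ => ?_
    rw [real_inner_smul_left, real_inner_comm, mul_comm]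
  exact funext (Fintype.linearIndependent_iff.1 hli v hz)

/-- Coordinate fields commute and torsion vanishes, so ∇_{∂ⱼ} ∂ₖ = ∇_{∂ₖ} ∂ⱼ is linear in the value
of ∂ₖ. Hence A' = C A with C independent of k, and the trace of C is the divergence of ∂ⱼ because
the frame part is antisymmetric. -/
lemma mvfderiv_det_frameMat (hp : p ∈ (extChartAt I x).source) (hα : p ∈ d.spin.baseSet α)
    (j : Fin n) :
    ContMDiffOn I 𝓘(ℝ, ℝ) ∞ (fun q => (d.frameMat α x q).det)
      (d.spin.baseSet α ∩ (extChartAt I x).source) ∧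
    mvfderiv I (fun q => (d.frameMat α x q).det) p (coordField I x j p) =
      d.divX (coordField I x j) p * (d.frameMat α x p).det := by
  have hW : IsOpen (d.spin.baseSet α ∩ (extChartAt I x).source) :=
    (d.spin.isOpen_baseSet α).inter (isOpen_extChartAt_source x)
  have hpW : p ∈ d.spin.baseSet α ∩ (extChartAt I x).source := ⟨hα, hp⟩
  have hs := fun i => (d.spin.smooth_frame α i).mono
    (Set.inter_subset_left (t := (extChartAt I x).source))
  have hc := fun i => (smooth_coordField (I := I) x i).mono
    (Set.inter_subset_right (s := d.spin.baseSet α))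
  have h := mvfderiv_det hW hpW (A := d.frameMat α x)
    (fun i k => smooth_inner_tangent (hs i) (hc k)) (coordField I x j p)
    (C := Matrix.of fun i m =>
      (inner ℝ (d.lc (d.spin.frame α i) p (coordField I x j p)) (d.spin.frame α m p)
      + inner ℝ (d.spin.frame α i p) (d.lc (coordField I x j) p (d.spin.frame α m p)) : ℝ)) ?_
  · refine ⟨h.1, h.2.trans ?_⟩
    congr 1
    rw [d.divX_eq_frame hα]
    refine Finset.sum_congr rfl fun i _ => ?_
    simp only [Matrix.of_apply]
    have := d.antisymm_frame hα (coordField I x j p) i i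
    rw [real_inner_comm (d.lc (coordField I x j) p (d.spin.frame α i p))]
    linarith
  · intro i k
    have e := d.mvfderiv_inner hW hpW (hs i) (hc k) (coordField I x j p)
    refine e.trans ?_
    have hb : d.lc (coordField I x k) p (coordField I x j p) =
        d.lc (coordField I x j) p (coordField I x k p) := by
      have := d.mlieBracket_eq hW hpW (hc j) (hc k)
      rw [mlieBracket_coordField hp] at this
      exact sub_eq_zero.1 this.symm
    rw [hb]
    have hk := d.sum_inner_smul hα (coordField I x k p)
    conv_lhs => rw [← hk]
    simp only [map_sum, map_smul, inner_sum, real_inner_smul_right, Matrix.of_apply, frameMat,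
      add_mul, Finset.sum_add_distrib]
    congr 1 <;> exact Finset.sum_congr rfl fun m _ => mul_comm _ _

/-- The density of the Riemannian volume in the chart at `x`. -/
def density (I : ModelWithCorners ℝ (EuclideanSpace ℝ (Fin n)) H)
    [RiemannianBundle (fun x : M => TangentSpace I x)] (x p : M) : ℝ :=
  Real.sqrt (chartGram I M x (extChartAt I x p)).det

/-- The determinant is continuous and nonzero, so its sign `r` is constant near `p`. -/
lemma density_eventuallyEq (d : SpinInitialData I M F V κ) (hp : p ∈ (extChartAt I x).source) :
    ∃ (α : κ) (r : ℝ), p ∈ d.spin.baseSet α ∧ ∃ W, IsOpen W ∧ p ∈ W ∧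
      W ⊆ d.spin.baseSet α ∩ (extChartAt I x).source ∧
      ∀ q ∈ W, density I x q = r * (d.frameMat α x q).det := by
  set α := d.spin.indexAt p
  have hα : p ∈ d.spin.baseSet α := d.spin.mem_baseSet_at p
  have hW : IsOpen (d.spin.baseSet α ∩ (extChartAt I x).source) :=
    (d.spin.isOpen_baseSet α).inter (isOpen_extChartAt_source x)
  have hd : ∀ q ∈ d.spin.baseSet α ∩ (extChartAt I x).source,
      density I x q = |(d.frameMat α x q).det| := fun q hq => by
    rw [density, d.det_chartGram_eq_sq hq.2 hq.1, Real.sqrt_sq_eq_abs]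
  -- In dimension zero there is no coordinate index from which to take the smoothness statement, but
  -- the determinant of the empty matrix is 1.
  rcases Nat.eq_zero_or_pos n with hn | hn
  · subst hn
    exact ⟨α, 1, hα, _, hW, ⟨hα, hp⟩, subset_rfl, fun q hq => by rw [hd q hq]; simp⟩
  have hcont := (d.mvfderiv_det_frameMat hp hα ⟨0, hn⟩).1.continuousOn
  rcases (d.det_frameMat_ne_zero hp hα).lt_or_gt with h | h
  · refine ⟨α, -1, hα, _, hcont.isOpen_inter_preimage hW isOpen_Iio, ⟨⟨hα, hp⟩, h⟩,
      Set.inter_subset_left, fun q hq => ?_⟩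
    rw [hd q hq.1, abs_of_neg hq.2, neg_one_mul]
  · refine ⟨α, 1, hα, _, hcont.isOpen_inter_preimage hW isOpen_Ioi, ⟨⟨hα, hp⟩, h⟩,
      Set.inter_subset_left, fun q hq => ?_⟩
    rw [hd q hq.1, abs_of_pos hq.2, one_mul]

lemma smooth_density (d : SpinInitialData I M F V κ) (x : M) :
    ContMDiffOn I 𝓘(ℝ, ℝ) ∞ (density I x) (extChartAt I x).source := by
  intro p hp
  obtain ⟨α, r, hα, W, hW, hpW, hWs, h⟩ := d.density_eventuallyEq hp
  rcases Nat.eq_zero_or_pos n with hn | hn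
  · subst hn
    have h1 : ContMDiffOn I 𝓘(ℝ, ℝ) ∞ (fun _ : M => r) W := contMDiffOn_const
    exact ((h1.congr fun q hq => by rw [h q hq]; simp).contMDiffAt
      (hW.mem_nhds hpW)).contMDiffWithinAt
  have hs := (d.mvfderiv_det_frameMat hp hα ⟨0, hn⟩).1.mono hWs
  have h1 : ContMDiffOn I 𝓘(ℝ, ℝ) ∞ (fun q => r * (d.frameMat α x q).det) W :=
    (contMDiffOn_const (I' := 𝓘(ℝ, ℝ)) (c := r)).smul hs
  exact ((h1.congr h).contMDiffAt (hW.mem_nhds hpW)).contMDiffWithinAt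

lemma mvfderiv_density (hp : p ∈ (extChartAt I x).source) (j : Fin n) :
    mvfderiv I (density I x) p (coordField I x j p) =
      density I x p * d.divX (coordField I x j) p := by
  obtain ⟨α, r, hα, W, hW, hpW, hWs, h⟩ := d.density_eventuallyEq hp
  have hm := d.mvfderiv_det_frameMat hp hα j
  rw [mvfderiv_congr (Filter.mem_of_superset (hW.mem_nhds hpW) h), h p hpW,
    mvfderiv_fun_mul mdifferentiableAt_const
      ((hm.1.mono hWs).mdifferentiableAt_of_isOpen hW hpW), mvfderiv_const]
  simp only [smul_zero, add_zero]
  change r * mvfderiv I (fun q => (d.frameMat α x q).det) p (coordField I x j p) = _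
  rw [hm.2]
  ring

/-- The divergence in coordinates. -/
lemma density_mul_divX {f : Fin n → M → ℝ} (hp : p ∈ (extChartAt I x).source)
    (hf : ∀ i, ContMDiffOn I 𝓘(ℝ, ℝ) ∞ (f i) (extChartAt I x).source)
    (hX : ∀ q ∈ (extChartAt I x).source, X q = ∑ i, f i q • coordField I x i q) :
    density I x p * d.divX X p =
      ∑ j, mvfderiv I (fun q => density I x q * f j q) p (coordField I x j p) := by
  have ho := isOpen_extChartAt_source (I := I) x
  have hc := smooth_coordField (I := I) x
  rw [d.divX_congr_nhds (Filter.mem_of_superset (ho.mem_nhds hp) hX) ho hp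
    (.sum fun i _ => (hc i).smul (hf i)), d.divX_sum ho hp fun i _ => (hc i).smul (hf i),
    Finset.mul_sum]
  refine Finset.sum_congr rfl fun j _ => ?_
  rw [d.divX_smul ho hp (hf j) (hc j), mvfderiv_fun_mul
    ((d.smooth_density x).mdifferentiableAt_of_isOpen ho hp)
    ((hf j).mdifferentiableAt_of_isOpen ho hp)]
  change _ = density I x p * mvfderiv I (f j) p (coordField I x j p)
    + f j p * mvfderiv I (density I x) p (coordField I x j p)
  rw [d.mvfderiv_density hp]
  ring

end

section

/-! ### The divergence theorem -/

/-- The integral of a derivative of a compactly supported function vanishes. -/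
lemma integral_fderiv_eq_zero_of_hasCompactSupport {E : Type*} [NormedAddCommGroup E]
    [NormedSpace ℝ E] [FiniteDimensional ℝ E] [MeasurableSpace E] [BorelSpace E] (μ : Measure E)
    [μ.IsAddHaarMeasure] {h : E → ℝ} (hh : ContDiff ℝ 1 h) (hc : HasCompactSupport h) (v : E) :
    Integrable (fun y => fderiv ℝ h y v) μ ∧ ∫ y, fderiv ℝ h y v ∂μ = 0 := by
  have hi : Integrable (fun y => fderiv ℝ h y v) μ :=
    ((hh.continuous_fderiv one_ne_zero).clm_apply continuous_const).integrable_of_hasCompactSupport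
      (hc.fderiv_apply (𝕜 := ℝ) v)
  refine ⟨hi, ?_⟩
  -- Integration by parts against the constant function 1.
  have := integral_mul_fderiv_eq_neg_fderiv_mul_of_integrable (μ := μ) (f := fun _ : E => (1 : ℝ))
    (g := h) (v := v) (by simp) (by simpa using hi)
    (by simpa using hh.continuous.integrable_of_hasCompactSupport hc)
    (fun _ _ => differentiableAt_const _) (fun y _ => (hh.differentiable one_ne_zero) y)
  simpa using this

variable {x p : M} {U K : Set M} {X : Π x : M, TangentSpace I x}

lemma divX_eq_zero_of_notMem (hK : IsClosed K) (h0 : ∀ y ∉ K, X y = 0) (hx : x ∉ K) :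
    d.divX X x = 0 := by
  have h : d.lc X x = 0 :=
    (d.lc.congr_nhds (U := Kᶜ) (Filter.mem_of_superset (hK.isOpen_compl.mem_nhds hx)
      fun y hy => h0 y hy) hK.isOpen_compl hx .zero).trans d.lc.fun_zero
  simp [divX, h]

variable [T2Space M] [SigmaCompactSpace M] [MeasurableSpace M] [BorelSpace M]

lemma isLocallyFiniteMeasure_riemannianVolume (d : SpinInitialData I M F V κ) :
    IsLocallyFiniteMeasure (riemannianVolume I M) := by
  refine ⟨fun p => ?_⟩
  have hp := mem_extChartAt_source (I := I) p
  have ho := isOpen_extChartAt_source (I := I) p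
  -- On `N` the density is bounded by its value at `p` plus 1, and the coordinates stay in a unit
  -- ball; so `N` has finite volume.
  set N := ((extChartAt I p).source ∩ density I p ⁻¹' Set.Iio (density I p p + 1)) ∩
    ((extChartAt I p).source ∩ extChartAt I p ⁻¹' Metric.ball (extChartAt I p p) 1) with hN
  have hNo : IsOpen N :=
    ((d.smooth_density p).continuousOn.isOpen_inter_preimage ho isOpen_Iio).inter
      ((continuousOn_extChartAt p).isOpen_inter_preimage ho Metric.isOpen_ball)
  refine ⟨N, hNo.mem_nhds ⟨⟨hp, by simp⟩, hp, by simp⟩, ?_⟩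
  rw [riemannianVolume_eq p hNo.measurableSet fun q hq => hq.1.1,
    chartVolume_apply p hNo.measurableSet]
  calc _ ≤ ∫⁻ y in (extChartAt I p).symm ⁻¹' N ∩ (extChartAt I p).target,
        ENNReal.ofReal (density I p p + 1) := by
        refine setLIntegral_mono' (measurableSet_preimage_inter p hNo.measurableSet) fun y hy => ?_
        refine ENNReal.ofReal_le_ofReal ?_
        have : density I p ((extChartAt I p).symm y) < density I p p + 1 := hy.1.1.2
        rw [density, (extChartAt I p).right_inv hy.2] at this
        exact this.le
    _ ≤ ENNReal.ofReal (density I p p + 1) * volume (Metric.ball (extChartAt I p p) 1) := by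
        rw [setLIntegral_const]
        gcongr
        intro y hy
        have := hy.1.2.2
        rwa [Set.mem_preimage, (extChartAt I p).right_inv hy.2] at this
    _ < ⊤ := ENNReal.mul_lt_top ENNReal.ofReal_lt_top Metric.isBounded_ball.measure_lt_top

lemma integrable_of_continuousOn (d : SpinInitialData I M F V κ) {E : Type*}
    [NormedAddCommGroup E] {f : M → E} (hK : IsCompact K)
    (hf : ContinuousOn f K) (h0 : ∀ x ∉ K, f x = 0) :
    Integrable f (riemannianVolume I M) := by
  have := d.isLocallyFiniteMeasure_riemannianVolume
  refine (integrableOn_iff_integrable_of_support_subset fun x hx => ?_).1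
    (hf.integrableOn_compact hK)
  by_contra h
  exact hx (h0 x h)

lemma integral_eq_chart (d : SpinInitialData I M F V κ) {f : M → ℝ}
    (hf : Integrable f (riemannianVolume I M)) (h0 : ∀ p ∉ (extChartAt I x).source, f p = 0) :
    ∫ p, f p ∂(riemannianVolume I M) = ∫ y in (extChartAt I x).target,
      density I x ((extChartAt I x).symm y) * f ((extChartAt I x).symm y) := by
  have hm : AEStronglyMeasurable f (chartVolume I M x) := by
    rw [← riemannianVolume_restrict x]
    exact hf.aestronglyMeasurable.restrict
  have hT := measurableSet_extChartAt_target (I := I) x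
  have hd : ∀ y ∈ (extChartAt I x).target, Real.sqrt (chartGram I M x y).det =
      density I x ((extChartAt I x).symm y) := fun y hy => by
    rw [density, (extChartAt I x).right_inv hy]
  have hdm : AEMeasurable (fun y => Real.sqrt (chartGram I M x y).det)
      ((volume : Measure (EuclideanSpace ℝ (Fin n))).restrict (extChartAt I x).target) := by
    refine (((d.smooth_density x).continuousOn.comp (continuousOn_extChartAt_symm x)
      (extChartAt I x).mapsTo_symm).congr fun y hy => ?_).aemeasurable hT
    exact hd y hy
  rw [← setIntegral_eq_integral_of_forall_compl_eq_zero h0, riemannianVolume_restrict x]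
  rw [chartVolume] at hm ⊢
  rw [integral_map ((aemeasurable_extChartAt_symm x).mono_ac
    (withDensity_absolutelyContinuous _ _)) hm,
    integral_withDensity_eq_integral_toReal_smul₀ hdm.ennreal_ofReal (by simp)]
  refine setIntegral_congr_fun hT fun y hy => ?_
  rw [ENNReal.toReal_ofReal (Real.sqrt_nonneg _), hd y hy, smul_eq_mul]

lemma fderiv_comp_extChartAt_symm {g : M → ℝ} {y : EuclideanSpace ℝ (Fin n)}
    (hy : y ∈ interior (extChartAt I x).target)
    (hg : MDifferentiableAt I 𝓘(ℝ, ℝ) g ((extChartAt I x).symm y)) (v : EuclideanSpace ℝ (Fin n)) :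
    fderiv ℝ (g ∘ (extChartAt I x).symm) y v =
      mvfderiv I g ((extChartAt I x).symm y) (chartDeriv I x ((extChartAt I x).symm y) v) := by
  have hyt := interior_subset hy
  have h1 : HasMFDerivAt 𝓘(ℝ, EuclideanSpace ℝ (Fin n)) I (extChartAt I x).symm
      y (chartDeriv I x ((extChartAt I x).symm y)) := by
    have := (mdifferentiableWithinAt_extChartAt_symm (I := I) hyt).hasMFDerivWithinAt
    have h2 := this.hasMFDerivAt (Filter.mem_of_superset (mem_interior_iff_mem_nhds.1 hy)
      (extChartAt_target_subset_range x))
    convert h2 using 1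
    rw [chartDeriv, (extChartAt I x).right_inv hyt]
  have h3 := hg.hasMFDerivAt.comp y h1
  let T : EuclideanSpace ℝ (Fin n) →L[ℝ] ℝ :=
    mfderiv I 𝓘(ℝ, ℝ) g ((extChartAt I x).symm y) ∘L chartDeriv I x ((extChartAt I x).symm y)
  have h4 : HasFDerivAt (g ∘ (extChartAt I x).symm) T y := hasMFDerivAt_iff_hasFDerivAt.1 h3
  rw [h4.fderiv]
  rfl

/-- The divergence theorem for vector fields supported in the interior of a chart domain. -/
lemma integral_divX_of_chart (hX : SmoothSectionOn I (EuclideanSpace ℝ (Fin n)) X Set.univ)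
    (hK : IsCompact K) (hKx : K ⊆ (extChartAt I x).source ∩
      extChartAt I x ⁻¹' interior (extChartAt I x).target) (h0 : ∀ y ∉ K, X y = 0) :
    ∫ p, d.divX X p ∂(riemannianVolume I M) = 0 := by
  have hs := isOpen_extChartAt_source (I := I) x
  have hdiv := (d.smooth_divX isOpen_univ hX).continuousOn
  have hdiv0 : ∀ p ∉ K, d.divX X p = 0 := fun p hp =>
    d.divX_eq_zero_of_notMem hK.isClosed h0 hp
  obtain ⟨f, hf, hfX, hf0⟩ := exists_coord_components x (hX.mono (Set.subset_univ _))
  set O := interior (extChartAt I x).target with hO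
  have hOt : O ⊆ (extChartAt I x).target := interior_subset
  set L := extChartAt I x '' K with hL
  have hLc : IsCompact L := hK.image_of_continuousOn ((continuousOn_extChartAt x).mono
    fun p hp => (hKx hp).1)
  have hLO : L ⊆ O := by
    rintro _ ⟨p, hp, rfl⟩
    exact (hKx hp).2
  have hLK : ∀ y ∈ (extChartAt I x).target, y ∉ L → (extChartAt I x).symm y ∉ K :=
    fun y hy hyL h => hyL ⟨_, h, (extChartAt I x).right_inv hy⟩
  have hgs : ∀ j, ContMDiffOn I 𝓘(ℝ, ℝ) ∞ (fun q => density I x q * f j q)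
      (extChartAt I x).source := fun j => (d.smooth_density x).smul (hf j)
  let g : Fin n → EuclideanSpace ℝ (Fin n) → ℝ := fun j =>
    (fun q => density I x q * f j q) ∘ (extChartAt I x).symm
  -- The density times the j-th component, extended by zero to the whole space. It is smooth because
  -- it vanishes off the compact set `L`, which lies in the open set `O`; here it is used that `K`
  -- avoids the boundary.
  let h : Fin n → EuclideanSpace ℝ (Fin n) → ℝ := fun j => O.indicator (g j)
  have hh0 : ∀ j, ∀ y ∉ L, h j y = 0 := by
    intro j y hy
    by_cases hyO : y ∈ O
    · have : f j ((extChartAt I x).symm y) = 0 := hf0 _ _ (h0 _ (hLK y (hOt hyO) hy))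
      simp only [h, g, Set.indicator_of_mem hyO, Function.comp_apply, this, mul_zero]
    · exact Set.indicator_of_notMem hyO _
  have hhg : ∀ j, ∀ y ∈ O, h j =ᶠ[nhds y] g j := fun j y hy =>
    Filter.mem_of_superset (isOpen_interior.mem_nhds hy) fun z hz => Set.indicator_of_mem hz _
  have hh0' : ∀ j, ∀ y ∉ L, h j =ᶠ[nhds y] fun _ => 0 := fun j y hy =>
    Filter.mem_of_superset (hLc.isClosed.isOpen_compl.mem_nhds hy) fun z hz => hh0 j z hz
  have hgc : ∀ j, ContDiffOn ℝ ∞ (g j) O := fun j => contMDiffOn_iff_contDiffOn.1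
    (((hgs j).comp (contMDiffOn_extChartAt_symm x) (extChartAt I x).mapsTo_symm).mono hOt)
  have hhc : ∀ j, ContDiff ℝ 1 (h j) := by
    intro j
    refine ContDiff.of_le (n := ∞) (contDiff_iff_contDiffAt.2 fun y => ?_)
      (WithTop.coe_le_coe.2 le_top)
    by_cases hy : y ∈ L
    · exact ((hgc j).contDiffAt (isOpen_interior.mem_nhds (hLO hy))).congr_of_eventuallyEq
        (hhg j y (hLO hy))
    · exact contDiffAt_const.congr_of_eventuallyEq (hh0' j y hy)
  have hint := fun j => integral_fderiv_eq_zero_of_hasCompactSupport volume (hhc j)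
    (HasCompactSupport.intro hLc (hh0 j)) (EuclideanSpace.single j 1)
  have hfd0 : ∀ j, ∀ y ∉ L, fderiv ℝ (h j) y (EuclideanSpace.single j 1) = 0 := by
    intro j y hy
    rw [(hh0' j y hy).fderiv_eq]
    simp
  rw [d.integral_eq_chart (x := x) (d.integrable_of_continuousOn hK
    (hdiv.mono (Set.subset_univ _)) hdiv0) fun p hp => hdiv0 p fun h => hp (hKx h).1]
  have e1 : ∀ y ∈ (extChartAt I x).target,
      density I x ((extChartAt I x).symm y) * d.divX X ((extChartAt I x).symm y) =
      ∑ j, fderiv ℝ (h j) y (EuclideanSpace.single j 1) := by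
    intro y hy
    by_cases hyO : y ∈ O
    · rw [d.density_mul_divX ((extChartAt I x).map_target hy) hf hfX]
      refine Finset.sum_congr rfl fun j _ => ?_
      rw [(hhg j y hyO).fderiv_eq]
      exact (fderiv_comp_extChartAt_symm hyO ((hgs j).mdifferentiableAt_of_isOpen hs
        ((extChartAt I x).map_target hy)) _).symm
    · have hyL : y ∉ L := fun h => hyO (hLO h)
      rw [hdiv0 _ (hLK y hy hyL), mul_zero, Finset.sum_eq_zero fun j _ => hfd0 j y hyL]
  rw [setIntegral_congr_fun (measurableSet_extChartAt_target x) e1,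
    setIntegral_eq_integral_of_forall_compl_eq_zero fun y hy =>
      Finset.sum_eq_zero fun j _ => hfd0 j y fun h => hy (hOt (hLO h)),
    integral_finsetSum _ fun j _ => (hint j).1, Finset.sum_eq_zero fun j _ => (hint j).2]

/-- The divergence theorem for vector fields with compact support in the interior. -/
lemma integral_divX (hX : SmoothSectionOn I (EuclideanSpace ℝ (Fin n)) X Set.univ)
    (hK : IsCompact K) (hKI : K ⊆ I.interior M) (h0 : ∀ y ∉ K, X y = 0) :
    Integrable (d.divX X) (riemannianVolume I M) ∧
      ∫ p, d.divX X p ∂(riemannianVolume I M) = 0 := by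
  have hint : ∀ Y : Π x : M, TangentSpace I x,
      SmoothSectionOn I (EuclideanSpace ℝ (Fin n)) Y Set.univ → (∀ y ∉ K, Y y = 0) →
      Integrable (d.divX Y) (riemannianVolume I M) := fun Y hY hY0 =>
    d.integrable_of_continuousOn hK
      ((d.smooth_divX isOpen_univ hY).continuousOn.mono (Set.subset_univ _)) fun p hp =>
        d.divX_eq_zero_of_notMem hK.isClosed hY0 hp
  refine ⟨hint X hX h0, ?_⟩
  -- Each fᵢ X is supported in the interior part of one chart domain. Only the additivity of the
  -- divergence is needed to sum up, so the derivatives of the fᵢ never enter.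
  obtain ⟨f, hf⟩ := SmoothPartitionOfUnity.exists_isSubordinate I hK.isClosed
    (fun x : M => (extChartAt I x).source ∩ extChartAt I x ⁻¹' interior (extChartAt I x).target)
    (fun x => (continuousOn_extChartAt x).isOpen_inter_preimage (isOpen_extChartAt_source x)
      isOpen_interior)
    (fun x hx => Set.mem_iUnion.2 ⟨x, mem_extChartAt_source x,
      I.isInteriorPoint_iff.1 (hKI hx)⟩)
  have hfin := f.locallyFinite.finite_nonempty_inter_compact hK
  set S := hfin.toFinset
  have hsum : ∀ y, X y = ∑ i ∈ S, f i y • X y := by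
    intro y
    by_cases hy : y ∈ K
    · rw [← Finset.sum_smul]
      have h1 := f.sum_eq_one hy
      rw [finsum_eq_sum_of_support_subset (s := S) _ fun i hi => by
        simpa [S] using ⟨y, hi, hy⟩] at h1
      rw [h1, one_smul]
    · simp [h0 y hy]
  have hsm : ∀ i, SmoothSectionOn I (EuclideanSpace ℝ (Fin n)) (fun y => f i y • X y)
      Set.univ := fun i => hX.smul (f i).contMDiff.contMDiffOn
  have hz : ∀ i, ∀ y ∉ K, f i y • X y = 0 := fun i y hy => by rw [h0 y hy, smul_zero]
  have hX' : d.divX X = fun p => ∑ i ∈ S, d.divX (fun y => f i y • X y) p := by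
    funext p
    rw [← d.divX_sum isOpen_univ (Set.mem_univ p) fun i _ => hsm i]
    congr 1
    exact funext hsum
  rw [hX', integral_finsetSum _ fun i _ => hint _ (hsm i) (hz i)]
  refine Finset.sum_eq_zero fun i _ => ?_
  refine d.integral_divX_of_chart (x := i) (K := K ∩ tsupport (f i)) (hsm i)
    (hK.inter_right (isClosed_tsupport _)) (fun y hy => hf i hy.2) fun y hy => ?_
  by_cases hyK : y ∈ K
  · rw [image_eq_zero_of_notMem_tsupport fun h => hy ⟨hyK, h⟩, zero_smul]
  · exact hz i y hyK

end

section

/-! ### Formal adjoints -/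

variable {α : κ} {x : M} {U K : Set M} {X : Π x : M, TangentSpace I x}
  {u v : Π x : M, SFiber n V x} {Φ Ψ : Π x : M, TangentSpace I x →ₗ[ℝ] SFiber n V x}

lemma herm_zero_left (z : SFiber n V x) : herm 0 z = 0 := by
  rw [herm_eq_hermL, map_zero, LinearMap.zero_apply]

lemma herm_zero_right (z : SFiber n V x) : herm z 0 = 0 := by
  rw [herm_eq_hermL, map_zero]

lemma contMDiffOn_hermForm (hU : IsOpen U) (hΦ : d.SmoothFormOn Φ U) (hΨ : d.SmoothFormOn Ψ U) :
    ContMDiffOn I 𝓘(ℝ, ℂ) ∞ (fun y => d.hermForm (Φ y) (Ψ y)) U := by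
  intro x hx
  set α := d.spin.indexAt x
  have hW := (d.spin.isOpen_baseSet α).inter hU
  have h : ContMDiffOn I 𝓘(ℝ, ℂ) ∞ (fun y => d.hermForm (Φ y) (Ψ y)) (d.spin.baseSet α ∩ U) :=
    (ContMDiffOn.finset_sum_fun (S := Finset.univ) fun i _ =>
      d.contMDiffOn_herm hW (hΦ α i) (hΨ α i)).congr fun y hy => d.hermForm_eq_frame hy.1 _ _
  exact (h.contMDiffAt (hW.mem_nhds ⟨d.spin.mem_baseSet_at x, hx⟩)).contMDiffWithinAt

/-- The divergence of the vector field dual to `⟨u, Ψ⟩`. -/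
lemma divX_sharp_herm (hU : IsOpen U) (hu : d.SmoothOn u U) (hΨ : d.SmoothFormOn Ψ U)
    (L : ℂ →L[ℝ] ℝ) :
    SmoothSectionOn I (EuclideanSpace ℝ (Fin n))
      (d.sharp fun y => L.toLinearMap ∘ₗ hermL (u y) ∘ₗ Ψ y) U ∧
    ∀ x ∈ U, d.divX (d.sharp fun y => L.toLinearMap ∘ₗ hermL (u y) ∘ₗ Ψ y) x =
      L (d.hermForm (d.nabla u x) (Ψ x) - herm (u x) (d.nablaStar Ψ x)) := by
  have hh : ∀ α i, ContMDiffOn I 𝓘(ℝ, ℂ) ∞ (fun y => herm (u y) (Ψ y (d.spin.frame α i y)))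
      (d.spin.baseSet α ∩ U) := fun α i =>
    d.contMDiffOn_herm ((d.spin.isOpen_baseSet α).inter hU) (hu.mono Set.inter_subset_right)
      (hΨ α i)
  have hθ : ∀ α i, ContMDiffOn I 𝓘(ℝ, ℝ) ∞ (fun y =>
      (L.toLinearMap ∘ₗ hermL (u y) ∘ₗ Ψ y) (d.spin.frame α i y)) (d.spin.baseSet α ∩ U) :=
    fun α i => (L.contMDiff.comp_contMDiffOn (hh α i) :)
  refine ⟨d.smooth_sharp hθ, fun x hx => ?_⟩
  set α := d.spin.indexAt x
  have hW := (d.spin.isOpen_baseSet α).inter hU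
  have hxW : x ∈ d.spin.baseSet α ∩ U := ⟨d.spin.mem_baseSet_at x, hx⟩
  rw [d.divX_sharp hU hx hθ, nablaStar_eq, hermForm]
  simp only [herm_eq_hermL, map_neg, map_sum, sub_neg_eq_add, ← Finset.sum_add_distrib, covForm,
    map_sub]
  refine Finset.sum_congr rfl fun i _ => ?_
  have e1 := mvfderiv_clm_comp L ((hh α i).mdifferentiableAt_of_isOpen hW hxW) (d.e x i x)
  rw [d.mvfderiv_herm_nabla hW hxW (hu.mono Set.inter_subset_right) (hΨ α i)] at e1
  change mvfderiv I (fun y => L (herm (u y) (Ψ y (d.spin.frame α i y)))) x (d.e x i x) - _ = _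
  rw [e1]
  simp only [map_add, herm_eq_hermL, LinearMap.comp_apply]
  change _ + L (hermL (u x) (d.nabla (fun y => Ψ y (d.e x i y)) x (d.e x i x)))
    - L (hermL (u x) (Ψ x (d.lc (d.e x i) x (d.e x i x)))) = _
  rw [map_sub]
  exact add_sub_assoc _ _ _

lemma nablaStar_eq_zero_of_notMem (hK : IsClosed K) (h0 : ∀ y ∉ K, Ψ y = 0) (hx : x ∉ K) :
    d.nablaStar Ψ x = 0 := by
  refine Finset.sum_eq_zero fun i _ => ?_
  rw [d.nabla_eq_zero_of_notMem hK (fun y hy => by rw [h0 y hy, LinearMap.zero_apply]) hx,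
    h0 x hx, LinearMap.zero_apply, neg_zero, add_zero]

variable [T2Space M] [SigmaCompactSpace M] [MeasurableSpace M] [BorelSpace M]

lemma integrable_herm (hU : IsOpen U) (hu : d.SmoothOn u U) (hv : d.SmoothOn v U)
    (hK : IsCompact K) (hKU : K ⊆ U) (h0 : ∀ x ∉ K, herm (u x) (v x) = 0) :
    Integrable (fun x => herm (u x) (v x)) (riemannianVolume I M) :=
  d.integrable_of_continuousOn hK ((d.contMDiffOn_herm hU hu hv).continuousOn.mono hKU) h0

/-- Integration by parts for the connection of `S`. -/
lemma integral_hermForm_nabla (hU : IsOpen U) (hu : d.SmoothOn u U) (hΨ : d.SmoothFormOn Ψ U)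
    (hK : IsCompact K) (hKU : K ⊆ U ∩ I.interior M)
    (h0 : (∀ x ∉ K, u x = 0) ∨ (∀ x ∉ K, Ψ x = 0)) :
    Integrable (fun x => d.hermForm (d.nabla u x) (Ψ x)) (riemannianVolume I M) ∧
    Integrable (fun x => herm (u x) (d.nablaStar Ψ x)) (riemannianVolume I M) ∧
    ∫ x, d.hermForm (d.nabla u x) (Ψ x) ∂(riemannianVolume I M) =
      ∫ x, herm (u x) (d.nablaStar Ψ x) ∂(riemannianVolume I M) := by
  have hKU' : K ⊆ U := fun x hx => (hKU hx).1
  have hz1 : ∀ x ∉ K, d.hermForm (d.nabla u x) (Ψ x) = 0 := by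
    intro x hx
    refine Finset.sum_eq_zero fun i _ => ?_
    rcases h0 with h | h
    · rw [d.nabla_eq_zero_of_notMem hK.isClosed h hx, herm_zero_left]
    · rw [h x hx, LinearMap.zero_apply, herm_zero_right]
  have hz2 : ∀ x ∉ K, herm (u x) (d.nablaStar Ψ x) = 0 := by
    intro x hx
    rcases h0 with h | h
    · rw [h x hx, herm_zero_left]
    · rw [d.nablaStar_eq_zero_of_notMem hK.isClosed h hx, herm_zero_right]
  have hi1 : Integrable (fun x => d.hermForm (d.nabla u x) (Ψ x)) (riemannianVolume I M) :=
    d.integrable_of_continuousOn hK ((d.contMDiffOn_hermForm hU (d.smoothFormOn_nabla hU hu)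
      hΨ).continuousOn.mono hKU') hz1
  have hi2 := d.integrable_herm hU hu (d.smoothOn_nablaStar hU hΨ) hK hKU' hz2
  refine ⟨hi1, hi2, sub_eq_zero.1 ?_⟩
  rw [← integral_sub hi1 hi2]
  -- The divergence theorem concerns real vector fields, so the complex integral is tested with real
  -- functionals; real and imaginary part suffice in the end.
  have key : ∀ L : ℂ →L[ℝ] ℝ, L (∫ x, (d.hermForm (d.nabla u x) (Ψ x) -
      herm (u x) (d.nablaStar Ψ x)) ∂(riemannianVolume I M)) = 0 := by
    intro L
    obtain ⟨hs, hd⟩ := d.divX_sharp_herm hU hu hΨ L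
    have hs0 : ∀ x ∉ K, d.sharp (fun y => L.toLinearMap ∘ₗ hermL (u y) ∘ₗ Ψ y) x = 0 := by
      intro x hx
      refine Finset.sum_eq_zero fun i _ => ?_
      rcases h0 with h | h
      · simp [h x hx]
      · simp [h x hx]
    -- The dual field is smooth only on `U`. It vanishes off `K`, whichever of `u` and Ψ does, and
    -- so is smooth on all of `M`.
    have hdiv := (d.integral_divX (hs.extend_zero hU hK.isClosed hKU' hs0) hK
      (fun x hx => (hKU hx).2) hs0).2
    refine (L.integral_comp_comm (hi1.sub hi2)).symm.trans ?_
    rw [← hdiv]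
    congr 1
    funext x
    by_cases hx : x ∈ K
    · exact (hd x (hKU' hx)).symm
    · rw [Pi.sub_apply, d.divX_eq_zero_of_notMem hK.isClosed hs0 hx, hz1 x hx, hz2 x hx, sub_zero,
        map_zero]
  exact Complex.ext (key Complex.reCLM) (key Complex.imCLM)

theorem isFormalAdjointForm_nabla : d.IsFormalAdjointForm d.nabla d.nablaStar :=
  ⟨fun _ hu => d.smoothFormOn_nabla isOpen_univ hu,
    fun _ hΨ => d.smoothOn_nablaStar isOpen_univ hΨ,
    fun _ _ hu hΨ _ hK hKI h0 => d.integral_hermForm_nabla isOpen_univ hu hΨ hK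
      (fun x hx => ⟨Set.mem_univ x, hKI hx⟩) h0⟩

/-- Both pairings change by the same pointwise term, because c(k(v, ·)) σ is Hermitian. -/
theorem isFormalAdjointForm_nablaT : d.IsFormalAdjointForm d.nablaT d.nablaTStar := by
  refine ⟨fun _ hu => d.smoothFormOn_nablaT isOpen_univ hu,
    fun _ hΨ => d.smoothOn_nablaTStar isOpen_univ hΨ, fun u Ψ hu hΨ K hK hKI h0 => ?_⟩
  obtain ⟨h1, h2, h3⟩ := d.isFormalAdjointForm_nabla.2.2 u Ψ hu hΨ K hK hKI h0
  have hi := d.integrable_herm isOpen_univ hu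
    ((d.smoothOn_sum_cK hΨ).const_smul (1 / 2)) hK (Set.subset_univ K) (fun x hx => by
      rcases h0 with h | h
      · rw [h x hx, herm_zero_left]
      · simp only [h x hx, LinearMap.zero_apply, map_zero, Finset.sum_const_zero, smul_zero,
          herm_zero_right])
  have e1 : (fun x => d.hermForm (d.nablaT u x) (Ψ x)) = fun x => d.hermForm (d.nabla u x) (Ψ x) -
      herm (u x) ((1 / 2 : ℝ) • ∑ i, d.cK (d.e x i x) (sigL (Ψ x (d.e x i x)))) := by
    funext x
    simp only [hermForm, nablaT_apply, herm_eq_hermL, map_sub, map_sum, map_smul,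
      LinearMap.sub_apply, LinearMap.smul_apply, Finset.sum_sub_distrib, Finset.smul_sum]
    congr 1
    refine Finset.sum_congr rfl fun i _ => ?_
    rw [← herm_eq_hermL, herm_c_sigL]
    rfl
  have e2 : (fun x => herm (u x) (d.nablaTStar Ψ x)) = fun x => herm (u x) (d.nablaStar Ψ x) -
      herm (u x) ((1 / 2 : ℝ) • ∑ i, d.cK (d.e x i x) (sigL (Ψ x (d.e x i x)))) := by
    funext x
    rw [nablaTStar_eq, herm_eq_hermL, map_sub]
    rfl
  rw [e1, e2]
  exact ⟨h1.sub hi, h2.sub hi, by rw [integral_sub h1 hi, integral_sub h2 hi, h3]⟩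

lemma IsFormalAdjointOn.add {d : SpinInitialData I M F V κ}
    {P Q P' Q' : (Π x : M, SFiber n V x) → (Π x : M, SFiber n V x)}
    (h : d.IsFormalAdjointOn U P Q) (h' : d.IsFormalAdjointOn U P' Q') :
    d.IsFormalAdjointOn U (fun u x => P u x + P' u x) (fun u x => Q u x + Q' u x) := by
  refine ⟨fun u hu => ⟨(h.1 u hu).1.add (h'.1 u hu).1, (h.1 u hu).2.add (h'.1 u hu).2⟩,
    fun u v hu hv K hK hKU h0 => ?_⟩
  obtain ⟨h1, h2, h3⟩ := h.2 u v hu hv K hK hKU h0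
  obtain ⟨k1, k2, k3⟩ := h'.2 u v hu hv K hK hKU h0
  simp only [herm_add_left, herm_add_right]
  exact ⟨h1.add k1, h2.add k2, by rw [integral_add h1 k1, integral_add h2 k2, h3, k3]⟩

/-- A smooth self-adjoint endomorphism field is its own formal adjoint. -/
lemma isFormalAdjointOn_of_herm (hU : IsOpen U)
    (A : Π x : M, SFiber n V x →ₗ[ℝ] SFiber n V x)
    (hA : ∀ u, d.SmoothOn u U → d.SmoothOn (fun x => A x (u x)) U)
    (hs : ∀ x (z w : SFiber n V x), herm (A x z) w = herm z (A x w)) :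
    d.IsFormalAdjointOn U (fun u x => A x (u x)) (fun u x => A x (u x)) := by
  refine ⟨fun u hu => ⟨hA u hu, hA u hu⟩, fun u v hu hv K hK hKU h0 => ?_⟩
  have hi := d.integrable_herm hU hu (hA v hv) hK (fun x hx => (hKU hx).1) (fun x hx => by
    rcases h0 with h | h
    · rw [h x hx, herm_zero_left]
    · rw [h x hx, map_zero, herm_zero_right])
  simp only [hs]
  exact ⟨hi, hi, trivial⟩

/-- Integration by parts with Ψ = g(X, ·) v. Differentiating the coefficient g(X, eᵢ) in ∇*Ψ and
tracing yields the divergence of `X`. -/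
theorem isFormalAdjointOn_nabla (hU : IsOpen U)
    (hX : SmoothSectionOn I (EuclideanSpace ℝ (Fin n)) X U) :
    d.IsFormalAdjointOn U (fun u x => d.nabla u x (X x))
      (fun u x => -d.nabla u x (X x) - d.divX X x • u x) := by
  refine ⟨fun u hu => ⟨d.smoothOn_nabla hU hX hu,
    (d.smoothOn_nabla hU hX hu).neg.sub (hu.smul (d.smooth_divX hU hX))⟩,
    fun u v hu hv K hK hKU h0 => ?_⟩
  let Ψ : Π x : M, TangentSpace I x →ₗ[ℝ] SFiber n V x := fun x =>
    ((innerSL ℝ (X x) : TangentSpace I x →L[ℝ] ℝ) : TangentSpace I x →ₗ[ℝ] ℝ).smulRight (v x)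
  have hΨa : ∀ x w, Ψ x w = (inner ℝ (X x) w : ℝ) • v x := fun x w => rfl
  have hΨ : d.SmoothFormOn Ψ U := fun α i => (hv.mono Set.inter_subset_right).smul
    (smooth_inner_tangent (hX.mono Set.inter_subset_right)
      ((d.spin.smooth_frame α i).mono Set.inter_subset_left))
  have h0' : (∀ x ∉ K, u x = 0) ∨ (∀ x ∉ K, Ψ x = 0) := h0.imp_right fun h x hx => by
    ext1 w
    rw [hΨa, h x hx, smul_zero, LinearMap.zero_apply]
  have key := d.integral_hermForm_nabla hU hu hΨ hK hKU h0'
  have hsum : ∀ (x : M) (L : TangentSpace I x →ₗ[ℝ] SFiber n V x),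
      ∑ i, (inner ℝ (X x) (d.e x i x) : ℝ) • L (d.e x i x) = L (X x) := by
    intro x L
    conv_rhs => rw [← d.sum_inner_smul (d.spin.mem_baseSet_at x) (X x)]
    rw [map_sum]
    refine Finset.sum_congr rfl fun i _ => ?_
    rw [map_smul, real_inner_comm]
    rfl
  have e1 : (fun x => d.hermForm (d.nabla u x) (Ψ x)) =
      fun x => herm (d.nabla u x (X x)) (v x) := by
    funext x
    rw [← hsum x (d.nabla u x)]
    simp only [hermForm, hΨa, herm_eq_hermL, map_smul, map_sum, LinearMap.sum_apply,
      LinearMap.smul_apply]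
  have e2 : (fun x => herm (u x) (d.nablaStar Ψ x)) =
      fun x => herm (u x) (-d.nabla v x (X x) - d.divX X x • v x) := by
    funext x
    -- The Leibniz rule needs smoothness, available on `U` and hence on `K`; off `K` both sides
    -- vanish.
    by_cases hx : x ∈ K
    · congr 1
      have hxU := (hKU hx).1
      set α := d.spin.indexAt x
      have hW := (d.spin.isOpen_baseSet α).inter hU
      have hxW : x ∈ d.spin.baseSet α ∩ U := ⟨d.spin.mem_baseSet_at x, hxU⟩
      have hX' := hX.mono (Set.inter_subset_right (s := d.spin.baseSet α))
      have hs := fun i => (d.spin.smooth_frame α i).mono (Set.inter_subset_left (t := U))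
      have hv' := hv.mono (Set.inter_subset_right (s := d.spin.baseSet α))
      rw [nablaStar_eq, ← hsum x (d.nabla v x), divX, Finset.sum_smul, ← neg_add',
        ← Finset.sum_add_distrib]
      congr 1
      refine Finset.sum_congr rfl fun i _ => ?_
      have h1 := d.nabla_smul hW hxW (smooth_inner_tangent hX' (hs i)) hv' (d.e x i x)
      rw [d.mvfderiv_inner hW hxW hX' (hs i), add_smul] at h1
      simp only [covForm, hΨa]
      refine (congrArg (· - _) h1).trans ?_
      simp only [e]
      abel
    · rcases h0 with h | h
      · rw [h x hx, herm_zero_left, herm_zero_left]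
      · rw [d.nablaStar_eq_zero_of_notMem hK.isClosed (fun y hy => by
          ext1 w
          rw [hΨa, h y hy, smul_zero, LinearMap.zero_apply]) hx,
          d.nabla_eq_zero_of_notMem hK.isClosed h hx, h x hx, smul_zero, neg_zero, sub_zero]
  rwa [e1, e2] at key

theorem isFormalAdjointOn_nablaT (hU : IsOpen U)
    (hX : SmoothSectionOn I (EuclideanSpace ℝ (Fin n)) X U) :
    d.IsFormalAdjointOn U (fun u x => d.nablaT u x (X x))
      (fun u x => -d.nablaT u x (X x) - d.c (d.kForm (X x)) (sig (u x)) - d.divX X x • u x) := by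
  have h := (d.isFormalAdjointOn_nabla hU hX).add (d.isFormalAdjointOn_of_herm hU
    -- The Hermitian term -½ c(k(X, ·)) σ is added to ∇_X and to its adjoint. Written with -∇̃_X,
    -- which contains +½ of it, the adjoint acquires the full -c(k(X, ·)) σ.
    (fun x => (-1 / 2 : ℝ) • d.cK (X x) ∘ₗ sigL)
    (fun u hu => (d.smooth_c_kForm hX hu.sigL).const_smul (-1 / 2)) fun x z w => by
      simp only [LinearMap.smul_apply, LinearMap.comp_apply, herm_smul_left, herm_smul_right,
        cK_apply, herm_c_sigL])
  convert h using 3 with u x u x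
  · simp only [nablaT_apply, LinearMap.smul_apply, LinearMap.comp_apply, cK_apply]
    module
  · simp only [nablaT_apply, LinearMap.smul_apply, LinearMap.comp_apply, cK_apply, sig_eq_sigL]
    module

/-- Integration by parts with Ψ = c(·) v. Clifford multiplication is skew-Hermitian and parallel, so
both sides become minus the pairings with D. -/
theorem isFormalAdjointOn_D : d.IsFormalAdjointOn Set.univ d.D d.D := by
  refine ⟨fun u hu => ⟨d.smoothOn_D isOpen_univ hu, d.smoothOn_D isOpen_univ hu⟩,
    fun u v hu hv K hK hKU h0 => ?_⟩
  let Ψ : Π x : M, TangentSpace I x →ₗ[ℝ] SFiber n V x := fun x => d.cv.flip (v x)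
  have hΨ : d.SmoothFormOn Ψ Set.univ := fun α i => (hv.mono Set.inter_subset_right).cv
    ((d.spin.smooth_frame α i).mono Set.inter_subset_left)
  have h0' : (∀ x ∉ K, u x = 0) ∨ (∀ x ∉ K, Ψ x = 0) := h0.imp_right fun h x hx => by
    simp only [Ψ, h x hx, map_zero]
  have key := d.integral_hermForm_nabla isOpen_univ hu hΨ hK hKU h0'
  have e1 : (fun x => d.hermForm (d.nabla u x) (Ψ x)) = fun x => -herm (d.D u x) (v x) := by
    funext x
    simp only [D, c_coframe, herm_eq_hermL, map_sum, LinearMap.sum_apply, hermForm]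
    simp only [← herm_eq_hermL, d.herm_cv, Finset.sum_neg_distrib, neg_neg]
    rfl
  have e2 : (fun x => herm (u x) (d.nablaStar Ψ x)) = fun x => -herm (u x) (d.D v x) := by
    funext x
    rw [nablaStar_eq, herm_eq_hermL, map_neg, ← herm_eq_hermL]
    congr 2
    refine Finset.sum_congr rfl fun i _ => ?_
    have h1 := d.nabla_cv (d.spin.isOpen_baseSet (d.spin.indexAt x)) (d.spin.mem_baseSet_at x)
      (d.spin.smooth_frame (d.spin.indexAt x) i) (hv.mono (Set.subset_univ _)) (d.e x i x)
    rw [c_coframe]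
    exact sub_eq_iff_eq_add'.2 h1
  rw [e1, e2, integral_neg, integral_neg, neg_inj] at key
  exact ⟨integrable_neg_iff.1 key.1, integrable_neg_iff.1 key.2.1, key.2.2⟩

theorem isFormalAdjointOn_DT : d.IsFormalAdjointOn Set.univ d.DT d.DT := by
  have h := d.isFormalAdjointOn_D.add (d.isFormalAdjointOn_of_herm isOpen_univ
    (fun x => (d.trK x / 2) • sigL) (fun u hu => (hu.sigL.smul d.smooth_trK_div_two).congr
      fun y _ => LinearMap.smul_apply _ _ _) fun x z w => by
      simp only [LinearMap.smul_apply, herm_smul_left, herm_smul_right, herm_sigL])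
  have e : d.DT = fun u x => d.D u x + ((d.trK x / 2) • sigL) (u x) := by
    funext u x
    rw [DT_eq, sig_eq_sigL, LinearMap.smul_apply]
  rw [e]
  exact h

end

end SpinInitialData

end

/-! ### The assembled theorem -/

theorem mainTheorem8 {n : ℕ} {H : Type*} [TopologicalSpace H]
    (I : ModelWithCorners ℝ (EuclideanSpace ℝ (Fin n)) H)
    (M : Type*) [TopologicalSpace M] [ChartedSpace H M] [IsManifold I ∞ M]
    [T2Space M] [SigmaCompactSpace M] [MeasurableSpace M] [BorelSpace M]
    [RiemannianBundle (fun x : M => TangentSpace I x)]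
    [IsContMDiffRiemannianBundle I ∞ (EuclideanSpace ℝ (Fin n)) (fun x : M => TangentSpace I x)]
    (F : Type*) [NormedAddCommGroup F] [NormedSpace ℂ F] [FiniteDimensional ℂ F]
    (V : M → Type*) [TopologicalSpace (TotalSpace F V)]
    [∀ x, NormedAddCommGroup (V x)] [∀ x, InnerProductSpace ℂ (V x)]
    [FiberBundle F V] [VectorBundle ℂ F V] [VectorBundle ℝ F V] [ContMDiffVectorBundle ∞ F V I]
    (κ : Type*) (d : SpinInitialData I M F V κ) :
    -- (i)
    (∀ u, d.SmoothOn u Set.univ →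
      (∀ x (v : TangentSpace I x), d.nablaT u x v =
        d.nabla u x v + (1 / 2 : ℝ) • SpinInitialData.sig (d.c (d.kForm v) (u x))) ∧
      (∀ x, d.DT u x = d.D u x + (d.trK x / 2) • SpinInitialData.sig (u x))) ∧
    -- (ii)
    (∀ (U : Set M) (X : Π x : M, TangentSpace I x), IsOpen U →
      SmoothSectionOn I (EuclideanSpace ℝ (Fin n)) X U →
      d.IsFormalAdjointOn U (fun u x => d.nabla u x (X x))
        (fun u x => -d.nabla u x (X x) - d.divX X x • u x) ∧
      d.IsFormalAdjointOn U (fun u x => d.nablaT u x (X x))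
        (fun u x => -d.nablaT u x (X x) - d.c (d.kForm (X x)) (SpinInitialData.sig (u x))
          - d.divX X x • u x)) ∧
    d.IsFormalAdjointForm d.nabla d.nablaStar ∧
    d.IsFormalAdjointForm d.nablaT d.nablaTStar ∧
    d.IsFormalAdjointOn Set.univ d.D d.D ∧
    d.IsFormalAdjointOn Set.univ d.DT d.DT ∧
    -- (iii)
    (∀ u, d.SmoothOn u Set.univ → ∀ x,
      d.D (d.D u) x = d.nablaStar (d.nabla u) x + d.Rcurv u x ∧
      d.DT (d.DT u) x = d.nablaTStar (d.nablaT u) x + d.RcurvT u x) := by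
  exact ⟨fun u _ => ⟨fun x v => d.nablaT_eq u x v, fun x => d.DT_eq u x⟩,
    fun U X hU hX => ⟨d.isFormalAdjointOn_nabla hU hX, d.isFormalAdjointOn_nablaT hU hX⟩,
    d.isFormalAdjointForm_nabla, d.isFormalAdjointForm_nablaT, d.isFormalAdjointOn_D,
    d.isFormalAdjointOn_DT, fun u hu x => ⟨d.D_D hu x, d.DT_DT hu x⟩⟩
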